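/- Let $\phi:[0,\infty)\to[0,\infty)$ be integrable with $\int_0^\infty\phi(t)\,dt=1$ and $\sigma:=\int_0^\infty t\,\phi(t)\,dt<\infty$ (the kernel of a weakly critical Hawkes process). Put $\Phi(t):=\int_t^\infty\phi(s)\,ds$ for $t\ge 0$ and $\Psi_2(\infty):=\int_0^\infty s^2\phi(s)\,ds\in(0,\infty]$. Let $R\in L^1_{\rm loc}([0,\infty))$ be the resolvent of $\phi$, i.e. the (a.e. unique) solution of $$R(t)=\phi(t)+\int_0^t R(t-s)\phi(s)\,ds\qquad\text{for a.e. } t\ge 0 .$$ For $n\in\mathbb N$ let $R^{(n)}(t):=R(nt)$, let $R^*(t):=1/\sigma$, and let $\mathcal I_f(t):=\int_0^t f(s)\,ds$. Write $\|\cdot\|_{L^p_T}$ for the norm of $L^p([0,T])$. For $\rho\in\mathbb R$ write $\Phi\in{\rm RV}^\infty_\rho$ if $\Phi$ is regularly varying at infinity with index $\rho$, i.e. $\Phi$ is eventually of one strict sign and $\Phi(tx)/\Phi(t)\to x^\rho$ as $t\to\infty$ for every $x>0$. (i) For each $T>0$ there is a constant $C>0$ such that for all integers $n\ge1$ $$\big\|\mathcal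 I_{R^{(n)}}-\mathcal I_{R^*}\big\|_{L^\infty_T}\le\begin{cases}C\,n^{-1/3}, & \text{if }\Psi_2(\infty)<\infty,\\ C\,|n\Phi(n)|^{1/3}, & \text{if }\Phi\in{\rm RV}^\infty_{-\alpha-1}\text{ with }\alpha\in(0,1).\end{cases}$$ (ii) If in addition $\phi$ has bounded variation on $[0,\infty)$, then for each $T>0$ and $\ell\in(0,1/2)$ there is a constant $C>0$ such that for all integers $n\ge1$ both $\|\mathcal I_{R^{(n)}}-\mathcal I_{R^*}\|_{L^2_T}$ and $\|R^{(n)}-R^*\|_{L^2_T}$ are at most $$\begin{cases}C\,n^{-1/2}, & \text{if }\Psi_2(\infty)<\infty,\\ C\,n\Phi(n), & \text{if }\Phi\in{\rm RV}^\infty_{-\alpha-1}\text{ with }\alpha\in(0,1/2),\\ C\,n^{\alpha+\ell+1/2}\,\Phi(n), & \text{if }\Phi\in{\rm RV}^\infty_{-\alpha-1}\text{ with }\alpha\in[1/2,1).\end{cases}$$ -/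

import Mathlib

open MeasureTheory Set Filter Topology
open scoped ENNReal

/-- The tail function `Φ(t) = ∫_t^∞ φ(s) ds` of a kernel `φ`. -/
noncomputable def tailPhi (φ : ℝ → ℝ) (t : ℝ) : ℝ :=
  ∫ s in Ioi t, φ s

/-- `Ψ_k(∞) = ∫_0^∞ s^k φ(s) ds ∈ [0, ∞]`, for a nonnegative kernel `φ`. -/
noncomputable def psiInfty (φ : ℝ → ℝ) (k : ℕ) : ℝ≥0∞ :=
  ∫⁻ s in Ioi (0 : ℝ), ENNReal.ofReal (s ^ k * φ s)

/-- The kernel of a weakly critical Hawkes process: `φ ∈ L¹(ℝ₊; ℝ₊)` with `m = ‖φ‖_{L¹} = 1`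
and finite dispersion coefficient `σ = Ψ_1(∞) < ∞`. Only the values of `φ` on `[0, ∞)` matter. -/
structure WeaklyCriticalKernel (φ : ℝ → ℝ) : Prop where
  nonneg : ∀ t, 0 ≤ t → 0 ≤ φ t
  integrable : IntegrableOn φ (Ici 0)
  mass_eq_one : ∫ t in Ioi (0 : ℝ), φ t = 1
  dispersion_lt_top : psiInfty φ 1 < ∞

/-- The dispersion coefficient `σ = Ψ_1(∞)` as a real number (used when it is finite). -/
noncomputable def dispersion (φ : ℝ → ℝ) : ℝ :=
  (psiInfty φ 1).toReal

/-- `R` is the resolvent of `φ`: the locally integrable solution on `[0, ∞)`, unique up to null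
sets, of the linear Volterra equation `R = φ + R * φ`. -/
structure IsResolvent (φ R : ℝ → ℝ) : Prop where
  locallyIntegrable : ∀ T : ℝ, IntegrableOn R (Icc 0 T)
  equation : ∀ᵐ t ∂(volume.restrict (Ici (0 : ℝ))),
    R t = φ t + ∫ s in (0 : ℝ)..t, R (t - s) * φ s

/-- The integral function `I_f(t) = ∫_0^t f(s) ds`. -/
noncomputable def integralFn (f : ℝ → ℝ) (t : ℝ) : ℝ :=
  ∫ s in (0 : ℝ)..t, f s

/-- The rescaled resolvent `R⁽ⁿ⁾(t) = R(nt)`. -/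
def rescaled (R : ℝ → ℝ) (n : ℕ) (t : ℝ) : ℝ :=
  R (n * t)

/-- The limit `R* ≡ 1/σ`. -/
noncomputable def limitResolvent (φ : ℝ → ℝ) (_t : ℝ) : ℝ :=
  1 / dispersion φ

/-- The norm `‖f‖_{L^p_T}` of `L^p([0, T]; ℝ)`, with values in `[0, ∞]`. -/
noncomputable def normLp (p : ℝ≥0∞) (T : ℝ) (f : ℝ → ℝ) : ℝ≥0∞ :=
  eLpNorm f p (volume.restrict (Icc 0 T))

/-- `f ∈ RV_ρ^∞`: `f` is regularly varying at infinity with index `ρ`. -/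
def IsRegularlyVarying (f : ℝ → ℝ) (ρ : ℝ) : Prop :=
  ((∀ᶠ t in atTop, 0 < f t) ∨ (∀ᶠ t in atTop, f t < 0)) ∧
    ∀ x : ℝ, 0 < x → Tendsto (fun t => f (t * x) / f t) atTop (𝓝 (x ^ ρ))

/-- Well-posedness of the resolvent: every nonnegative integrable kernel has one (the Neumann
series), so quantifying over the resolvents of a kernel is never vacuous. -/
theorem exists_isResolvent (φ : ℝ → ℝ) (h0 : ∀ t, 0 ≤ t → 0 ≤ φ t)
    (hi : IntegrableOn φ (Ici 0)) : ∃ R : ℝ → ℝ, IsResolvent φ R := by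
  have hm0 : AEMeasurable φ (volume.restrict (Ici 0)) := hi.aestronglyMeasurable.aemeasurable
  set g : ℝ → ℝ≥0∞ := (Ici (0 : ℝ)).indicator (fun t => ENNReal.ofReal (hm0.mk φ t)) with hg
  have hgm : Measurable g := (hm0.measurable_mk.ennreal_ofReal).indicator measurableSet_Ici
  have hgneg : ∀ t, t < 0 → g t = 0 := fun t ht => by
    simp [hg, not_le.mpr ht]
  have hgtop : ∀ t, g t ≠ ∞ := fun t => by
    by_cases ht : 0 ≤ t <;> simp [hg, ht]
  have hgφ : ∀ᵐ t ∂(volume.restrict (Ici (0 : ℝ))), (g t).toReal = φ t := by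
    filter_upwards [hm0.ae_eq_mk, ae_restrict_mem measurableSet_Ici] with t ht ht0
    rw [hg, indicator_of_mem ht0, ← ht, ENNReal.toReal_ofReal (h0 t ht0)]
  have hgint : ∫⁻ t, g t ≠ ∞ := by
    rw [hg, lintegral_indicator measurableSet_Ici]
    have : ∫⁻ t in Ici 0, ENNReal.ofReal (hm0.mk φ t) = ∫⁻ t in Ici 0, ENNReal.ofReal (φ t) := by
      refine lintegral_congr_ae ?_
      filter_upwards [hm0.ae_eq_mk] with t ht
      rw [ht]
    rw [this]
    exact (hi.lintegral_lt_top).ne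
  -- an exponential weight that makes the kernel subcritical
  obtain ⟨b, hb⟩ : ∃ b : ℕ, ∫⁻ t, ENNReal.ofReal (Real.exp (-(b * t))) * g t < 1 := by
    have hlim : Tendsto (fun b : ℕ => ∫⁻ t, ENNReal.ofReal (Real.exp (-(b * t))) * g t) atTop
        (𝓝 (∫⁻ _ : ℝ, 0)) := by
      refine tendsto_lintegral_of_dominated_convergence g ?_ ?_ hgint ?_
      · intro b
        exact (by fun_prop : Measurable fun t : ℝ => ENNReal.ofReal (Real.exp (-(b * t)))).mul hgm
      · intro b
        refine Eventually.of_forall fun t => ?_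
        by_cases ht : t < 0
        · simp [hgneg t ht]
        · refine mul_le_of_le_one_left (zero_le) ?_
          rw [ENNReal.ofReal_le_one, Real.exp_le_one_iff]
          have : 0 ≤ (b : ℝ) * t := mul_nonneg (Nat.cast_nonneg b) (not_lt.mp ht)
          linarith
      · have hne : ∀ᵐ t : ℝ, t ≠ 0 := by simp [ae_iff]
        filter_upwards [hne] with t ht
        by_cases htn : t < 0
        · simp [hgneg t htn]
        · have htp : 0 < t := lt_of_le_of_ne (not_lt.mp htn) (Ne.symm ht)
          have h1 : Tendsto (fun b : ℕ => Real.exp (-(b * t))) atTop (𝓝 0) :=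
            Real.tendsto_exp_neg_atTop_nhds_zero.comp
              (tendsto_natCast_atTop_atTop.atTop_mul_const htp)
          have h2 := ENNReal.tendsto_ofReal h1
          rw [ENNReal.ofReal_zero] at h2
          simpa using ENNReal.Tendsto.mul_const h2 (Or.inr (hgtop t))
    rw [lintegral_zero] at hlim
    exact (hlim.eventually (gt_mem_nhds one_pos)).exists
  set w : ℝ → ℝ≥0∞ := fun t => ENNReal.ofReal (Real.exp (-(b * t))) with hw
  have hwm : Measurable w := by fun_prop
  have hwadd : ∀ s t, w (s + t) = w s * w t := fun s t => by
    simp only [hw]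
    rw [← ENNReal.ofReal_mul (Real.exp_pos _).le, ← Real.exp_add]
    congr 2
    ring
  set q : ℝ≥0∞ := ∫⁻ t, w t * g t with hq
  let K : (ℝ → ℝ≥0∞) → ℝ → ℝ≥0∞ := fun u t => ∫⁻ s, u (t - s) * g s
  let u : ℕ → ℝ → ℝ≥0∞ := fun k => K^[k] g
  have hus : ∀ k, u (k + 1) = K (u k) := fun k => Function.iterate_succ_apply' K k g
  have hKm : ∀ v, Measurable v → Measurable (K v) := fun v hv => by
    have h1 : Measurable fun p : ℝ × ℝ => v (p.1 - p.2) * g p.2 :=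
      (hv.comp (by fun_prop)).mul (hgm.comp measurable_snd)
    exact h1.lintegral_prod_right'
  have hum : ∀ k, Measurable (u k) := fun k => by
    induction k with
    | zero => exact hgm
    | succ k ih => rw [hus]; exact hKm _ ih
  have hKneg : ∀ v, (∀ t, t < 0 → v t = 0) → ∀ t, t < 0 → K v t = 0 := fun v hv t ht => by
    have : ∀ s, v (t - s) * g s = 0 := fun s => by
      by_cases hs : s < 0
      · simp [hgneg s hs]
      · rw [hv (t - s) (by linarith [not_lt.mp hs]), zero_mul]
    simp [K, this]
  have huneg : ∀ k, ∀ t, t < 0 → u k t = 0 := fun k => by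
    induction k with
    | zero => exact hgneg
    | succ k ih => rw [hus]; exact hKneg _ ih
  have hwK : ∀ v, Measurable v → ∫⁻ t, w t * K v t = (∫⁻ t, w t * v t) * q := fun v hv => by
    have h1 : ∀ t, w t * K v t = ∫⁻ s, (w (t - s) * v (t - s)) * (w s * g s) := fun t => by
      simp only [K]
      rw [← lintegral_const_mul]
      · refine lintegral_congr fun s => ?_
        have : w t = w (t - s) * w s := by rw [← hwadd, sub_add_cancel]
        rw [this]
        ring
      · exact (hv.comp (by fun_prop)).mul hgm
    simp_rw [h1]
    rw [lintegral_lintegral_swap]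
    · have h2 : ∀ s, ∫⁻ t, (w (t - s) * v (t - s)) * (w s * g s)
          = (∫⁻ t, w t * v t) * (w s * g s) := fun s => by
        rw [lintegral_mul_const, lintegral_sub_right_eq_self (fun t => w t * v t) s]
        exact (hwm.mul hv).comp (by fun_prop)
      simp_rw [h2]
      exact lintegral_const_mul _ (hwm.mul hgm)
    · refine Measurable.aemeasurable ?_
      exact ((hwm.mul hv).comp (by fun_prop : Measurable fun p : ℝ × ℝ => p.1 - p.2)).mul
        ((hwm.mul hgm).comp measurable_snd)
  have hwu : ∀ k, ∫⁻ t, w t * u k t = q * q ^ k := fun k => by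
    induction k with
    | zero => simp [u, hq]
    | succ k ih => rw [hus, hwK _ (hum k), ih, pow_succ]; ring
  let S : ℝ → ℝ≥0∞ := fun t => ∑' k, u k t
  have hSm : Measurable S := Measurable.tsum hum
  have hSneg : ∀ t, t < 0 → S t = 0 := fun t ht => by simp [S, huneg _ t ht]
  have hSeq : ∀ t, S t = g t + K S t := fun t => by
    have h1 : S t = u 0 t + ∑' k, u (k + 1) t := tsum_eq_zero_add' ENNReal.summable
    have h2 : K S t = ∑' k, u (k + 1) t := by
      simp only [K, S, hus]
      rw [← lintegral_tsum]
      · simp_rw [ENNReal.tsum_mul_right]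
      · exact fun k => (((hum k).comp (by fun_prop)).mul hgm).aemeasurable
    rw [h1, h2]
    rfl
  have hSw : ∫⁻ t, w t * S t ≠ ∞ := by
    have : ∫⁻ t, w t * S t = ∑' k, q * q ^ k := by
      simp_rw [← hwu]
      refine Eq.trans ?_ (lintegral_tsum fun k => (hwm.mul (hum k)).aemeasurable)
      simp only [S, ENNReal.tsum_mul_left]
    rw [this, ENNReal.tsum_mul_left, ENNReal.tsum_geometric]
    refine ENNReal.mul_ne_top (hb.trans ENNReal.one_lt_top).ne ?_
    rw [ENNReal.inv_ne_top]
    exact (tsub_pos_of_lt hb).ne'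
  have hwpos : ∀ t, w t ≠ 0 := fun t => by
    simp only [hw, ne_eq, ENNReal.ofReal_eq_zero, not_le]
    exact Real.exp_pos _
  have hSfin : ∀ᵐ t, S t < ∞ := by
    filter_upwards [ae_lt_top (hwm.mul hSm) hSw] with t ht
    by_contra hcon
    rw [not_lt, top_le_iff] at hcon
    simp [hcon, ENNReal.mul_top (hwpos t)] at ht
  refine ⟨fun t => (S t).toReal, fun T => ?_, ?_⟩
  · refine integrable_toReal_of_lintegral_ne_top hSm.aemeasurable ?_
    have hle : ∫⁻ t in Icc 0 T, S t ≤
        ∫⁻ t in Icc 0 T, ENNReal.ofReal (Real.exp (b * T)) * (w t * S t) := by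
      refine setLIntegral_mono ((hwm.mul hSm).const_mul _) fun t ht => ?_
      rw [← mul_assoc]
      refine le_mul_of_one_le_left (zero_le) ?_
      simp only [hw]
      rw [← ENNReal.ofReal_mul (Real.exp_pos _).le, ← Real.exp_add, ENNReal.one_le_ofReal,
        Real.one_le_exp_iff]
      have := mul_le_mul_of_nonneg_left ht.2 (Nat.cast_nonneg (α := ℝ) b)
      linarith
    refine ne_top_of_le_ne_top ?_ hle
    refine ne_of_eq_of_ne (lintegral_const_mul _ (hwm.mul hSm)) ?_
    exact ENNReal.mul_ne_top ENNReal.ofReal_ne_top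
      (ne_top_of_le_ne_top hSw (setLIntegral_le_lintegral _ _))
  · filter_upwards [hgφ, ae_restrict_of_ae hSfin, ae_restrict_mem measurableSet_Ici]
      with t hgt hSt ht0
    have hKtop : K S t ≠ ∞ := by
      refine ne_top_of_le_ne_top hSt.ne ?_
      rw [hSeq t]
      exact le_add_self
    have hmm : Measurable fun s => S (t - s) * g s := (hSm.comp (by fun_prop)).mul hgm
    rw [hSeq t, ENNReal.toReal_add (hgtop t) hKtop, hgt]
    congr 1
    rw [← integral_toReal hmm.aemeasurable (ae_lt_top hmm hKtop),
      intervalIntegral.integral_of_le ht0, ← integral_Icc_eq_integral_Ioc,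
      ← setIntegral_eq_integral_of_forall_compl_eq_zero (s := Icc 0 t)]
    · refine setIntegral_congr_ae measurableSet_Icc ?_
      have h3 := (ae_restrict_iff' measurableSet_Ici).mp hgφ
      filter_upwards [h3] with s hs hst
      rw [ENNReal.toReal_mul, hs hst.1]
    · intro s hs
      rw [mem_Icc, not_and_or, not_le, not_le] at hs
      rcases hs with hs | hs
      · simp [hgneg s hs]
      · simp [hSneg (t - s) (by linarith)]

open scoped FourierTransform

/-! The kernel is a probability density `g` on the half-line with finite mean `σ`, and its resolvent
is the renewal density `u = g + g ⋆ u`. Let `H` be the Heaviside function, `P` the tail of `g` (so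
`P = Φ` on `[0, ∞)`) and `G` the tail integral of `P`. Splitting the mass of `g`, then of `P`, at a
point gives `P + H ⋆ g = H` and `G + H ⋆ P = σ H`. Combined with the renewal equation these become
`P + P ⋆ u = H` and `σ(1 + U(x)) = x + G(x) + (G ⋆ u)(x)` for `x ≥ 0`, where `U(x) = ∫_0^x u`.

Integrated error. The lower bound `x ≤ σ + σ U(x)` is immediate. For the upper one, `P` is bounded
below on some `[0, a]`, so `P ⋆ u ≤ H` bounds the `u`-mass of every window of length `a`; as `G`
decreases, `G ⋆ u` is then at most a constant times `1 + ∫_0^x G`. Hence `|U(x) - x/σ| ≤ K(1 + ∫_0^x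
G)`, and the integrated rescaled resolvent has error `n⁻¹ |U(nt) - nt/σ|` at time `t`. This holds
uniformly in `t ≤ T`, so it serves the sup norm and the `L²` norm alike, and it is stronger than the
cube-root rates claimed in (i).

Error of the resolvent itself. With `z = ε + 2πiξ` and hats for Laplace transforms at `z`, the
difference `A = u - H/σ` satisfies `(1 - ĝ) Â = ĝ - P̂/σ` and `P̂ Â = -(P̂ - Ĝ/σ)`. One of `|1 -
ĝ|`, `|P̂|` is bounded below, uniformly in `0 < ε ≤ 1` and `ξ`: the second near frequency zero, by
continuity, and the first elsewhere, because a density is non-lattice and its transform vanishes at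
infinity. Plancherel then bounds `∫ e^{-2εt} |A|²` by `C(1 + ∫ e^{-2εt} G²)`; bounded variation
enters through the boundedness of `g`, which places the functions in `L²`. Taking `ε = 1/n` makes
the weight harmless on `[0, nT]`.

Rates. What remains is to estimate `∫ e^{-t/n} G^p` for `p = 1, 2`. With a finite second moment, `G`
is bounded and integrable. If `Φ` is regularly varying, Potter's bounds and an upper Karamata
estimate give `G(t) ≤ K N^{α+1+δ} Φ(N) t^{-(α+δ)}` for `1 ≤ t ≤ N`. When `p(α+δ) < 1` the auxiliary
`δ` cancels after integration; for `p = 2` and `α ≥ 1/2` it survives, and is the `ℓ` of the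
statement. -/

/-! ### Convolution of `[0, ∞]`-valued functions, and tail integrals. -/

theorem lconvolution_add_right {f a b : ℝ → ℝ≥0∞} (hf : Measurable f) (ha : Measurable a) :
    f ⋆ₗ (a + b) = f ⋆ₗ a + f ⋆ₗ b := by
  ext x
  simp only [lconvolution_def, Pi.add_apply, mul_add]
  exact lintegral_add_left (by fun_prop) _

theorem lconvolution_add_left {f a b : ℝ → ℝ≥0∞} (hf : Measurable f) (ha : Measurable a) :
    (a + b) ⋆ₗ f = a ⋆ₗ f + b ⋆ₗ f := by
  rw [lconvolution_comm, lconvolution_add_right hf ha, lconvolution_comm,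
    lconvolution_comm (f := f) (g := b)]

theorem lconvolution_congr_left {f a b : ℝ → ℝ≥0∞} (h : a =ᵐ[volume] b) : a ⋆ₗ f = b ⋆ₗ f := by
  ext x
  simp only [lconvolution_def]
  refine lintegral_congr_ae ?_
  filter_upwards [h] with y hy
  rw [hy]

theorem lconvolution_congr_right {f a b : ℝ → ℝ≥0∞} (h : a =ᵐ[volume] b) : f ⋆ₗ a = f ⋆ₗ b := by
  rw [lconvolution_comm, lconvolution_congr_left h, lconvolution_comm]

theorem lconvolution_const_smul_left {f a : ℝ → ℝ≥0∞} (hf : Measurable f) (ha : Measurable a)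
    (c : ℝ≥0∞) : (c • a) ⋆ₗ f = c • (a ⋆ₗ f) := by
  ext x
  simp only [lconvolution_def, Pi.smul_apply, smul_eq_mul, mul_assoc]
  exact lintegral_const_mul _ (by fun_prop)

theorem lconvolution_mono_left {f a b : ℝ → ℝ≥0∞} (h : a ≤ b) : a ⋆ₗ f ≤ b ⋆ₗ f := fun x => by
  simp only [lconvolution_def]
  exact lintegral_mono fun y => mul_le_mul_left (h y) _

theorem lconvolution_mono_right {f a b : ℝ → ℝ≥0∞} (h : a ≤ b) : f ⋆ₗ a ≤ f ⋆ₗ b := by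
  rw [lconvolution_comm, lconvolution_comm (f := f) (g := b)]
  exact lconvolution_mono_left h

/-- The indicator function of `[0, ∞)`. -/
noncomputable def heaviside : ℝ → ℝ≥0∞ := (Ici (0 : ℝ)).indicator 1

/-- The tail integral `∫_t^∞ a` of a function on the half-line, extended by zero. -/
noncomputable def tailInt (a : ℝ → ℝ≥0∞) : ℝ → ℝ≥0∞ :=
  (Ici (0 : ℝ)).indicator fun t => ∫⁻ s in Ioi t, a s

theorem measurable_heaviside : Measurable heaviside :=
  measurable_const.indicator measurableSet_Ici

theorem heaviside_of_nonneg {t : ℝ} (ht : 0 ≤ t) : heaviside t = 1 :=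
  indicator_of_mem (mem_Ici.2 ht) _

theorem heaviside_of_neg {t : ℝ} (ht : t < 0) : heaviside t = 0 :=
  indicator_of_notMem (by simpa using ht) _

theorem heaviside_le_one (t : ℝ) : heaviside t ≤ 1 := by
  rcases lt_or_ge t 0 with h | h
  · simp [heaviside_of_neg h]
  · simp [heaviside_of_nonneg h]

theorem tailInt_of_nonneg (a : ℝ → ℝ≥0∞) {t : ℝ} (ht : 0 ≤ t) :
    tailInt a t = ∫⁻ s in Ioi t, a s :=
  indicator_of_mem (mem_Ici.2 ht) _

theorem tailInt_of_neg (a : ℝ → ℝ≥0∞) {t : ℝ} (ht : t < 0) : tailInt a t = 0 :=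
  indicator_of_notMem (by simpa using ht) _

theorem antitone_lintegral_Ioi (a : ℝ → ℝ≥0∞) : Antitone fun t => ∫⁻ s in Ioi t, a s :=
  fun _ _ h => lintegral_mono_set (Ioi_subset_Ioi h)

theorem measurable_tailInt (a : ℝ → ℝ≥0∞) : Measurable (tailInt a) :=
  (antitone_lintegral_Ioi a).measurable.indicator measurableSet_Ici

theorem tailInt_le (a : ℝ → ℝ≥0∞) (t : ℝ) : tailInt a t ≤ ∫⁻ s, a s := by
  rcases lt_or_ge t 0 with h | h
  · simp [tailInt_of_neg a h]
  · rw [tailInt_of_nonneg a h]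
    exact setLIntegral_le_lintegral _ _

theorem tailInt_anti (a : ℝ → ℝ≥0∞) {s t : ℝ} (hs : 0 ≤ s) (h : s ≤ t) :
    tailInt a t ≤ tailInt a s := by
  rw [tailInt_of_nonneg a hs, tailInt_of_nonneg a (hs.trans h)]
  exact antitone_lintegral_Ioi a h

theorem heaviside_lconvolution (a : ℝ → ℝ≥0∞) (x : ℝ) :
    (heaviside ⋆ₗ a) x = ∫⁻ y in Iic x, a y := by
  rw [lconvolution_comm, lconvolution_def, ← lintegral_indicator measurableSet_Iic]
  refine lintegral_congr fun y => ?_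
  by_cases h : y ≤ x
  · rw [indicator_of_mem (mem_Iic.2 h), heaviside_of_nonneg (by linarith), mul_one]
  · rw [indicator_of_notMem (by simpa using h), heaviside_of_neg (by linarith), mul_zero]

/-- The total mass is split at `x`. Used for `g` and then for its tail, this is the source of every
identity of renewal type below. -/
theorem tailInt_add_heaviside_lconvolution {a : ℝ → ℝ≥0∞} (ha : ∀ t, t < 0 → a t = 0) :
    tailInt a + heaviside ⋆ₗ a = (∫⁻ s, a s) • heaviside := by
  ext x
  rw [Pi.add_apply, heaviside_lconvolution, Pi.smul_apply, smul_eq_mul]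
  rcases lt_or_ge x 0 with h | h
  · rw [tailInt_of_neg a h, heaviside_of_neg h, mul_zero, zero_add,
      setLIntegral_congr_fun (g := fun _ => 0) measurableSet_Iic fun y hy => ha y (lt_of_le_of_lt hy h)]
    simp
  · rw [tailInt_of_nonneg a h, heaviside_of_nonneg h, mul_one, add_comm]
    have := lintegral_add_compl (μ := volume) a (measurableSet_Iic (a := x))
    rwa [compl_Iic] at this

/-! ### Renewal identities and the linear growth of the renewal function. -/

/-- A probability density `g` on `(0, ∞)` with finite mean and its renewal density `u`. -/
structure RenewalPair (g u : ℝ → ℝ≥0∞) : Prop where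
  meas_g : Measurable g
  meas_u : Measurable u
  g_zero : ∀ t, t ≤ 0 → g t = 0
  u_zero : ∀ t, t ≤ 0 → u t = 0
  mass : ∫⁻ t, g t = 1
  mean : ∫⁻ t, tailInt g t ≠ ∞
  finite : ∀ T : ℝ, ∫⁻ t in Iic T, u t ≠ ∞
  eq : u =ᵐ[volume] g + g ⋆ₗ u

namespace RenewalPair

variable {g u : ℝ → ℝ≥0∞}

/-- Convolve the renewal equation with the Heaviside function and insert the splitting of the mass
of `g`. The term `heaviside ⋆ₗ u` appears on both sides; it may be cancelled in `[0, ∞]` because it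
is finite at each point. -/
theorem tail_eq (h : RenewalPair g u) : tailInt g + tailInt g ⋆ₗ u = heaviside := by
  have hg := h.meas_g
  have hu := h.meas_u
  have hh := measurable_heaviside
  have hP := measurable_tailInt g
  have h1 : heaviside ⋆ₗ u = heaviside ⋆ₗ g + (heaviside ⋆ₗ g) ⋆ₗ u := by
    rw [← lconvolution_assoc hh hg hu, ← lconvolution_add_right hh hg]
    exact lconvolution_congr_right h.eq
  have h2 : tailInt g + heaviside ⋆ₗ g = heaviside := by
    rw [tailInt_add_heaviside_lconvolution fun t ht => h.g_zero t ht.le, h.mass, one_smul]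
  have h3 : heaviside ⋆ₗ u + (tailInt g + tailInt g ⋆ₗ u) = heaviside ⋆ₗ u + heaviside := by
    calc heaviside ⋆ₗ u + (tailInt g + tailInt g ⋆ₗ u)
        = (tailInt g + heaviside ⋆ₗ g) + (tailInt g ⋆ₗ u + (heaviside ⋆ₗ g) ⋆ₗ u) := by
          rw [h1]; abel
      _ = _ := by
          rw [← lconvolution_add_left hu hP, h2, add_comm]
  ext x
  have h4 := congrFun h3 x
  rw [Pi.add_apply, Pi.add_apply (heaviside ⋆ₗ u)] at h4
  refine (ENNReal.add_right_inj ?_).1 h4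
  rw [heaviside_lconvolution]
  exact h.finite x

/-- The same splitting one level up, for the tail of `g` in place of `g`, convolved with `u`. Since
`heaviside ⋆ₗ heaviside` is the positive part `x⁺`, this is the exact form of the law `∫_0^x u ≈
x/σ`. -/
theorem tail_tail_eq (h : RenewalPair g u) :
    (∫⁻ t, tailInt g t) • heaviside + (∫⁻ t, tailInt g t) • (heaviside ⋆ₗ u) =
      tailInt (tailInt g) + tailInt (tailInt g) ⋆ₗ u + heaviside ⋆ₗ heaviside := by
  have hu := h.meas_u
  have hh := measurable_heaviside
  have hP := measurable_tailInt g
  have hG := measurable_tailInt (tailInt g)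
  have h1 := tailInt_add_heaviside_lconvolution fun t ht => tailInt_of_neg g (t := t) ht
  rw [← lconvolution_const_smul_left hu hh, ← h1, lconvolution_add_left hu hG]
  rw [show heaviside ⋆ₗ heaviside = heaviside ⋆ₗ (tailInt g + tailInt g ⋆ₗ u) by rw [h.tail_eq]]
  rw [lconvolution_add_right hh hP, lconvolution_assoc hh hP hu]
  abel

/-- A uniform bound for the renewal measure of windows of length `a`. The tail of `g` is at least
its value `c` at `a` on all of `[0, a]`, and its convolution with `u` is at most `1` by `tail_eq`.
Some `a > 0` has `c ≠ 0`, since otherwise `g` would have no mass on `(0, ∞)`. -/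
theorem exists_window (h : RenewalPair g u) :
    ∃ a : ℝ, 0 < a ∧ ∃ c : ℝ≥0∞, c ≠ 0 ∧ c ≠ ∞ ∧
      c • ((Icc 0 a).indicator (1 : ℝ → ℝ≥0∞) ⋆ₗ u) ≤ heaviside := by
  obtain ⟨a, ha, hc⟩ : ∃ a : ℝ, 0 < a ∧ tailInt g a ≠ 0 := by
    by_contra! hcon
    have h1 : ∫⁻ t in Ioi (0 : ℝ), g t = 0 := by
      have : Ioi (0 : ℝ) = ⋃ n : ℕ, Ioi (1 / ((n : ℝ) + 1)) := by
        ext x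
        simp only [mem_Ioi, mem_iUnion]
        exact ⟨fun hx => exists_nat_one_div_lt hx, fun ⟨n, hn⟩ => lt_trans (by positivity) hn⟩
      rw [this, setLIntegral_iUnion_of_directed]
      · simp only [ENNReal.iSup_eq_zero]
        intro n
        have := hcon (1 / ((n : ℝ) + 1)) (by positivity)
        rwa [tailInt_of_nonneg g (by positivity)] at this
      · refine directed_of_isDirected_le fun m n hmn => Ioi_subset_Ioi ?_
        exact Nat.one_div_le_one_div hmn
    have h2 : ∫⁻ t, g t = ∫⁻ t in Ioi (0 : ℝ), g t := by
      rw [← lintegral_indicator measurableSet_Ioi]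
      refine lintegral_congr fun t => ?_
      by_cases ht : 0 < t
      · rw [indicator_of_mem (mem_Ioi.2 ht)]
      · rw [indicator_of_notMem (by simpa using ht), h.g_zero t (not_lt.1 ht)]
    rw [h.mass, h1] at h2
    exact one_ne_zero h2
  refine ⟨a, ha, tailInt g a, hc, ?_, ?_⟩
  · exact ne_top_of_le_ne_top (by simp [h.mass]) (tailInt_le g a)
  · rw [← lconvolution_const_smul_left h.meas_u (measurable_one.indicator measurableSet_Icc)]
    rw [← h.tail_eq]
    refine le_trans (lconvolution_mono_left fun t => ?_) le_add_self
    by_cases ht : t ∈ Icc 0 a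
    · simpa [ht] using tailInt_anti g ht.1 ht.2
    · simp [ht]

/-- The two-sided bound for the renewal function. -/
theorem bounds (h : RenewalPair g u) :
    ∃ K : ℝ≥0∞, K ≠ ∞ ∧ ∀ x : ℝ, 0 ≤ x →
      ENNReal.ofReal x ≤ (∫⁻ t, tailInt g t) + (∫⁻ t, tailInt g t) * ∫⁻ t in Iic x, u t ∧
      (∫⁻ t, tailInt g t) * ∫⁻ t in Iic x, u t ≤
        ENNReal.ofReal x + K * (1 + ∫⁻ t in Iic x, tailInt (tailInt g) t) := by
  obtain ⟨a, ha, c, hc0, hct, hc⟩ := h.exists_window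
  have hu := h.meas_u
  set S := ∫⁻ t, tailInt g t with hS
  set G := tailInt (tailInt g) with hGdef
  set k : ℝ → ℝ≥0∞ := (Icc 0 a).indicator 1 with hk
  have hkm : Measurable k := measurable_const.indicator measurableSet_Icc
  have hG : Measurable G := measurable_tailInt _
  have hA0 : ENNReal.ofReal a ≠ 0 := by simpa using ha
  -- Since `G` decreases, beyond `a` its value is at most its mean over the preceding window of
  -- length `a`; on `[0, a]` the bound `G ≤ S` is enough. This replaces `G ⋆ₗ u` by convolutions
  -- containing `k ⋆ₗ u`, which `exists_window` controls.
  have h1 : ENNReal.ofReal a • G ≤ (ENNReal.ofReal a * S) • k + k ⋆ₗ G := by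
    intro x
    simp only [Pi.smul_apply, Pi.add_apply, smul_eq_mul]
    rcases lt_or_ge x 0 with hx | hx
    · simp [hGdef, tailInt_of_neg _ hx]
    · by_cases hxa : x ≤ a
      · refine le_trans ?_ le_self_add
        rw [hk, indicator_of_mem (mem_Icc.2 ⟨hx, hxa⟩), Pi.one_apply, mul_one]
        exact mul_le_mul_right (tailInt_le _ _) _
      · refine le_trans ?_ le_add_self
        rw [lconvolution_def]
        calc ENNReal.ofReal a * G x = ∫⁻ y in Icc 0 a, G x := by
              simp [mul_comm]
          _ ≤ ∫⁻ y in Icc 0 a, k y * G (-y + x) := by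
              refine setLIntegral_mono (by fun_prop) fun y hy => ?_
              rw [hk, indicator_of_mem hy, Pi.one_apply, one_mul]
              exact tailInt_anti _ (by linarith [hy.2]) (by linarith [hy.1])
          _ ≤ _ := setLIntegral_le_lintegral _ _
  have h2 : ∀ x, 0 ≤ x → c * (ENNReal.ofReal a * (G ⋆ₗ u) x) ≤
      ENNReal.ofReal a * S + ∫⁻ t in Iic x, G t := by
    intro x hx
    have h3 := lconvolution_mono_left (f := u) h1
    rw [lconvolution_const_smul_left hu hG, lconvolution_add_left hu (hkm.const_smul _),
      lconvolution_const_smul_left hu hkm, lconvolution_comm (f := k) (g := G),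
      ← lconvolution_assoc hG hkm hu] at h3
    have h4 := lconvolution_mono_right (f := G) hc
    rw [lconvolution_comm, lconvolution_const_smul_left hG (measurable_lconvolution _ hkm hu),
      lconvolution_comm, lconvolution_comm (f := G) (g := heaviside)] at h4
    have h5 := h3 x
    have h6 := h4 x
    have h7 := hc x
    simp only [Pi.smul_apply, Pi.add_apply, smul_eq_mul, heaviside_lconvolution] at h5 h6 h7
    calc c * (ENNReal.ofReal a * (G ⋆ₗ u) x)
        ≤ c * (ENNReal.ofReal a * S * (k ⋆ₗ u) x + (G ⋆ₗ k ⋆ₗ u) x) := mul_le_mul_right h5 _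
      _ = ENNReal.ofReal a * S * (c * (k ⋆ₗ u) x) + c * (G ⋆ₗ k ⋆ₗ u) x := by ring
      _ ≤ ENNReal.ofReal a * S * 1 + ∫⁻ t in Iic x, G t :=
          add_le_add (mul_le_mul_right (h7.trans (heaviside_le_one x)) _) h6
      _ = _ := by rw [mul_one]
  have h8 : ∀ x, 0 ≤ x → (G ⋆ₗ u) x ≤ c⁻¹ * (ENNReal.ofReal a)⁻¹ * (1 + ENNReal.ofReal a * S) *
      (1 + ∫⁻ t in Iic x, G t) := by
    intro x hx
    have h9 : ENNReal.ofReal a * S + ∫⁻ t in Iic x, G t ≤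
        (1 + ENNReal.ofReal a * S) * (1 + ∫⁻ t in Iic x, G t) := by
      calc _ ≤ (1 + ENNReal.ofReal a * S * ∫⁻ t in Iic x, G t) +
          (ENNReal.ofReal a * S + ∫⁻ t in Iic x, G t) := le_add_self
        _ = _ := by ring
    calc (G ⋆ₗ u) x = c⁻¹ * (ENNReal.ofReal a)⁻¹ * (c * (ENNReal.ofReal a * (G ⋆ₗ u) x)) := by
          rw [show c⁻¹ * (ENNReal.ofReal a)⁻¹ * (c * (ENNReal.ofReal a * (G ⋆ₗ u) x)) =
            (c⁻¹ * c) * ((ENNReal.ofReal a)⁻¹ * ENNReal.ofReal a) * (G ⋆ₗ u) x by ring,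
            ENNReal.inv_mul_cancel hc0 hct, ENNReal.inv_mul_cancel hA0 ENNReal.ofReal_ne_top,
            one_mul, one_mul]
      _ ≤ _ := by
          rw [mul_assoc _ _ (1 + ∫⁻ t in Iic x, G t)]
          exact mul_le_mul_right ((h2 x hx).trans h9) _
  refine ⟨c⁻¹ * (ENNReal.ofReal a)⁻¹ * (1 + ENNReal.ofReal a * S), ?_, fun x hx => ?_⟩
  · exact ENNReal.mul_ne_top (ENNReal.mul_ne_top (ENNReal.inv_ne_top.2 hc0)
      (ENNReal.inv_ne_top.2 hA0)) (ENNReal.add_ne_top.2 ⟨ENNReal.one_ne_top,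
        ENNReal.mul_ne_top ENNReal.ofReal_ne_top h.mean⟩)
  · have h9 := congrFun h.tail_tail_eq x
    have h10 : (heaviside ⋆ₗ heaviside) x = ENNReal.ofReal x := by
      rw [heaviside_lconvolution, heaviside, lintegral_indicator measurableSet_Ici]
      simp [Measure.restrict_restrict, Ici_inter_Iic]
    simp only [Pi.add_apply, Pi.smul_apply, smul_eq_mul, heaviside_lconvolution u,
      heaviside_of_nonneg hx, mul_one, h10] at h9
    refine ⟨?_, ?_⟩
    · rw [h9]
      exact le_add_self
    -- The boundary term `G x` is at most `S`, so it cancels against the `S` on the left.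
    · have h11 : S + S * ∫⁻ t in Iic x, u t ≤ S + (ENNReal.ofReal x +
          c⁻¹ * (ENNReal.ofReal a)⁻¹ * (1 + ENNReal.ofReal a * S) *
            (1 + ∫⁻ t in Iic x, G t)) := by
        rw [h9, add_assoc, add_comm (ENNReal.ofReal x)]
        gcongr
        · exact tailInt_le _ _
        · exact h8 x hx
      exact (ENNReal.add_le_add_iff_left h.mean).1 h11

end RenewalPair

/-! ### Plancherel's identity and Laplace transforms on vertical lines. -/

/-- The Fourier transform on `L²` is given by the Fourier integral on `L¹ ∩ L²`. -/
theorem fourier_toLp_ae_eq {f : ℝ → ℂ} (h1 : Integrable f) (h2 : MemLp f 2) :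
    (𝓕 (h2.toLp f) : Lp ℂ 2 (volume : Measure ℝ)) =ᵐ[volume] 𝓕 f := by
  have hcont : Continuous (𝓕 f) :=
    VectorFourier.fourierIntegral_continuous Real.continuous_fourierChar
      (by exact continuous_inner) h1
  refine ae_eq_of_integral_contDiff_smul_eq
    ((Lp.memLp _).locallyIntegrable (by norm_num)) hcont.locallyIntegrable ?_
  -- Both sides are tested against smooth compactly supported functions: the `L²` transform is dual
  -- to the Schwartz transform by its compatibility with tempered distributions, the `L¹` one by
  -- Fubini.
  intro ψ hψ hψc
  have hc' : HasCompactSupport fun x => (ψ x : ℂ) := hψc.comp_left (g := Complex.ofReal) (by simp)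
  set Ψ : SchwartzMap ℝ ℂ := hc'.toSchwartzMap (Complex.ofRealCLM.contDiff.comp hψ) with hΨ
  have hΨa : ∀ x, Ψ x = (ψ x : ℂ) := fun x => rfl
  have h3 := congrArg (fun D : TemperedDistribution ℝ ℂ => D Ψ)
    (Lp.fourier_toTemperedDistribution_eq (h2.toLp f))
  simp only [TemperedDistribution.fourier_apply, Lp.toTemperedDistribution_apply] at h3
  have h4 : ∫ x, ψ x • (𝓕 (h2.toLp f) : Lp ℂ 2 (volume : Measure ℝ)) x
      = ∫ x, Ψ x • (𝓕 (h2.toLp f) : Lp ℂ 2 (volume : Measure ℝ)) x := rfl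
  rw [h4, ← h3]
  have h5 : ∫ x, 𝓕 Ψ x • (h2.toLp f) x = ∫ x, 𝓕 (Ψ : ℝ → ℂ) x • f x := by
    refine integral_congr_ae ?_
    filter_upwards [h2.coeFn_toLp] with x hx
    rw [hx, SchwartzMap.fourier_coe]
  have h6 := VectorFourier.integral_fourierIntegral_smul_eq_flip (μ := volume) (ν := volume)
    (L := innerₗ ℝ) Real.continuous_fourierChar continuous_inner Ψ.integrable h1
  rw [flip_innerₗ] at h6
  rw [h5]
  exact h6

/-- Plancherel's identity on `L¹ ∩ L²`. -/
theorem lintegral_enorm_sq_fourier {f : ℝ → ℂ} (h1 : Integrable f) (h2 : MemLp f 2) :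
    ∫⁻ ξ, ‖𝓕 f ξ‖ₑ ^ 2 = ∫⁻ x, ‖f x‖ₑ ^ 2 := by
  have h3 : eLpNorm (𝓕 f) 2 volume = eLpNorm f 2 volume := by
    rw [← eLpNorm_congr_ae (fourier_toLp_ae_eq h1 h2), ← Lp.enorm_def, ← enorm_norm,
      Lp.norm_fourier_eq, enorm_norm, Lp.enorm_toLp]
  have h4 := congrArg (fun y : ℝ≥0∞ => y ^ 2) h3
  simpa [eLpNorm_eq_lintegral_rpow_enorm_toReal (p := 2) (by norm_num) (by norm_num),
    ← ENNReal.rpow_mul_natCast] using h4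

/-- The function `e^{-εt} a(t)`, complex-valued. -/
noncomputable def damped (ε : ℝ) (a : ℝ → ℝ≥0∞) (t : ℝ) : ℂ :=
  ((Real.exp (-(ε * t)) * (a t).toReal : ℝ) : ℂ)

theorem measurable_damped (ε : ℝ) {a : ℝ → ℝ≥0∞} (ha : Measurable a) :
    Measurable (damped ε a) := by
  unfold damped
  fun_prop

theorem enorm_damped (ε : ℝ) (a : ℝ → ℝ≥0∞) (t : ℝ) :
    ‖damped ε a t‖ₑ = ENNReal.ofReal (Real.exp (-(ε * t))) * ENNReal.ofReal (a t).toReal := by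
  rw [damped, ← ENNReal.ofReal_mul (Real.exp_pos _).le, ← ofReal_norm, Complex.norm_real,
    Real.norm_of_nonneg (by positivity)]

/-- `a` is integrable with the exponential weight `e^{-εt}`. -/
def DampedFinite (ε : ℝ) (a : ℝ → ℝ≥0∞) : Prop :=
  ∫⁻ t, ENNReal.ofReal (Real.exp (-(ε * t))) * a t ≠ ∞

theorem DampedFinite.ae_lt_top {ε : ℝ} {a : ℝ → ℝ≥0∞} (h : DampedFinite ε a) (ha : Measurable a) :
    ∀ᵐ t, a t < ∞ := by
  filter_upwards [MeasureTheory.ae_lt_top (by fun_prop) h] with t ht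
  by_contra hcon
  rw [not_lt, top_le_iff] at hcon
  have : ENNReal.ofReal (Real.exp (-(ε * t))) ≠ 0 := by simpa using Real.exp_pos _
  simp [hcon, ENNReal.mul_top this] at ht

theorem DampedFinite.integrable {ε : ℝ} {a : ℝ → ℝ≥0∞} (h : DampedFinite ε a)
    (ha : Measurable a) : Integrable (damped ε a) := by
  refine ⟨(measurable_damped ε ha).aestronglyMeasurable, lt_of_le_of_lt ?_ (lt_top_iff_ne_top.2 h)⟩
  refine lintegral_mono fun t => ?_
  rw [enorm_damped]
  exact mul_le_mul_right ENNReal.ofReal_toReal_le _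

/-- The Laplace transform on the line with real part `ε`, as a Fourier transform. -/
noncomputable def laplaceFourier (ε : ℝ) (a : ℝ → ℝ≥0∞) : ℝ → ℂ := 𝓕 (damped ε a)

-- The form `d = a + b ⋆ c` covers the renewal equation and both tail identities at once. An almost
-- everywhere identity suffices, and finiteness almost everywhere of the left side makes the passage
-- from `[0, ∞]` to real convolutions legitimate.
open Convolution in
theorem laplaceFourier_convolution {ε : ℝ} {a b c d : ℝ → ℝ≥0∞} (ha : Measurable a)
    (hb : Measurable b) (hc : Measurable c) (hd : Measurable d) (fa : DampedFinite ε a)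
    (fb : DampedFinite ε b) (fc : DampedFinite ε c) (fd : DampedFinite ε d)
    (h : d =ᵐ[volume] a + b ⋆ₗ c) (ξ : ℝ) :
    laplaceFourier ε d ξ = laplaceFourier ε a ξ + laplaceFourier ε b ξ * laplaceFourier ε c ξ := by
  have h1 : damped ε d =ᵐ[volume]
      damped ε a + (damped ε b ⋆[ContinuousLinearMap.mul ℂ ℂ] damped ε c) := by
    filter_upwards [h, fd.ae_lt_top hd, fa.ae_lt_top ha] with x hx hdx hax
    have h2 : (b ⋆ₗ c) x ≠ ∞ := by
      refine ne_top_of_le_ne_top hdx.ne ?_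
      rw [hx]
      exact le_add_self
    have hm : Measurable fun y => b y * c (-y + x) := by fun_prop
    have h3 : ((b ⋆ₗ c) x).toReal = ∫ y, (b y).toReal * (c (-y + x)).toReal := by
      rw [lconvolution_def, ← integral_toReal hm.aemeasurable
        (MeasureTheory.ae_lt_top hm h2)]
      simp
    have h4 : (damped ε b ⋆[ContinuousLinearMap.mul ℂ ℂ] damped ε c) x =
        ((Real.exp (-(ε * x)) * ((b ⋆ₗ c) x).toReal : ℝ) : ℂ) := by
      rw [h3, convolution_def, ← integral_const_mul, ← integral_complex_ofReal]
      refine integral_congr_ae (Eventually.of_forall fun y => ?_)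
      simp only [ContinuousLinearMap.mul_apply', damped]
      rw [← Complex.ofReal_mul, show x - y = -y + x by ring]
      congr 1
      rw [show Real.exp (-(ε * x)) = Real.exp (-(ε * y)) * Real.exp (-(ε * (-y + x))) by
        rw [← Real.exp_add]; congr 1; ring]
      ring
    rw [Pi.add_apply, h4, damped, damped, hx, Pi.add_apply, ENNReal.toReal_add hax.ne h2]
    push_cast
    ring
  have hI : Integrable (damped ε b ⋆[ContinuousLinearMap.mul ℂ ℂ] damped ε c) :=
    (fb.integrable hb).integrable_convolution _ (fc.integrable hc)
  have hadd : 𝓕 (damped ε a + (damped ε b ⋆[ContinuousLinearMap.mul ℂ ℂ] damped ε c)) ξ =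
      𝓕 (damped ε a) ξ + 𝓕 (damped ε b ⋆[ContinuousLinearMap.mul ℂ ℂ] damped ε c) ξ := by
    have := VectorFourier.fourierIntegral_add (μ := volume) (L := innerₗ ℝ)
      Real.continuous_fourierChar continuous_inner (fa.integrable ha) hI
    exact congrFun this ξ |>.trans rfl
  rw [laplaceFourier, Real.fourier_congr_ae h1, hadd,
    Real.fourier_mul_convolution_eq (fb.integrable hb) (fc.integrable hc)]
  rfl

theorem laplaceFourier_eq_integral (ε : ℝ) (a : ℝ → ℝ≥0∞) (ξ : ℝ) :
    laplaceFourier ε a ξ =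
      ∫ t : ℝ, Complex.exp (-((ε + 2 * Real.pi * ξ * Complex.I) * t)) * ((a t).toReal : ℂ) := by
  rw [laplaceFourier, Real.fourier_real_eq_integral_exp_smul]
  refine integral_congr_ae (Eventually.of_forall fun t => ?_)
  simp only [damped, smul_eq_mul]
  push_cast
  rw [← mul_assoc, ← Complex.exp_add]
  congr 2
  ring

theorem laplaceFourier_heaviside {ε : ℝ} (hε : 0 < ε) (ξ : ℝ) :
    laplaceFourier ε heaviside ξ = 1 / (ε + 2 * Real.pi * ξ * Complex.I) := by
  have hz : (-(ε + 2 * Real.pi * ξ * Complex.I) : ℂ).re < 0 := by simpa using hε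
  have h1 := integral_exp_mul_complex_Ioi hz 0
  rw [laplaceFourier_eq_integral]
  rw [← integral_Ici_eq_integral_Ioi, ← integral_indicator measurableSet_Ici] at h1
  calc _ = _ := by
        refine integral_congr_ae (Eventually.of_forall fun t => ?_)
        by_cases ht : 0 ≤ t
        · simp only [heaviside_of_nonneg ht, indicator_of_mem (mem_Ici.2 ht)]
          rw [ENNReal.toReal_one, Complex.ofReal_one, mul_one, neg_mul]
        · simp only [heaviside_of_neg (not_le.1 ht), indicator_of_notMem (show t ∉ Ici 0 from ht)]
          simp
    _ = _ := h1
    _ = _ := by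
      simp only [Complex.ofReal_zero, mul_zero, Complex.exp_zero]
      rw [neg_div_neg_eq]

theorem lintegral_lconvolution_eq_mul {a b : ℝ → ℝ≥0∞} (ha : Measurable a) (hb : Measurable b) :
    ∫⁻ t, (a ⋆ₗ b) t = (∫⁻ t, a t) * ∫⁻ t, b t := by
  simp only [lconvolution_def]
  rw [lintegral_lintegral_swap (by fun_prop), ← lintegral_mul_const _ ha]
  refine lintegral_congr fun y => ?_
  rw [lintegral_const_mul _ (by fun_prop), lintegral_add_left_eq_self]

/-- The exponential weight `e^{-εt}`. -/
noncomputable def expWeight (ε t : ℝ) : ℝ≥0∞ := ENNReal.ofReal (Real.exp (-(ε * t)))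

theorem expWeight_add (ε s t : ℝ) : expWeight ε (s + t) = expWeight ε s * expWeight ε t := by
  simp only [expWeight]
  rw [← ENNReal.ofReal_mul (Real.exp_pos _).le, ← Real.exp_add]
  congr 2
  ring

theorem expWeight_ne_zero (ε t : ℝ) : expWeight ε t ≠ 0 := by
  simpa [expWeight] using Real.exp_pos _

@[fun_prop]
theorem measurable_expWeight (ε : ℝ) : Measurable (expWeight ε) := by
  unfold expWeight
  fun_prop

theorem expWeight_anti {ε s t : ℝ} (hε : 0 ≤ ε) (h : s ≤ t) : expWeight ε t ≤ expWeight ε s := by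
  refine ENNReal.ofReal_le_ofReal (Real.exp_le_exp.2 ?_)
  have := mul_le_mul_of_nonneg_left h hε
  linarith

theorem expWeight_zero_right (ε : ℝ) : expWeight ε 0 = 1 := by simp [expWeight]

theorem expWeight_le_one {ε t : ℝ} (hε : 0 ≤ ε) (ht : 0 ≤ t) : expWeight ε t ≤ 1 :=
  (expWeight_anti hε ht).trans_eq (expWeight_zero_right ε)

/-- The weight is a character, so it distributes over the two factors of the convolution, and
Tonelli separates them. -/
theorem lintegral_expWeight_mul_lconvolution (ε : ℝ) {a b : ℝ → ℝ≥0∞} (ha : Measurable a)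
    (hb : Measurable b) : ∫⁻ t, expWeight ε t * (a ⋆ₗ b) t =
      (∫⁻ t, expWeight ε t * a t) * ∫⁻ t, expWeight ε t * b t := by
  rw [← lintegral_lconvolution_eq_mul (by fun_prop) (by fun_prop)]
  refine lintegral_congr fun t => ?_
  rw [lconvolution_def, lconvolution_def, ← lintegral_const_mul _ (by fun_prop)]
  refine lintegral_congr fun y => ?_
  rw [show expWeight ε t = expWeight ε y * expWeight ε (-y + t) by
    rw [← expWeight_add]; congr 1; ring]
  ring

theorem dampedFinite_of_lintegral_ne_top {ε : ℝ} (hε : 0 ≤ ε) {a : ℝ → ℝ≥0∞}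
    (h0 : ∀ t, t < 0 → a t = 0) (h : ∫⁻ t, a t ≠ ∞) : DampedFinite ε a := by
  refine ne_top_of_le_ne_top h (lintegral_mono fun t => ?_)
  rcases lt_or_ge t 0 with ht | ht
  · simp [h0 t ht]
  · exact mul_le_of_le_one_left (zero_le) (expWeight_le_one hε ht)

theorem dampedFinite_heaviside {ε : ℝ} (hε : 0 < ε) : DampedFinite ε heaviside := by
  have h1 : ∫⁻ t, ENNReal.ofReal (Real.exp (-(ε * t))) * heaviside t =
      ∫⁻ t in Ici (0 : ℝ), ENNReal.ofReal (Real.exp (-(ε * t))) := by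
    rw [← lintegral_indicator measurableSet_Ici]
    refine lintegral_congr fun t => ?_
    by_cases ht : t ∈ Ici (0 : ℝ)
    · rw [heaviside_of_nonneg ht, indicator_of_mem ht, mul_one]
    · rw [heaviside_of_neg (by simpa using ht), indicator_of_notMem ht, mul_zero]
  rw [DampedFinite, h1]
  have h2 : IntegrableOn (fun t => Real.exp (-(ε * t))) (Ici 0) := by
    rw [integrableOn_Ici_iff_integrableOn_Ioi]
    simpa using exp_neg_integrableOn_Ioi 0 hε
  exact h2.lintegral_lt_top.ne

theorem DampedFinite.mono {ε : ℝ} {a b : ℝ → ℝ≥0∞} (h : DampedFinite ε b) (hab : a ≤ b) :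
    DampedFinite ε a :=
  ne_top_of_le_ne_top h (lintegral_mono fun t => mul_le_mul_right (hab t) _)

theorem DampedFinite.const_smul {ε : ℝ} {a : ℝ → ℝ≥0∞} (h : DampedFinite ε a) {c : ℝ≥0∞}
    (hc : c ≠ ∞) : DampedFinite ε (c • a) := by
  have : ∫⁻ t, ENNReal.ofReal (Real.exp (-(ε * t))) * (c • a) t =
      c * ∫⁻ t, ENNReal.ofReal (Real.exp (-(ε * t))) * a t := by
    rw [← lintegral_const_mul' _ _ hc]
    refine lintegral_congr fun t => ?_
    simp only [Pi.smul_apply, smul_eq_mul]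
    ring
  rw [DampedFinite, this]
  exact ENNReal.mul_ne_top hc h

theorem tailInt_le_smul_heaviside (a : ℝ → ℝ≥0∞) : tailInt a ≤ (∫⁻ t, a t) • heaviside := by
  intro t
  rcases lt_or_ge t 0 with ht | ht
  · simp [tailInt_of_neg a ht]
  · simpa [heaviside_of_nonneg ht] using tailInt_le a t

theorem damped_const_smul (ε : ℝ) (a : ℝ → ℝ≥0∞) (c : ℝ≥0∞) :
    damped ε (c • a) = (c.toReal : ℂ) • damped ε a := by
  ext t
  simp only [damped, Pi.smul_apply, smul_eq_mul, ENNReal.toReal_mul]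
  push_cast
  ring

theorem laplaceFourier_const_smul (ε : ℝ) (a : ℝ → ℝ≥0∞) (c : ℝ≥0∞) (ξ : ℝ) :
    laplaceFourier ε (c • a) ξ = (c.toReal : ℂ) * laplaceFourier ε a ξ := by
  rw [laplaceFourier, damped_const_smul]
  exact congrFun (VectorFourier.fourierIntegral_const_smul _ _ _ _ _) ξ

theorem laplaceFourier_re {ε : ℝ} {a : ℝ → ℝ≥0∞} (ha : Measurable a) (h : DampedFinite ε a)
    (ξ : ℝ) : (laplaceFourier ε a ξ).re =
      ∫ t : ℝ, Real.exp (-(ε * t)) * Real.cos (2 * Real.pi * ξ * t) * (a t).toReal := by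
  have hi : Integrable fun t : ℝ => Complex.exp (((-2 * Real.pi * t * ξ : ℝ) : ℂ) * Complex.I) •
      damped ε a t := by
    have := (Real.fourierIntegral_convergent_iff ξ).2 (h.integrable ha)
    refine this.congr (Eventually.of_forall fun t => ?_)
    simp only [Circle.smul_def, Real.fourierChar_apply]
    congr 3
    simp
    ring
  rw [laplaceFourier, Real.fourier_real_eq_integral_exp_smul]
  have h2 := integral_re hi
  refine h2.symm.trans (integral_congr_ae (Eventually.of_forall fun t => ?_))
  simp only [damped, smul_eq_mul, RCLike.re_to_complex, Complex.re_mul_ofReal,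
    Complex.exp_ofReal_mul_I_re]
  rw [show -2 * Real.pi * t * ξ = -(2 * Real.pi * ξ * t) by ring, Real.cos_neg]
  ring

theorem integrable_exp_cos_mul {ε : ℝ} {a : ℝ → ℝ≥0∞} (ha : Measurable a) (h : DampedFinite ε a)
    (ξ : ℝ) :
    Integrable fun t : ℝ => Real.exp (-(ε * t)) * Real.cos (2 * Real.pi * ξ * t) * (a t).toReal := by
  refine (h.integrable ha).mono ?_ (Eventually.of_forall fun t => ?_)
  · exact Measurable.aestronglyMeasurable (by fun_prop)
  · rw [damped, Complex.norm_real, norm_mul, norm_mul, norm_mul]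
    refine mul_le_mul_of_nonneg_right ?_ (norm_nonneg _)
    exact mul_le_of_le_one_right (norm_nonneg _) (Real.abs_cos_le_one _)

theorem continuous_laplaceFourier {ε : ℝ} {a : ℝ → ℝ≥0∞} (ha : Measurable a)
    (h : DampedFinite ε a) : Continuous (laplaceFourier ε a) :=
  VectorFourier.fourierIntegral_continuous Real.continuous_fourierChar
    (by exact continuous_inner) (h.integrable ha)

/-! ### Transforms of a renewal pair and a uniform lower bound for the symbols. -/

namespace RenewalPair

variable {g u : ℝ → ℝ≥0∞}

/-- Otherwise `tail_eq` would make the Heaviside function vanish almost everywhere. -/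
theorem tail_not_ae_zero (h : RenewalPair g u) : ¬ tailInt g =ᵐ[volume] 0 := by
  intro h0
  have h1 : tailInt g ⋆ₗ u = 0 := by
    rw [lconvolution_congr_left h0]
    exact zero_lconvolution u volume
  have h2 := h.tail_eq
  rw [h1, add_zero] at h2
  have h3 : ∫⁻ t, heaviside t = 0 := by
    rw [← h2, lintegral_eq_zero_iff (measurable_tailInt g)]
    exact h0
  rw [heaviside, lintegral_indicator measurableSet_Ici] at h3
  simp at h3

theorem mean_ne_zero (h : RenewalPair g u) : ∫⁻ t, tailInt g t ≠ 0 := fun h0 =>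
  h.tail_not_ae_zero ((lintegral_eq_zero_iff (measurable_tailInt g)).1 h0)

theorem lintegral_expWeight_tail_ne_zero (h : RenewalPair g u) (ε : ℝ) :
    ∫⁻ t, expWeight ε t * tailInt g t ≠ 0 := fun h0 => by
  have hP := measurable_tailInt g
  have h1 := (lintegral_eq_zero_iff (by fun_prop)).1 h0
  refine h.tail_not_ae_zero ?_
  filter_upwards [h1] with t ht
  simpa [expWeight_ne_zero] using ht

theorem dampedFinite_g (h : RenewalPair g u) {ε : ℝ} (hε : 0 ≤ ε) : DampedFinite ε g :=
  dampedFinite_of_lintegral_ne_top hε (fun t ht => h.g_zero t ht.le) (by simp [h.mass])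

theorem dampedFinite_tail (h : RenewalPair g u) {ε : ℝ} (hε : 0 ≤ ε) :
    DampedFinite ε (tailInt g) :=
  dampedFinite_of_lintegral_ne_top hε (fun _ ht => tailInt_of_neg g ht) h.mean

theorem dampedFinite_tail_tail (h : RenewalPair g u) {ε : ℝ} (hε : 0 < ε) :
    DampedFinite ε (tailInt (tailInt g)) :=
  ((dampedFinite_heaviside hε).const_smul h.mean).mono (tailInt_le_smul_heaviside _)

/-- By `tail_eq`, the weighted mass of `u` times the nonzero weighted mass of the tail is at most
the weighted mass of the Heaviside function, which is finite. -/
theorem dampedFinite_u (h : RenewalPair g u) {ε : ℝ} (hε : 0 < ε) : DampedFinite ε u := by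
  have h1 : (∫⁻ t, expWeight ε t * tailInt g t) * (∫⁻ t, expWeight ε t * u t) ≤
      ∫⁻ t, expWeight ε t * heaviside t := by
    rw [← lintegral_expWeight_mul_lconvolution ε (measurable_tailInt g) h.meas_u, ← h.tail_eq]
    exact lintegral_mono fun t => mul_le_mul_right le_add_self _
  intro htop
  have h2 : ∫⁻ t, expWeight ε t * u t = ∞ := htop
  rw [h2, ENNReal.mul_top (h.lintegral_expWeight_tail_ne_zero ε), top_le_iff] at h1
  exact dampedFinite_heaviside hε h1

/-- The density of the renewal measure is at most exponential if the kernel is bounded. -/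
theorem u_bound (h : RenewalPair g u) {M : ℝ≥0∞} (hM : ∀ t, g t ≤ M) {ε : ℝ} (hε : 0 < ε) :
    ∀ᵐ t, expWeight ε t * u t ≤ M + M * ∫⁻ s, expWeight ε s * u s := by
  have hu := h.meas_u
  filter_upwards [h.eq] with x hx
  rcases le_or_gt x 0 with hx0 | hx0
  · simp [h.u_zero x hx0]
  -- Boundedness of `g` turns its convolution with `u` into the renewal function, whose damped
  -- values are at most the damped mass of `u`.
  have h1 : (g ⋆ₗ u) x ≤ M * ∫⁻ y in Iic x, u y := by
    rw [← heaviside_lconvolution, ← smul_eq_mul, ← Pi.smul_apply,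
      ← lconvolution_const_smul_left hu measurable_heaviside]
    refine lconvolution_mono_left (fun t => ?_) x
    rcases lt_or_ge t 0 with ht | ht
    · simp [h.g_zero t ht.le]
    · simpa [heaviside_of_nonneg ht] using hM t
  have h2 : expWeight ε x * ∫⁻ y in Iic x, u y ≤ ∫⁻ s, expWeight ε s * u s := by
    rw [← lintegral_const_mul _ hu]
    refine (setLIntegral_mono (by fun_prop) fun y hy => ?_).trans (setLIntegral_le_lintegral _ _)
    exact mul_le_mul_left (expWeight_anti hε.le hy) _
  rw [hx, Pi.add_apply, mul_add]
  refine add_le_add ?_ ?_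
  · exact (mul_le_of_le_one_left (zero_le) (expWeight_le_one hε.le hx0.le)).trans (hM x)
  · calc expWeight ε x * (g ⋆ₗ u) x ≤ expWeight ε x * (M * ∫⁻ y in Iic x, u y) :=
          mul_le_mul_right h1 _
      _ = M * (expWeight ε x * ∫⁻ y in Iic x, u y) := by ring
      _ ≤ _ := mul_le_mul_right h2 _

section transforms

variable {ε : ℝ}

theorem laplaceFourier_u (h : RenewalPair g u) (hε : 0 < ε) (ξ : ℝ) :
    laplaceFourier ε u ξ = laplaceFourier ε g ξ + laplaceFourier ε g ξ * laplaceFourier ε u ξ :=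
  laplaceFourier_convolution h.meas_g h.meas_g h.meas_u h.meas_u (h.dampedFinite_g hε.le)
    (h.dampedFinite_g hε.le) (h.dampedFinite_u hε) (h.dampedFinite_u hε) h.eq ξ

theorem laplaceFourier_tail (h : RenewalPair g u) (hε : 0 < ε) (ξ : ℝ) :
    1 / (ε + 2 * Real.pi * ξ * Complex.I) = laplaceFourier ε (tailInt g) ξ +
      1 / (ε + 2 * Real.pi * ξ * Complex.I) * laplaceFourier ε g ξ := by
  have h2 : tailInt g + heaviside ⋆ₗ g = heaviside := by
    rw [tailInt_add_heaviside_lconvolution fun t ht => h.g_zero t ht.le, h.mass, one_smul]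
  rw [← laplaceFourier_heaviside hε]
  exact laplaceFourier_convolution (measurable_tailInt g) measurable_heaviside h.meas_g
    measurable_heaviside (h.dampedFinite_tail hε.le) (dampedFinite_heaviside hε)
    (h.dampedFinite_g hε.le) (dampedFinite_heaviside hε) (by rw [h2]) ξ

theorem laplaceFourier_tail_tail (h : RenewalPair g u) (hε : 0 < ε) (ξ : ℝ) :
    ((∫⁻ t, tailInt g t).toReal : ℂ) * (1 / (ε + 2 * Real.pi * ξ * Complex.I)) =
      laplaceFourier ε (tailInt (tailInt g)) ξ +
      1 / (ε + 2 * Real.pi * ξ * Complex.I) * laplaceFourier ε (tailInt g) ξ := by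
  rw [← laplaceFourier_heaviside hε, ← laplaceFourier_const_smul]
  exact laplaceFourier_convolution (measurable_tailInt _) measurable_heaviside
    (measurable_tailInt g) (measurable_heaviside.const_smul _) (h.dampedFinite_tail_tail hε)
    (dampedFinite_heaviside hε) (h.dampedFinite_tail hε.le)
    ((dampedFinite_heaviside hε).const_smul h.mean)
    (by rw [tailInt_add_heaviside_lconvolution fun t ht => tailInt_of_neg g (t := t) ht]) ξ

end transforms

theorem integral_toReal_g (h : RenewalPair g u) : ∫ t, (g t).toReal = 1 := by
  rw [integral_toReal h.meas_g.aemeasurable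
    (MeasureTheory.ae_lt_top h.meas_g (by simp [h.mass])), h.mass, ENNReal.toReal_one]

theorem integrable_toReal_g (h : RenewalPair g u) : Integrable fun t => (g t).toReal :=
  integrable_toReal_of_lintegral_ne_top h.meas_g.aemeasurable (by simp [h.mass])

/-- Removes the damping at the cost of doubling the frequency. Pointwise, `(1 - cos 2θ)/4 = (1 -
cos² θ)/2 ≤ 1 - e cos θ` for every `e` in `(0, 1]`, whatever the sign of the cosine. -/
theorem re_one_sub_laplaceFourier_ge (h : RenewalPair g u) {ε : ℝ} (hε : 0 ≤ ε) (ξ : ℝ) :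
    (1 - (laplaceFourier 0 g (2 * ξ)).re) / 4 ≤ 1 - (laplaceFourier ε g ξ).re := by
  rw [laplaceFourier_re h.meas_g (h.dampedFinite_g hε),
    laplaceFourier_re h.meas_g (h.dampedFinite_g le_rfl), ← h.integral_toReal_g,
    ← integral_sub h.integrable_toReal_g
      (integrable_exp_cos_mul h.meas_g (h.dampedFinite_g le_rfl) _),
    ← integral_sub h.integrable_toReal_g
      (integrable_exp_cos_mul h.meas_g (h.dampedFinite_g hε) _), ← integral_div]
  refine integral_mono
    ((h.integrable_toReal_g.sub
      (integrable_exp_cos_mul h.meas_g (h.dampedFinite_g le_rfl) _)).div_const _)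
    (h.integrable_toReal_g.sub
      (integrable_exp_cos_mul h.meas_g (h.dampedFinite_g hε) _)) fun t => ?_
  simp only
  rcases le_or_gt t 0 with ht | ht
  · simp [h.g_zero t ht]
  have h1 : Real.exp (-(ε * t)) ≤ 1 := Real.exp_le_one_iff.2 (by nlinarith)
  have h2 := Real.exp_pos (-(ε * t))
  have h3 : Real.cos (2 * Real.pi * (2 * ξ) * t) = 2 * Real.cos (2 * Real.pi * ξ * t) ^ 2 - 1 := by
    rw [← Real.cos_two_mul]
    congr 1
    ring
  have h4 := Real.neg_one_le_cos (2 * Real.pi * ξ * t)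
  have h5 := Real.cos_le_one (2 * Real.pi * ξ * t)
  rw [h3]
  set x := Real.cos (2 * Real.pi * ξ * t)
  set e := Real.exp (-(ε * t))
  have h6 : (1 - (2 * x ^ 2 - 1)) / 4 ≤ 1 - e * x := by
    rcases le_or_gt x 0 with hx | hx
    · nlinarith
    · nlinarith [sq_nonneg (1 - x)]
  have h7 := mul_le_mul_of_nonneg_right h6 (ENNReal.toReal_nonneg (a := g t))
  simp only [zero_mul, neg_zero, Real.exp_zero, one_mul]
  linarith

/-- Equality would concentrate `g` on the set where `cos (2πξt) = 1`. That set is countable, so it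
carries no mass of a density. -/
theorem re_laplaceFourier_lt_one (h : RenewalPair g u) {ξ : ℝ} (hξ : ξ ≠ 0) :
    (laplaceFourier 0 g ξ).re < 1 := by
  have hi := h.integrable_toReal_g.sub
      (integrable_exp_cos_mul h.meas_g (h.dampedFinite_g le_rfl) ξ)
  have h1 : 1 - (laplaceFourier 0 g ξ).re = ∫ t, ((g t).toReal -
      Real.exp (-(0 * t)) * Real.cos (2 * Real.pi * ξ * t) * (g t).toReal) := by
    rw [laplaceFourier_re h.meas_g (h.dampedFinite_g le_rfl), ← h.integral_toReal_g,
    ← integral_sub h.integrable_toReal_g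
      (integrable_exp_cos_mul h.meas_g (h.dampedFinite_g le_rfl) _)]
  have h2 : ∀ t, 0 ≤ (g t).toReal -
      Real.exp (-(0 * t)) * Real.cos (2 * Real.pi * ξ * t) * (g t).toReal := fun t => by
    have := mul_le_mul_of_nonneg_right (Real.cos_le_one (2 * Real.pi * ξ * t))
      (ENNReal.toReal_nonneg (a := g t))
    simp only [zero_mul, neg_zero, Real.exp_zero, one_mul] at this ⊢
    linarith
  have h3 : 0 ≤ 1 - (laplaceFourier 0 g ξ).re := by
    rw [h1]
    exact integral_nonneg h2
  refine lt_of_le_of_ne (by linarith) fun heq => ?_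
  have h4 := (integral_eq_zero_iff_of_nonneg h2 hi).1 (by simpa [heq] using h1.symm)
  have hcount : {t : ℝ | Real.cos (2 * Real.pi * ξ * t) = 1}.Countable := by
    refine (countable_range fun n : ℤ => (n : ℝ) / ξ).mono fun t ht => ?_
    obtain ⟨n, hn⟩ := (Real.cos_eq_one_iff _).1 ht
    refine ⟨n, ?_⟩
    have := Real.pi_pos
    field_simp
    have h5 : 2 * Real.pi * (n - ξ * t) = 0 := by linarith
    rcases mul_eq_zero.1 h5 with h6 | h6
    · linarith
    · linarith
  have h5 : g =ᵐ[volume] 0 := by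
    filter_upwards [h4, compl_mem_ae_iff.2 (hcount.measure_zero volume),
      (h.dampedFinite_g le_rfl).ae_lt_top h.meas_g] with t ht htc hfin
    simp only [zero_mul, neg_zero, Real.exp_zero, one_mul, Pi.zero_apply] at ht
    have h6 : (1 - Real.cos (2 * Real.pi * ξ * t)) * (g t).toReal = 0 := by linarith
    rcases mul_eq_zero.1 h6 with h7 | h7
    · exact absurd (show t ∈ {t : ℝ | Real.cos (2 * Real.pi * ξ * t) = 1} by
        simp only [mem_ofPred_eq]; linarith) htc
    · exact ((ENNReal.toReal_eq_zero_iff _).1 h7).resolve_right hfin.ne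
  have h6 := h.mass
  rw [lintegral_congr_ae h5] at h6
  simp at h6

/-- The symbol `1 - φ̂` is bounded below away from frequency zero, and the transform of the tail
is bounded below near it. -/
theorem exists_lower_bound (h : RenewalPair g u) :
    ∃ c : ℝ, 0 < c ∧ ∀ ε : ℝ, 0 < ε → ε ≤ 1 → ∀ ξ : ℝ,
      c ≤ ‖1 - laplaceFourier ε g ξ‖ ∨ c ≤ ‖laplaceFourier ε (tailInt g) ξ‖ := by
  have hP := measurable_tailInt g
  have hD0 := h.dampedFinite_tail (le_refl 0)
  have hD1 := h.dampedFinite_tail zero_le_one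
  -- The damping `ε = 1` is the strongest allowed, so this positive number serves for all `ε ≤ 1`.
  set κ := (laplaceFourier 1 (tailInt g) 0).re with hκ
  have hκpos : 0 < κ := by
    rw [hκ, laplaceFourier_re hP hD1]
    refine (integral_pos_iff_support_of_nonneg (fun t => ?_)
      (integrable_exp_cos_mul hP hD1 0)).2 ?_
    · simp only [mul_zero, zero_mul, Real.cos_zero, mul_one]
      positivity
    · by_contra hcon
      have h0 : volume (Function.support fun t : ℝ => Real.exp (-(1 * t)) *
          Real.cos (2 * Real.pi * 0 * t) * (tailInt g t).toReal) = 0 := by simpa using hcon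
      refine h.tail_not_ae_zero ?_
      filter_upwards [compl_mem_ae_iff.2 h0, hD0.ae_lt_top hP] with t ht hfin
      rw [mem_compl_iff, Function.notMem_support] at ht
      simp only [mul_zero, zero_mul, Real.cos_zero, mul_one, mul_eq_zero, Real.exp_ne_zero,
        false_or] at ht
      exact ((ENNReal.toReal_eq_zero_iff _).1 ht).resolve_right hfin.ne
  -- Integrates `e^{-t} - (1 - cos θ) ≤ e^{-εt} cos θ`. The loss is the undamped modulus of
  -- continuity at zero, which does not depend on `ε`.
  have hnear : ∀ ε : ℝ, 0 < ε → ε ≤ 1 → ∀ ξ : ℝ, κ - ((laplaceFourier 0 (tailInt g) 0).re -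
      (laplaceFourier 0 (tailInt g) ξ).re) ≤ (laplaceFourier ε (tailInt g) ξ).re := by
    intro ε hε hε1 ξ
    have hDε := h.dampedFinite_tail hε.le
    have i0 := integrable_exp_cos_mul hP hD0 0
    have i1 := integrable_exp_cos_mul hP hD0 ξ
    have i01 : Integrable fun t : ℝ =>
        Real.exp (-(0 * t)) * Real.cos (2 * Real.pi * 0 * t) * (tailInt g t).toReal -
        Real.exp (-(0 * t)) * Real.cos (2 * Real.pi * ξ * t) * (tailInt g t).toReal := i0.sub i1
    rw [hκ, laplaceFourier_re hP hD0, laplaceFourier_re hP hD0, laplaceFourier_re hP hD1,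
      laplaceFourier_re hP hDε, ← integral_sub i0 i1,
      ← integral_sub (integrable_exp_cos_mul hP hD1 0) i01]
    refine integral_mono ((integrable_exp_cos_mul hP hD1 0).sub i01)
      (integrable_exp_cos_mul hP hDε ξ) fun t => ?_
    simp only
    rcases lt_or_ge t 0 with ht | ht
    · simp [tailInt_of_neg g ht]
    have e1 : Real.exp (-(ε * t)) ≤ 1 := Real.exp_le_one_iff.2 (by nlinarith)
    have e2 : Real.exp (-(1 * t)) ≤ Real.exp (-(ε * t)) := Real.exp_le_exp.2 (by nlinarith)
    have e3 := Real.cos_le_one (2 * Real.pi * ξ * t)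
    simp only [mul_zero, zero_mul, neg_zero, Real.exp_zero, Real.cos_zero, mul_one, one_mul]
      at e2 ⊢
    set x := Real.cos (2 * Real.pi * ξ * t)
    set e := Real.exp (-(ε * t))
    have e4 : Real.exp (-t) - (1 - x) ≤ e * x := by nlinarith
    have e5 := mul_le_mul_of_nonneg_right e4 (ENNReal.toReal_nonneg (a := tailInt g t))
    linarith
  obtain ⟨δ, hδ, hδ2⟩ : ∃ δ : ℝ, 0 < δ ∧ ∀ ξ : ℝ, |ξ| < δ →
      (laplaceFourier 0 (tailInt g) 0).re - (laplaceFourier 0 (tailInt g) ξ).re < κ / 2 := by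
    have hc : Continuous fun ξ => (laplaceFourier 0 (tailInt g) ξ).re :=
      Complex.continuous_re.comp (continuous_laplaceFourier hP hD0)
    obtain ⟨δ, hδ, hδ2⟩ := Metric.continuous_iff.1 hc 0 (κ / 2) (by linarith)
    refine ⟨δ, hδ, fun ξ hξ => ?_⟩
    have := hδ2 ξ (by simpa using hξ)
    rw [Real.dist_eq] at this
    linarith [neg_abs_le ((laplaceFourier 0 (tailInt g) ξ).re - (laplaceFourier 0 (tailInt g) 0).re)]
  -- Riemann–Lebesgue gives the gap `1/2` outside a compact set; on its part with frequency at least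
  -- `2δ`, the continuous function `1 - Re ĝ` is positive and attains its minimum.
  obtain ⟨m, hm, hm2⟩ : ∃ m : ℝ, 0 < m ∧ ∀ ξ : ℝ, δ ≤ |ξ| →
      m ≤ 1 - (laplaceFourier 0 g (2 * ξ)).re := by
    have hcz := continuous_laplaceFourier h.meas_g (h.dampedFinite_g le_rfl)
    have hc : Continuous fun ξ => 1 - (laplaceFourier 0 g ξ).re :=
      continuous_const.sub (Complex.continuous_re.comp hcz)
    have hlim : Tendsto (fun ξ => (laplaceFourier 0 g ξ).re) (cocompact ℝ) (𝓝 0) := by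
      have := Real.zero_at_infty_fourier (damped 0 g)
      have h0 := (Complex.continuous_re.tendsto 0).comp this
      rwa [Complex.zero_re] at h0
    have hev := hlim.eventually (gt_mem_nhds (show (0 : ℝ) < 1 / 2 by norm_num))
    obtain ⟨K, hK, hKsub⟩ := mem_cocompact.1 hev
    have hK2 : IsCompact (K ∩ {ξ : ℝ | 2 * δ ≤ |ξ|}) :=
      hK.inter_right (isClosed_le continuous_const continuous_abs)
    obtain ⟨m, hm, hm2⟩ : ∃ m : ℝ, 0 < m ∧ ∀ ξ ∈ K ∩ {ξ : ℝ | 2 * δ ≤ |ξ|},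
        m ≤ 1 - (laplaceFourier 0 g ξ).re := by
      rcases (K ∩ {ξ : ℝ | 2 * δ ≤ |ξ|}).eq_empty_or_nonempty with he | hne
      · exact ⟨1, one_pos, by simp [he]⟩
      · obtain ⟨ξ₀, hξ₀, hmin⟩ := hK2.exists_isMinOn hne hc.continuousOn
        refine ⟨_, ?_, fun ξ hξ => hmin hξ⟩
        have hne0 : ξ₀ ≠ 0 := by
          rintro rfl
          have := hξ₀.2
          simp only [mem_ofPred_eq, abs_zero] at this
          linarith
        have := h.re_laplaceFourier_lt_one hne0
        simp only
        linarith
    refine ⟨min m (1 / 2), by positivity, fun ξ hξ => ?_⟩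
    by_cases hmem : 2 * ξ ∈ K
    · refine (min_le_left _ _).trans (hm2 _ ⟨hmem, ?_⟩)
      simp only [mem_ofPred_eq, abs_mul, abs_two]
      linarith
    · have := hKsub hmem
      simp only [mem_ofPred_eq] at this
      refine (min_le_right _ _).trans ?_
      linarith
  refine ⟨min (κ / 2) (m / 4), by positivity, fun ε hε hε1 ξ => ?_⟩
  rcases lt_or_ge |ξ| δ with hξ | hξ
  · right
    refine (min_le_left _ _).trans (le_trans ?_ (Complex.re_le_norm _))
    linarith [hnear ε hε hε1 ξ, hδ2 ξ hξ]
  · left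
    refine (min_le_right _ _).trans (le_trans ?_ (Complex.re_le_norm _))
    rw [Complex.sub_re, Complex.one_re]
    linarith [hm2 ξ hξ, h.re_one_sub_laplaceFourier_ge hε.le ξ]

end RenewalPair

/-! ### The weighted `L²` estimate. -/

theorem ENNReal.add_sq_le_four_mul (a b : ℝ≥0∞) : (a + b) ^ 2 ≤ 4 * (a ^ 2 + b ^ 2) := by
  rcases le_total a b with h | h
  · calc (a + b) ^ 2 ≤ (b + b) ^ 2 := by gcongr
      _ = 4 * b ^ 2 := by ring
      _ ≤ _ := mul_le_mul_right le_add_self _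
  · calc (a + b) ^ 2 ≤ (a + a) ^ 2 := by gcongr
      _ = 4 * a ^ 2 := by ring
      _ ≤ _ := mul_le_mul_right le_self_add _

theorem enorm_sub_mul_sq_le (c x y : ℂ) :
    ‖x - c * y‖ₑ ^ 2 ≤ 4 * (‖x‖ₑ ^ 2 + ‖c‖ₑ ^ 2 * ‖y‖ₑ ^ 2) := by
  rw [← mul_pow, ← enorm_mul]
  refine le_trans ?_ (ENNReal.add_sq_le_four_mul _ _)
  gcongr
  exact enorm_sub_le

theorem fourier_sub_mul {f k : ℝ → ℂ} (hf : Integrable f) (hk : Integrable k) (c : ℂ) (ξ : ℝ) :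
    𝓕 (fun t => f t - c * k t) ξ = 𝓕 f ξ - c * 𝓕 k ξ := by
  simp only [Real.fourier_eq, Circle.smul_def, smul_eq_mul, mul_sub]
  have h1 : Integrable fun t => (Real.fourierChar (-inner ℝ t ξ) : ℂ) * f t :=
    (Real.fourierIntegral_convergent_iff ξ).2 hf
  have h2 : Integrable fun t => (Real.fourierChar (-inner ℝ t ξ) : ℂ) * (c * k t) :=
    (Real.fourierIntegral_convergent_iff ξ).2 (hk.const_mul c)
  rw [integral_sub h1 h2, ← integral_const_mul]
  congr 2
  ext t
  ring

theorem MeasureTheory.Integrable.memLp_two_of_bound {f : ℝ → ℂ} (hf : Integrable f) {B : ℝ}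
    (hB : ∀ᵐ t, ‖f t‖ ≤ B) : MemLp f 2 := by
  rw [memLp_two_iff_integrable_sq_norm hf.1]
  refine (hf.norm.const_mul B).mono' (hf.1.norm.pow 2) ?_
  filter_upwards [hB] with t ht
  rw [Real.norm_of_nonneg (by positivity), sq]
  exact mul_le_mul_of_nonneg_right ht (norm_nonneg _)

theorem enorm_damped_le (ε : ℝ) (a : ℝ → ℝ≥0∞) (t : ℝ) : ‖damped ε a t‖ₑ ≤ expWeight ε t * a t := by
  rw [enorm_damped]
  exact mul_le_mul_right ENNReal.ofReal_toReal_le _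

theorem memLp_two_damped {ε : ℝ} {a : ℝ → ℝ≥0∞} (ha : Measurable a) (h : DampedFinite ε a)
    {B : ℝ≥0∞} (hBt : B ≠ ∞) (hB : ∀ᵐ t, expWeight ε t * a t ≤ B) : MemLp (damped ε a) 2 := by
  refine (h.integrable ha).memLp_two_of_bound (B := B.toReal) ?_
  filter_upwards [hB] with t ht
  rw [← toReal_enorm]
  exact ENNReal.toReal_mono hBt ((enorm_damped_le ε a t).trans ht)

theorem expWeight_mul_le_of_le_smul_heaviside {ε : ℝ} (hε : 0 ≤ ε) {a : ℝ → ℝ≥0∞} {B : ℝ≥0∞}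
    (h : a ≤ B • heaviside) (t : ℝ) : expWeight ε t * a t ≤ B := by
  have h1 := h t
  rcases lt_or_ge t 0 with ht | ht
  · have : a t = 0 := by simpa [heaviside_of_neg ht] using h1
    simp [this]
  · have : a t ≤ B := by simpa [heaviside_of_nonneg ht] using h1
    exact (mul_le_of_le_one_left (zero_le) (expWeight_le_one hε ht)).trans this

theorem lintegral_enorm_damped_sq_le {ε : ℝ} (hε : 0 ≤ ε) {a : ℝ → ℝ≥0∞} (ha : Measurable a)
    {B : ℝ≥0∞} (h : a ≤ B • heaviside) :
    ∫⁻ t, ‖damped ε a t‖ₑ ^ 2 ≤ B * ∫⁻ t, a t := by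
  rw [← lintegral_const_mul _ ha]
  refine lintegral_mono fun t => ?_
  rcases lt_or_ge t 0 with ht | ht
  · have : a t = 0 := by simpa [heaviside_of_neg ht] using h t
    simp [this, damped]
  rw [sq]
  refine mul_le_mul' ((enorm_damped_le ε a t).trans
    (expWeight_mul_le_of_le_smul_heaviside hε h t)) ((enorm_damped_le ε a t).trans ?_)
  exact mul_le_of_le_one_left (zero_le) (expWeight_le_one hε ht)

namespace RenewalPair

variable {g u : ℝ → ℝ≥0∞}

/-- Divide by whichever symbol is large at a given frequency, add the two resulting bounds and apply
Plancherel. The constant does not depend on `ε`, and only the integrated tail is left on the right,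
because `g` and its tail are bounded and integrable. -/
theorem exists_l2_bound (h : RenewalPair g u) {M : ℝ≥0∞} (hMt : M ≠ ∞) (hM : ∀ t, g t ≤ M) :
    ∃ C : ℝ≥0∞, C ≠ ∞ ∧ ∀ ε : ℝ, 0 < ε → ε ≤ 1 →
      ∫⁻ t, ‖damped ε u t - ((1 / (∫⁻ t, tailInt g t).toReal : ℝ) : ℂ) * damped ε heaviside t‖ₑ ^ 2
        ≤ C * (1 + ∫⁻ t, ‖damped ε (tailInt (tailInt g)) t‖ₑ ^ 2) := by
  obtain ⟨c, hc, hlow⟩ := h.exists_lower_bound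
  have hg := h.meas_g
  have hu := h.meas_u
  have hP := measurable_tailInt g
  have hG := measurable_tailInt (tailInt g)
  have hh := measurable_heaviside
  set S := ∫⁻ t, tailInt g t with hS
  set σ := S.toReal with hσ
  have hσpos : 0 < σ := ENNReal.toReal_pos h.mean_ne_zero h.mean
  set q : ℂ := ((1 / σ : ℝ) : ℂ) with hq
  have hgM : g ≤ M • heaviside := fun t => by
    rcases lt_or_ge t 0 with ht | ht
    · simp [h.g_zero t ht.le]
    · simpa [heaviside_of_nonneg ht] using hM t
  have hP1 : tailInt g ≤ (1 : ℝ≥0∞) • heaviside := by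
    have := tailInt_le_smul_heaviside g
    rwa [h.mass] at this
  have hGS := tailInt_le_smul_heaviside (tailInt g)
  set D := ENNReal.ofReal c ^ 2 with hD
  have hD0 : D ≠ 0 := pow_ne_zero _ (by simpa using hc)
  have hDt : D ≠ ∞ := ENNReal.pow_ne_top ENNReal.ofReal_ne_top
  have hqt : ‖q‖ₑ ^ 2 ≠ ∞ := ENNReal.pow_ne_top enorm_ne_top
  refine ⟨D⁻¹ * (4 * (M + ‖q‖ₑ ^ 2 * S) + 4 * S + 4 * ‖q‖ₑ ^ 2), ?_, fun ε hε hε1 => ?_⟩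
  · have h4 : (4 : ℝ≥0∞) ≠ ∞ := by norm_num
    have := h.mean
    exact ENNReal.mul_ne_top (ENNReal.inv_ne_top.2 hD0) (ENNReal.add_ne_top.2 ⟨ENNReal.add_ne_top.2
      ⟨ENNReal.mul_ne_top h4 (ENNReal.add_ne_top.2 ⟨hMt, ENNReal.mul_ne_top hqt this⟩),
        ENNReal.mul_ne_top h4 this⟩, ENNReal.mul_ne_top h4 hqt⟩)
  have fg := h.dampedFinite_g hε.le
  have fu := h.dampedFinite_u hε
  have fP := h.dampedFinite_tail hε.le
  have fG := h.dampedFinite_tail_tail hε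
  have fh := dampedFinite_heaviside hε
  have mg : MemLp (damped ε g) 2 := memLp_two_damped hg fg hMt
    (Eventually.of_forall (expWeight_mul_le_of_le_smul_heaviside hε.le hgM))
  have mP : MemLp (damped ε (tailInt g)) 2 := memLp_two_damped hP fP ENNReal.one_ne_top
    (Eventually.of_forall (expWeight_mul_le_of_le_smul_heaviside hε.le hP1))
  have mG : MemLp (damped ε (tailInt (tailInt g))) 2 := memLp_two_damped hG fG h.mean
    (Eventually.of_forall (expWeight_mul_le_of_le_smul_heaviside hε.le hGS))
  have mh : MemLp (damped ε heaviside) 2 := memLp_two_damped hh fh ENNReal.one_ne_top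
    (Eventually.of_forall (expWeight_mul_le_of_le_smul_heaviside hε.le (one_smul _ _).ge))
  have mu : MemLp (damped ε u) 2 := memLp_two_damped hu fu
    (ENNReal.add_ne_top.2 ⟨hMt, ENNReal.mul_ne_top hMt fu⟩) (h.u_bound hM hε)
  have iA := (fu.integrable hu).sub ((fh.integrable hh).const_mul q)
  have i_f := (fg.integrable hg).sub ((fP.integrable hP).const_mul q)
  have iF := (fP.integrable hP).sub ((fG.integrable hG).const_mul q)
  have pA := lintegral_enorm_sq_fourier iA (mu.sub (mh.const_mul q))
  have pf := lintegral_enorm_sq_fourier i_f (mg.sub (mP.const_mul q))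
  have pF := lintegral_enorm_sq_fourier iF (mP.sub (mG.const_mul q))
  have key : ∀ ξ, D * ‖𝓕 (fun t => damped ε u t - q * damped ε heaviside t) ξ‖ₑ ^ 2 ≤
      ‖𝓕 (fun t => damped ε g t - q * damped ε (tailInt g) t) ξ‖ₑ ^ 2 +
      ‖𝓕 (fun t => damped ε (tailInt g) t - q * damped ε (tailInt (tailInt g)) t) ξ‖ₑ ^ 2 := by
    intro ξ
    rw [fourier_sub_mul (fu.integrable hu) (fh.integrable hh),
      fourier_sub_mul (fg.integrable hg) (fP.integrable hP),
      fourier_sub_mul (fP.integrable hP) (fG.integrable hG)]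
    have e0 := laplaceFourier_heaviside hε ξ
    have e1 := h.laplaceFourier_u hε ξ
    have e2 := h.laplaceFourier_tail hε ξ
    have e3 := h.laplaceFourier_tail_tail hε ξ
    have hlowξ := hlow ε hε hε1 ξ
    simp only [laplaceFourier] at e0 e1 e2 e3 hlowξ
    rw [← hS, ← hσ] at e3
    rw [← e0] at e2 e3
    have hσq : (σ : ℂ) * q = 1 := by
      rw [hq, ← Complex.ofReal_mul, mul_one_div_cancel hσpos.ne', Complex.ofReal_one]
    set U := 𝓕 (damped ε u) ξ
    set E := 𝓕 (damped ε heaviside) ξ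
    set Γ := 𝓕 (damped ε g) ξ
    set W := 𝓕 (damped ε (tailInt g)) ξ
    set Θ := 𝓕 (damped ε (tailInt (tailInt g))) ξ
    -- The factor `1 - Γ` degenerates near frequency zero as `ε` tends to zero; there the second
    -- identity, with factor `W`, takes over.
    have r1 : (1 - Γ) * (U - q * E) = Γ - q * W := by
      linear_combination e1 - q * e2
    have r2 : W * (U - q * E) = -(W - q * Θ) := by
      linear_combination (-U - 1) * e2 + E * e1 + q * e3 - E * hσq
    rcases hlowξ with hl | hl
    · refine le_trans ?_ le_self_add
      rw [← r1, enorm_mul, mul_pow]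
      gcongr
      rw [hD, ← ofReal_norm]
      exact pow_le_pow_left' (ENNReal.ofReal_le_ofReal hl) 2
    · refine le_trans ?_ le_add_self
      rw [← enorm_neg (W - q * Θ), ← r2, enorm_mul, mul_pow]
      gcongr
      rw [hD, ← ofReal_norm]
      exact pow_le_pow_left' (ENNReal.ofReal_le_ofReal hl) 2
  have hsplit : ∀ a b : ℝ → ℝ≥0∞, Measurable a → Measurable b →
      ∫⁻ t, ‖damped ε a t - q * damped ε b t‖ₑ ^ 2 ≤
        4 * ((∫⁻ t, ‖damped ε a t‖ₑ ^ 2) + ‖q‖ₑ ^ 2 * ∫⁻ t, ‖damped ε b t‖ₑ ^ 2) := by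
    intro a b ha hb
    have ha' := measurable_damped ε ha
    have hb' := measurable_damped ε hb
    rw [← lintegral_const_mul _ (by fun_prop), ← lintegral_add_left (by fun_prop),
      ← lintegral_const_mul _ (by fun_prop)]
    exact lintegral_mono fun t => enorm_sub_mul_sq_le q _ _
  have bg := lintegral_enorm_damped_sq_le hε.le hg hgM
  have bP := lintegral_enorm_damped_sq_le hε.le hP hP1
  rw [h.mass, mul_one] at bg
  rw [one_mul, ← hS] at bP
  set I := ∫⁻ t, ‖damped ε (tailInt (tailInt g)) t‖ₑ ^ 2 with hI
  have hcF : Measurable (𝓕 (fun t => damped ε g t - q * damped ε (tailInt g) t)) :=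
    (VectorFourier.fourierIntegral_continuous Real.continuous_fourierChar
    (by exact continuous_inner) i_f).measurable
  have fin : D * ∫⁻ t, ‖damped ε u t - q * damped ε heaviside t‖ₑ ^ 2 ≤
      (4 * (M + ‖q‖ₑ ^ 2 * S) + 4 * S + 4 * ‖q‖ₑ ^ 2) * (1 + I) := by
    calc D * ∫⁻ t, ‖damped ε u t - q * damped ε heaviside t‖ₑ ^ 2
        = ∫⁻ ξ, D * ‖𝓕 (fun t => damped ε u t - q * damped ε heaviside t) ξ‖ₑ ^ 2 := by
          rw [lintegral_const_mul' _ _ hDt]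
          congr 1
          exact pA.symm
      _ ≤ ∫⁻ ξ, (‖𝓕 (fun t => damped ε g t - q * damped ε (tailInt g) t) ξ‖ₑ ^ 2 +
          ‖𝓕 (fun t => damped ε (tailInt g) t - q * damped ε (tailInt (tailInt g)) t) ξ‖ₑ ^ 2) :=
          lintegral_mono key
      _ = (∫⁻ t, ‖damped ε g t - q * damped ε (tailInt g) t‖ₑ ^ 2) +
          ∫⁻ t, ‖damped ε (tailInt g) t - q * damped ε (tailInt (tailInt g)) t‖ₑ ^ 2 := by
          rw [lintegral_add_left (by fun_prop)]
          exact congrArg₂ _ pf pF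
      _ ≤ 4 * (M + ‖q‖ₑ ^ 2 * S) + 4 * (S + ‖q‖ₑ ^ 2 * I) := by
          refine add_le_add ((hsplit g _ hg hP).trans ?_) ((hsplit _ _ hP hG).trans ?_) <;> gcongr
      _ ≤ 4 * (M + ‖q‖ₑ ^ 2 * S) + 4 * (S + ‖q‖ₑ ^ 2 * I) +
          ((4 * (M + ‖q‖ₑ ^ 2 * S) + 4 * S) * I + 4 * ‖q‖ₑ ^ 2) := le_self_add
      _ = _ := by ring
  calc ∫⁻ t, ‖damped ε u t - q * damped ε heaviside t‖ₑ ^ 2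
      = D⁻¹ * (D * ∫⁻ t, ‖damped ε u t - q * damped ε heaviside t‖ₑ ^ 2) := by
        rw [← mul_assoc, ENNReal.inv_mul_cancel hD0 hDt, one_mul]
    _ ≤ _ := by
        rw [mul_assoc D⁻¹]
        exact mul_le_mul_right fin _

end RenewalPair

/-! ### Regular variation: Potter bounds and moments of the integrated tail. -/

/-- Potter-type bounds for a decreasing function beyond a threshold. -/
theorem potter_bounds_of_doubling {Φ : ℝ → ℝ} (hanti : AntitoneOn Φ (Ici 0))
    (hpos : ∀ t, 0 ≤ t → 0 < Φ t) {p q t₀ : ℝ} (hp : 0 ≤ p) (hq : 0 ≤ q) (ht₀ : 1 ≤ t₀)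
    (hlow : ∀ t, t₀ ≤ t → Φ t ≤ 2 ^ p * Φ (t * 2))
    (hup : ∀ t, t₀ ≤ t → Φ (t * 2) ≤ 2 ^ (-q) * Φ t) {s t : ℝ} (hs : t₀ ≤ s) (hst : s ≤ t) :
    Φ s ≤ 2 ^ p * (t / s) ^ p * Φ t ∧ Φ t ≤ 2 ^ q * (t / s) ^ (-q) * Φ s := by
  have hs0 : 0 < s := by linarith
  have hge : ∀ k : ℕ, t₀ ≤ s * 2 ^ k := fun k =>
    hs.trans (le_mul_of_one_le_right hs0.le (one_le_pow₀ one_le_two))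
  have h1 : ∀ k : ℕ, Φ s ≤ (2 ^ k : ℝ) ^ p * Φ (s * 2 ^ k) := fun k => by
    induction k with
    | zero => simp
    | succ k ih =>
      refine ih.trans ?_
      rw [pow_succ, Real.mul_rpow (by positivity) (by norm_num), mul_assoc, ← mul_assoc s]
      exact mul_le_mul_of_nonneg_left (hlow _ (hge k)) (by positivity)
  have h2 : ∀ k : ℕ, Φ (s * 2 ^ k) ≤ (2 ^ k : ℝ) ^ (-q) * Φ s := fun k => by
    induction k with
    | zero => simp
    | succ k ih =>
      rw [pow_succ, ← mul_assoc]
      refine (hup _ (hge k)).trans ?_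
      rw [Real.mul_rpow (by positivity) (by norm_num), mul_comm ((2 ^ k : ℝ) ^ (-q)), mul_assoc]
      exact mul_le_mul_of_nonneg_left ih (by positivity)
  -- Locates `t` between `s * 2 ^ k` and `s * 2 ^ (k + 1)`. Monotonicity fills in between dyadic
  -- points, so the limit of `Φ (t * x) / Φ t` is needed only at `x = 2`.
  obtain ⟨k, hk1, hk2⟩ := exists_nat_pow_near ((one_le_div hs0).2 hst) one_lt_two
  rw [le_div_iff₀ hs0] at hk1
  rw [div_lt_iff₀ hs0] at hk2
  have hts : 0 < t / s := div_pos (by linarith) hs0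
  have hΦs := hpos s hs0.le
  have hΦt := hpos t (by linarith)
  constructor
  · calc Φ s ≤ (2 ^ (k + 1) : ℝ) ^ p * Φ (s * 2 ^ (k + 1)) := h1 _
      _ ≤ (2 ^ (k + 1) : ℝ) ^ p * Φ t := by
        refine mul_le_mul_of_nonneg_left (hanti ?_ ?_ (by linarith)) (by positivity)
        · exact mem_Ici.2 (by linarith)
        · exact mem_Ici.2 (by positivity)
      _ ≤ (2 * (t / s)) ^ p * Φ t := by
        refine mul_le_mul_of_nonneg_right (Real.rpow_le_rpow (by positivity) ?_ hp) hΦt.le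
        rw [pow_succ, mul_comm]
        refine mul_le_mul_of_nonneg_left ?_ zero_le_two
        rwa [le_div_iff₀ hs0]
      _ = _ := by rw [Real.mul_rpow zero_le_two hts.le]
  · calc Φ t ≤ Φ (s * 2 ^ k) := by
          refine hanti (mem_Ici.2 (by positivity)) (mem_Ici.2 (by linarith)) (by linarith)
      _ ≤ (2 ^ k : ℝ) ^ (-q) * Φ s := h2 k
      _ ≤ (t / s / 2) ^ (-q) * Φ s := by
        refine mul_le_mul_of_nonneg_right
          (Real.rpow_le_rpow_of_nonpos (by positivity) ?_ (by linarith)) hΦs.le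
        rw [div_le_iff₀ zero_lt_two, div_le_iff₀ hs0, ← pow_succ]
        exact hk2.le
      _ = _ := by
        rw [Real.div_rpow hts.le zero_le_two, Real.rpow_neg zero_le_two, div_inv_eq_mul]
        ring

/-- Potter's bounds for a decreasing regularly varying function. -/
theorem exists_potter_bounds {Φ : ℝ → ℝ} (hanti : AntitoneOn Φ (Ici 0))
    (hpos : ∀ t, 0 ≤ t → 0 < Φ t) {β δ : ℝ}
    (hlim : Tendsto (fun t => Φ (t * 2) / Φ t) atTop (𝓝 (2 ^ (-β)))) (hδ : 0 < δ) (hδβ : δ ≤ β) :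
    ∃ C : ℝ, 0 < C ∧ ∀ s t : ℝ, 1 ≤ s → s ≤ t →
      Φ s ≤ C * (t / s) ^ (β + δ) * Φ t ∧ Φ t ≤ C * (t / s) ^ (-(β - δ)) * Φ s := by
  have hlt : ∀ a b : ℝ, a < b → (2 : ℝ) ^ a < 2 ^ b := fun a b h =>
    Real.rpow_lt_rpow_of_exponent_lt one_lt_two h
  have hev := (hlim.eventually (lt_mem_nhds (hlt (-(β + δ)) (-β) (by linarith)))).and
    (hlim.eventually (gt_mem_nhds (hlt (-β) (-(β - δ)) (by linarith))))
  obtain ⟨t₁, ht₁⟩ := eventually_atTop.1 hev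
  set t₀ := max t₁ 1 with ht₀
  have ht₀1 : 1 ≤ t₀ := le_max_right _ _
  have hlow : ∀ t, t₀ ≤ t → Φ t ≤ 2 ^ (β + δ) * Φ (t * 2) := fun t ht => by
    have h1 := (ht₁ t ((le_max_left _ _).trans ht)).1
    rw [lt_div_iff₀ (hpos t (by linarith)), Real.rpow_neg zero_le_two, inv_mul_lt_iff₀
      (by positivity)] at h1
    exact h1.le
  have hup : ∀ t, t₀ ≤ t → Φ (t * 2) ≤ 2 ^ (-(β - δ)) * Φ t := fun t ht => by
    have h1 := (ht₁ t ((le_max_left _ _).trans ht)).2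
    rw [div_lt_iff₀ (hpos t (by linarith))] at h1
    exact h1.le
  have hb := fun {s t : ℝ} (hs : t₀ ≤ s) (hst : s ≤ t) => potter_bounds_of_doubling hanti hpos
    (show 0 ≤ β + δ by linarith) (show 0 ≤ β - δ by linarith) ht₀1 hlow hup hs hst
  -- Extends the bounds from `s ≥ t₀` to `s ≥ 1`: both arguments are multiplied by `t₀`, which keeps
  -- their ratio and costs `K`. For `s ≤ t₀`, `K` compares the extreme values `Φ 0` and `Φ (t₀ *
  -- t₀)`.
  obtain ⟨K, hK, hKb⟩ : ∃ K : ℝ, 0 < K ∧ ∀ s, 1 ≤ s → Φ s ≤ K * Φ (t₀ * s) := by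
    have hq := hpos (t₀ * t₀) (by positivity)
    have h0 := hpos 0 le_rfl
    refine ⟨max (2 ^ (β + δ) * t₀ ^ (β + δ)) (Φ 0 / Φ (t₀ * t₀)),
      lt_max_of_lt_right (by positivity), fun s hs => ?_⟩
    have hp := hpos (t₀ * s) (by positivity)
    rcases le_total t₀ s with h | h
    · refine (hb h (le_mul_of_one_le_left (by linarith) ht₀1)).1.trans ?_
      rw [mul_div_cancel_right₀ _ (by linarith : s ≠ 0)]
      exact mul_le_mul_of_nonneg_right (le_max_left _ _) hp.le
    · refine le_trans ?_ (mul_le_mul_of_nonneg_right (le_max_right _ _) hp.le)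
      rw [div_mul_eq_mul_div, le_div_iff₀ hq]
      refine mul_le_mul (hanti (mem_Ici.2 le_rfl) (mem_Ici.2 (by linarith)) (by linarith))
        (hanti (mem_Ici.2 (by positivity)) (mem_Ici.2 (by positivity)) ?_) hq.le h0.le
      exact mul_le_mul_of_nonneg_left h (by linarith)
  refine ⟨K * max (2 ^ (β + δ)) (2 ^ (β - δ)), by positivity, fun s t hs hst => ?_⟩
  have ht : 1 ≤ t := hs.trans hst
  have hs' : t₀ ≤ t₀ * s := le_mul_of_one_le_right (by linarith) hs
  have hst' : t₀ * s ≤ t₀ * t := mul_le_mul_of_nonneg_left hst (by linarith)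
  have h1 := hb hs' hst'
  rw [mul_div_mul_left _ _ (by linarith : t₀ ≠ 0)] at h1
  have hmono : ∀ r, 1 ≤ r → Φ (t₀ * r) ≤ Φ r := fun r hr =>
    hanti (mem_Ici.2 (by linarith)) (mem_Ici.2 (by positivity))
      (le_mul_of_one_le_left (by linarith) ht₀1)
  have hts : 0 < t / s := by positivity
  have p1 := hpos s (by linarith)
  have p2 := hpos t (by linarith)
  constructor
  · calc Φ s ≤ K * Φ (t₀ * s) := hKb s hs
      _ ≤ K * (2 ^ (β + δ) * (t / s) ^ (β + δ) * Φ (t₀ * t)) :=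
        mul_le_mul_of_nonneg_left h1.1 hK.le
      _ ≤ K * (max (2 ^ (β + δ)) (2 ^ (β - δ)) * (t / s) ^ (β + δ) * Φ t) := by
        gcongr
        · exact (hpos _ (by positivity)).le
        · exact le_max_left _ _
        · exact hmono t ht
      _ = _ := by ring
  · calc Φ t ≤ K * Φ (t₀ * t) := hKb t ht
      _ ≤ K * (2 ^ (β - δ) * (t / s) ^ (-(β - δ)) * Φ (t₀ * s)) :=
        mul_le_mul_of_nonneg_left h1.2 hK.le
      _ ≤ K * (max (2 ^ (β + δ)) (2 ^ (β - δ)) * (t / s) ^ (-(β - δ)) * Φ s) := by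
        gcongr
        · exact (hpos _ (by positivity)).le
        · exact le_max_right _ _
        · exact hmono s hs
      _ = _ := by ring

/-- One half of Karamata's theorem, together with Potter's bounds, for the integrated tail. -/
theorem exists_tail_bound {Φ : ℝ → ℝ} (hanti : AntitoneOn Φ (Ici 0))
    (hpos : ∀ t, 0 ≤ t → 0 < Φ t) {α δ : ℝ}
    (hlim : Tendsto (fun t => Φ (t * 2) / Φ t) atTop (𝓝 (2 ^ (-α - 1)))) (hδ : 0 < δ)
    (hδα : δ < α) {P : ℝ → ℝ≥0∞} (hP : ∀ t, 0 ≤ t → P t = ENNReal.ofReal (Φ t)) :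
    ∃ K : ℝ, 0 < K ∧ ∀ N : ℝ, 1 ≤ N → 1 ≤ K * (N ^ (α + 1 + δ) * Φ N) ∧
      ∀ t : ℝ, 1 ≤ t → t ≤ N →
        tailInt P t ≤ ENNReal.ofReal (K * (N ^ (α + 1 + δ) * Φ N) * t ^ (-(α + δ))) := by
  rw [show -α - 1 = -(α + 1) by ring] at hlim
  obtain ⟨C, hC, hb⟩ := exists_potter_bounds hanti hpos hlim hδ (by linarith)
  have h1pos := hpos 1 zero_le_one
  refine ⟨max (C / Φ 1) (C * (1 / (α - δ)) * C), lt_max_of_lt_left (by positivity), fun N hN => ?_⟩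
  have hN0 : 0 < N := by linarith
  have hΦN := hpos N hN0.le
  refine ⟨?_, fun t ht htN => ?_⟩
  · refine le_trans ?_ (mul_le_mul_of_nonneg_right (le_max_left _ _) (by positivity))
    have := (hb 1 N le_rfl hN).1
    rw [div_one] at this
    rw [div_mul_eq_mul_div, one_le_div h1pos]
    linarith
  have ht0 : 0 < t := by linarith
  have hΦt := hpos t ht0.le
  -- The Karamata estimate: the upper Potter bound is integrable at infinity since `δ < α`. The
  -- lower Potter bound then moves the reference point from `t` to `N`.
  have hint : tailInt P t ≤ ENNReal.ofReal (C * (1 / (α - δ)) * t * Φ t) := by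
    have hexp : -(α + 1 - δ) < -1 := by linarith
    have hi := integral_Ioi_rpow_of_lt hexp ht0
    have hii := integrableOn_Ioi_rpow_of_lt hexp ht0
    rw [tailInt_of_nonneg P ht0.le]
    calc ∫⁻ s in Ioi t, P s
        ≤ ∫⁻ s in Ioi t, ENNReal.ofReal (C * t ^ (α + 1 - δ) * Φ t * s ^ (-(α + 1 - δ))) := by
          refine setLIntegral_mono' measurableSet_Ioi fun s hs => ?_
          have hs0 : 0 < s := ht0.trans hs
          rw [hP s hs0.le]
          refine ENNReal.ofReal_le_ofReal (((hb t s ht (le_of_lt hs)).2).trans_eq ?_)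
          rw [Real.div_rpow hs0.le ht0.le, Real.rpow_neg ht0.le (α + 1 - δ), div_inv_eq_mul]
          ring
      _ = ENNReal.ofReal (∫ s in Ioi t, C * t ^ (α + 1 - δ) * Φ t * s ^ (-(α + 1 - δ))) := by
          refine (ofReal_integral_eq_lintegral_ofReal (hii.const_mul _) ?_).symm
          filter_upwards [ae_restrict_mem measurableSet_Ioi] with s hs
          have hs0 : 0 < s := ht0.trans hs
          simp only [Pi.zero_apply]
          positivity
      _ = _ := by
          rw [integral_const_mul, hi]
          congr 1
          rw [show -(α + 1 - δ) + 1 = -(α - δ) by ring, show α + 1 - δ = (α - δ) + 1 by ring,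
            Real.rpow_add_one ht0.ne', Real.rpow_neg ht0.le]
          have : t ^ (α - δ) ≠ 0 := by positivity
          have : α - δ ≠ 0 := by linarith
          field_simp
  refine hint.trans (ENNReal.ofReal_le_ofReal ?_)
  have hcd : 0 ≤ C * (1 / (α - δ)) := mul_nonneg hC.le (one_div_nonneg.2 (by linarith))
  calc C * (1 / (α - δ)) * t * Φ t
      ≤ C * (1 / (α - δ)) * t * (C * (N / t) ^ (α + 1 + δ) * Φ N) :=
        mul_le_mul_of_nonneg_left (hb t N ht htN).1 (mul_nonneg hcd ht0.le)
    _ = C * (1 / (α - δ)) * C * (N ^ (α + 1 + δ) * Φ N) * t ^ (-(α + δ)) := by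
        rw [Real.div_rpow hN0.le ht0.le, show α + 1 + δ = (α + δ) + 1 by ring,
          Real.rpow_add_one ht0.ne', Real.rpow_neg ht0.le]
        have : t ^ (α + δ) ≠ 0 := by positivity
        field_simp
    _ ≤ _ := by
        gcongr
        exact le_max_right _ _

theorem lintegral_expWeight_heaviside {N : ℝ} (hN : 0 < N) :
    ∫⁻ t, expWeight (1 / N) t * heaviside t = ENNReal.ofReal N := by
  have hε : 0 < 1 / N := by positivity
  have h1 : ∫⁻ t, expWeight (1 / N) t * heaviside t =
      ∫⁻ t in Ici (0 : ℝ), ENNReal.ofReal (Real.exp (-(1 / N * t))) := by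
    rw [← lintegral_indicator measurableSet_Ici]
    refine lintegral_congr fun t => ?_
    by_cases ht : t ∈ Ici (0 : ℝ)
    · rw [heaviside_of_nonneg ht, indicator_of_mem ht, mul_one, expWeight]
    · rw [heaviside_of_neg (by simpa using ht), indicator_of_notMem ht, mul_zero]
  have h2 : IntegrableOn (fun t => Real.exp (-(1 / N) * t)) (Ioi 0) := exp_neg_integrableOn_Ioi 0 hε
  have h3 := integral_exp_mul_Ioi (a := -(1 / N)) (by linarith) 0
  rw [h1, setLIntegral_congr Ioi_ae_eq_Ici.symm]
  simp only [← neg_mul]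
  rw [← ofReal_integral_eq_lintegral_ofReal h2 (Eventually.of_forall fun t => (Real.exp_pos _).le),
    h3]
  congr 1
  simp

/-- Exponentially weighted integrals of a function dominated by a power. -/
theorem exists_lintegral_expWeight_le {e : ℝ} (he : e ≠ 1) :
    ∃ C : ℝ, 0 < C ∧ ∀ N : ℝ, 1 ≤ N → ∀ (A : ℝ≥0∞) (H : ℝ → ℝ≥0∞),
      (∀ t, t < 0 → H t = 0) → (∀ t, 0 ≤ t → t < 1 → H t ≤ A) →
      (∀ t, 1 ≤ t → t ≤ N → H t ≤ A * ENNReal.ofReal (t ^ (-e))) →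
      (∀ t, N < t → H t ≤ A * ENNReal.ofReal (N ^ (-e))) →
      ∫⁻ t, expWeight (1 / N) t * H t ≤ A * ENNReal.ofReal (C * N ^ (max (1 - e) 0)) := by
  -- One summand for each of the ranges `[0, 1)`, `[1, N]` and `(N, ∞)`; on the last, the weight has
  -- mass at most `N`.
  refine ⟨1 + |1 / (1 - e)| + 1, by positivity, fun N hN A H h0 h1 h2 h3 => ?_⟩
  have hN0 : 0 < N := by linarith
  have hε : 0 ≤ 1 / N := by positivity
  set μ := max (1 - e) 0 with hμ
  have hNμ : 1 ≤ N ^ μ := Real.one_le_rpow hN (le_max_right _ _)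
  have hNe : N ^ (1 - e) ≤ N ^ μ := Real.rpow_le_rpow_of_exponent_le hN (le_max_left _ _)
  have hpt : ∀ t, expWeight (1 / N) t * H t ≤ A * ((Ico (0 : ℝ) 1).indicator 1 t +
      ((Icc 1 N).indicator (fun t => ENNReal.ofReal (t ^ (-e))) t +
        ENNReal.ofReal (N ^ (-e)) * (expWeight (1 / N) t * heaviside t))) := by
    intro t
    rcases lt_or_ge t 0 with ht | ht
    · simp [h0 t ht]
    have hw : expWeight (1 / N) t * H t ≤ H t := mul_le_of_le_one_left (zero_le)
      (expWeight_le_one hε ht)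
    rcases lt_or_ge t 1 with ht1 | ht1
    · refine (hw.trans (h1 t ht ht1)).trans ?_
      rw [indicator_of_mem (mem_Ico.2 ⟨ht, ht1⟩), Pi.one_apply]
      exact le_mul_of_one_le_right (zero_le) le_self_add
    rcases le_or_gt t N with htN | htN
    · refine (hw.trans (h2 t ht1 htN)).trans (mul_le_mul_right ?_ _)
      rw [indicator_of_mem (mem_Icc.2 ⟨ht1, htN⟩)]
      exact le_self_add.trans le_add_self
    · rw [heaviside_of_nonneg ht, mul_one]
      calc expWeight (1 / N) t * H t ≤ expWeight (1 / N) t * (A * ENNReal.ofReal (N ^ (-e))) :=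
            mul_le_mul_right (h3 t htN) _
        _ = A * (ENNReal.ofReal (N ^ (-e)) * expWeight (1 / N) t) := by ring
        _ ≤ _ := mul_le_mul_right (le_add_self.trans le_add_self) _
  have hmid : ∫⁻ t in Icc 1 N, ENNReal.ofReal (t ^ (-e)) ≤
      ENNReal.ofReal (|1 / (1 - e)| * N ^ μ) := by
    have hcont : ContinuousOn (fun t : ℝ => t ^ (-e)) (Icc 1 N) := fun t ht =>
      (Real.continuousAt_rpow_const _ _ (Or.inl (by linarith [ht.1]))).continuousWithinAt
    have hi := hcont.integrableOn_Icc (μ := volume)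
    rw [← ofReal_integral_eq_lintegral_ofReal hi]
    · refine ENNReal.ofReal_le_ofReal ?_
      have h01 : (0 : ℝ) ∉ uIcc 1 N := by
        rw [uIcc_of_le hN]
        simp
      rw [integral_Icc_eq_integral_Ioc, ← intervalIntegral.integral_of_le hN,
        integral_rpow (Or.inr ⟨fun h => he (by linarith), h01⟩), Real.one_rpow,
        show -e + 1 = 1 - e by ring]
      have hpos : 0 < N ^ (1 - e) := by positivity
      rcases lt_or_gt_of_ne he with he1 | he1
      · have h5 : 0 < 1 - e := by linarith
        rw [abs_of_pos (by positivity), div_le_iff₀ h5, mul_assoc, mul_comm (N ^ μ), ← mul_assoc,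
          one_div_mul_cancel h5.ne']
        linarith
      · have h5 : 0 < e - 1 := by linarith
        rw [← neg_sub e 1, div_neg, div_neg, abs_neg, abs_of_pos (by positivity), ← neg_div,
          div_le_iff₀ h5, mul_assoc, mul_comm (N ^ μ), ← mul_assoc,
          one_div_mul_cancel h5.ne']
        rw [← neg_sub e 1] at hpos
        linarith
    · filter_upwards [ae_restrict_mem measurableSet_Icc] with t ht
      exact Real.rpow_nonneg (by linarith [ht.1]) _
  have hrm : Measurable fun t : ℝ => ENNReal.ofReal (t ^ (-e)) := by fun_prop
  have hm1 : Measurable ((Ico (0 : ℝ) 1).indicator (1 : ℝ → ℝ≥0∞)) :=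
    measurable_one.indicator measurableSet_Ico
  have hm2 := hrm.indicator (measurableSet_Icc (a := (1 : ℝ)) (b := N))
  have hm3 := measurable_heaviside
  calc ∫⁻ t, expWeight (1 / N) t * H t ≤ ∫⁻ t, A * ((Ico (0 : ℝ) 1).indicator 1 t +
      ((Icc 1 N).indicator (fun t => ENNReal.ofReal (t ^ (-e))) t +
        ENNReal.ofReal (N ^ (-e)) * (expWeight (1 / N) t * heaviside t))) := lintegral_mono hpt
    _ = A * (1 + ((∫⁻ t in Icc 1 N, ENNReal.ofReal (t ^ (-e))) +
        ENNReal.ofReal (N ^ (-e)) * ENNReal.ofReal N)) := by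
      rw [lintegral_const_mul _ (by fun_prop), lintegral_add_left hm1, lintegral_add_left hm2,
        lintegral_indicator_one measurableSet_Ico, lintegral_indicator measurableSet_Icc,
        lintegral_const_mul _ (by fun_prop), lintegral_expWeight_heaviside hN0, Real.volume_Ico,
        sub_zero, ENNReal.ofReal_one]
    _ ≤ A * (ENNReal.ofReal (N ^ μ) + (ENNReal.ofReal (|1 / (1 - e)| * N ^ μ) +
        ENNReal.ofReal (N ^ μ))) := by
      refine mul_le_mul_right (add_le_add (ENNReal.one_le_ofReal.2 hNμ) (add_le_add hmid ?_)) _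
      · rw [← ENNReal.ofReal_mul (by positivity)]
        refine ENNReal.ofReal_le_ofReal (le_trans (le_of_eq ?_) hNe)
        rw [← Real.rpow_add_one hN0.ne']
        congr 1
        ring
    _ = _ := by
      rw [← ENNReal.ofReal_add (by positivity) (by positivity),
        ← ENNReal.ofReal_add (by positivity) (by positivity)]
      congr 2
      ring

/-- Exponentially weighted moments of the integrated tail of a regularly varying function. -/
theorem exists_lintegral_tail_pow_le {Φ : ℝ → ℝ} (hanti : AntitoneOn Φ (Ici 0))
    (hpos : ∀ t, 0 ≤ t → 0 < Φ t) {α δ : ℝ}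
    (hlim : Tendsto (fun t => Φ (t * 2) / Φ t) atTop (𝓝 (2 ^ (-α - 1)))) (hδ : 0 < δ)
    (hδα : δ < α) {P : ℝ → ℝ≥0∞} (hP : ∀ t, 0 ≤ t → P t = ENNReal.ofReal (Φ t))
    (hPfin : ∫⁻ t, P t ≠ ∞) {p : ℕ} (hp : p ≠ 0) (he : p * (α + δ) ≠ 1) :
    ∃ C : ℝ, 0 < C ∧ ∀ N : ℝ, 1 ≤ N →
      1 + ∫⁻ t, expWeight (1 / N) t * tailInt P t ^ p ≤
        ENNReal.ofReal (C * ((N ^ (α + 1 + δ) * Φ N) ^ p * N ^ (max (1 - p * (α + δ)) 0))) := by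
  obtain ⟨K, hK, hb⟩ := exists_tail_bound hanti hpos hlim hδ hδα hP
  obtain ⟨C, hC, hw⟩ := exists_lintegral_expWeight_le he
  set S := (∫⁻ t, P t).toReal with hS
  have hS0 : 0 ≤ S := ENNReal.toReal_nonneg
  -- The factor `1 + S` covers `[0, 1)`, where the integrated tail is at most `S` and `K * X` is at
  -- least `1`; the `1` in `1 + C` absorbs the additive `1` of the conclusion.
  refine ⟨(K * (1 + S)) ^ p * (1 + C), by positivity, fun N hN => ?_⟩
  have hN0 : 0 < N := by linarith
  have hΦN := hpos N hN0.le
  set X := N ^ (α + 1 + δ) * Φ N with hX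
  have hX0 : 0 < X := by positivity
  obtain ⟨hb1, hb2⟩ := hb N hN
  have hKX : K * X ≤ K * (1 + S) * X := by
    have : 0 ≤ K * S * X := by positivity
    linarith
  have hle : ∀ t, 1 ≤ t → t ≤ N → tailInt P t ^ p ≤
      ENNReal.ofReal ((K * (1 + S) * X) ^ p) * ENNReal.ofReal (t ^ (-(p * (α + δ)))) := by
    intro t ht htN
    have ht0 : 0 < t := by linarith
    calc tailInt P t ^ p ≤ ENNReal.ofReal (K * (1 + S) * X * t ^ (-(α + δ))) ^ p := by
          refine pow_le_pow_left' ((hb2 t ht htN).trans (ENNReal.ofReal_le_ofReal ?_)) p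
          gcongr
      _ = _ := by
          rw [← ENNReal.ofReal_pow (by positivity), mul_pow, ENNReal.ofReal_mul (by positivity)]
          congr 2
          rw [← Real.rpow_natCast, ← Real.rpow_mul ht0.le]
          congr 1
          ring
  have hmain := hw N hN (ENNReal.ofReal ((K * (1 + S) * X) ^ p)) (fun t => tailInt P t ^ p)
    (fun t ht => by simp [tailInt_of_neg P ht, hp])
    (fun t ht0 ht1 => by
      rw [ENNReal.ofReal_pow (by positivity)]
      refine pow_le_pow_left' ((tailInt_le P t).trans ?_) p
      rw [← ENNReal.ofReal_toReal hPfin]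
      refine ENNReal.ofReal_le_ofReal ?_
      rw [← hS]
      nlinarith)
    hle (fun t ht => (pow_le_pow_left' (tailInt_anti P hN0.le ht.le) p).trans
      (hle N hN le_rfl))
  set μ := max (1 - p * (α + δ)) 0 with hμ
  have hNμ : 1 ≤ N ^ μ := Real.one_le_rpow hN (le_max_right _ _)
  have h1 : (1 : ℝ≥0∞) ≤ ENNReal.ofReal ((K * (1 + S) * X) ^ p * N ^ μ) := by
    rw [ENNReal.one_le_ofReal]
    exact one_le_mul_of_one_le_of_one_le (one_le_pow₀ (hb1.trans hKX)) hNμ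
  refine (add_le_add h1 hmain).trans (le_of_eq ?_)
  rw [← ENNReal.ofReal_mul (by positivity), ← ENNReal.ofReal_add (by positivity) (by positivity)]
  congr 1
  rw [mul_pow _ X]
  ring

/-! ### From a kernel and its resolvent to a renewal pair. -/

/-- A non-integrable function has integral zero by convention, so no hypothesis is needed. This lets
the Volterra integral be estimated before its integrability and the sign of the resolvent are known.
-/
theorem ofReal_integral_le_lintegral_ofReal {α : Type*} [MeasurableSpace α] {μ : Measure α}
    (f : α → ℝ) : ENNReal.ofReal (∫ x, f x ∂μ) ≤ ∫⁻ x, ENNReal.ofReal (f x) ∂μ := by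
  by_cases hf : Integrable f μ
  · rw [integral_eq_lintegral_pos_part_sub_lintegral_neg_part hf]
    refine le_trans (ENNReal.ofReal_le_ofReal (sub_le_self _ ENNReal.toReal_nonneg)) ?_
    exact ENNReal.ofReal_toReal_le
  · simp [integral_undef hf]

/-- Truncation to `(-∞, T]` does not change a causal convolution up to time `T`. -/
theorem lconvolution_truncate {g a : ℝ → ℝ≥0∞} (hg : ∀ t, t ≤ 0 → g t = 0) {t T : ℝ} (h : t ≤ T) :
    (g ⋆ₗ a) t = (g ⋆ₗ (Iic T).indicator a) t := by
  simp only [lconvolution_def]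
  refine lintegral_congr fun y => ?_
  rcases le_or_gt y 0 with hy | hy
  · simp [hg y hy]
  · rw [indicator_of_mem (mem_Iic.2 (by linarith))]

/-- A locally integrable subsolution of the homogeneous renewal inequality vanishes. -/
theorem ae_eq_zero_of_le_lconvolution {g v : ℝ → ℝ≥0∞} (hgm : Measurable g) (hvm : Measurable v)
    (hg0 : ∀ t, t ≤ 0 → g t = 0) (hv0 : ∀ t, t ≤ 0 → v t = 0) (hmass : ∫⁻ t, g t = 1)
    (hfin : ∀ T : ℝ, ∫⁻ t in Iic T, v t ≠ ∞) (hle : v ≤ᵐ[volume] g ⋆ₗ v) : v =ᵐ[volume] 0 := by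
  have hw1 : ∀ a : ℝ → ℝ≥0∞, (∀ t, t ≤ 0 → a t = 0) → ∀ t, expWeight 1 t * a t ≤ a t := by
    intro a ha t
    rcases le_or_gt t 0 with ht | ht
    · simp [ha t ht]
    · exact mul_le_of_le_one_left (zero_le) (expWeight_le_one zero_le_one ht.le)
  -- The weight makes the critical kernel strictly subcritical, since it is less than `1` on `(0,
  -- ∞)` where `g` lives.
  have hq : ∫⁻ t, expWeight 1 t * g t < 1 := by
    rw [← hmass]
    refine lintegral_strict_mono_of_ae_le_of_frequently_ae_lt hgm.aemeasurable ?_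
      (Eventually.of_forall (hw1 g hg0)) ?_
    · exact ne_top_of_le_ne_top (by simp [hmass]) (lintegral_mono (hw1 g hg0))
    · intro hcon
      have h0 : g =ᵐ[volume] 0 := by
        filter_upwards [hcon, ae_lt_top hgm (by simp [hmass])] with t ht htop
        rw [not_not] at ht
        rcases le_or_gt t 0 with ht0 | ht0
        · exact hg0 t ht0
        · by_contra hne
          have h1 : expWeight 1 t < 1 := by
            rw [expWeight, ENNReal.ofReal_lt_one, Real.exp_lt_one_iff]
            linarith
          have h2 := ENNReal.mul_lt_mul_left hne htop.ne h1
          rw [ht, one_mul] at h2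
          exact lt_irrefl _ h2
      rw [lintegral_congr_ae h0] at hmass
      simp at hmass
  -- Truncation makes the weighted mass of `v` finite, so `m ≤ q m` with `q < 1` forces `m = 0`. By
  -- causality it preserves the inequality.
  have hT : ∀ n : ℕ, (Iic (n : ℝ)).indicator v =ᵐ[volume] 0 := by
    intro n
    set vn := (Iic (n : ℝ)).indicator v with hvn
    have hvnm : Measurable vn := hvm.indicator measurableSet_Iic
    have hvn0 : ∀ t, t ≤ 0 → vn t = 0 := fun t ht => by
      simp [hvn, indicator_apply, hv0 t ht]
    have h1 : vn ≤ᵐ[volume] g ⋆ₗ vn := by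
      filter_upwards [hle] with t ht
      by_cases htn : t ∈ Iic (n : ℝ)
      · rw [hvn, indicator_of_mem htn, ← lconvolution_truncate hg0 htn]
        exact ht
      · rw [hvn, indicator_of_notMem htn]
        exact zero_le
    have h2 : ∫⁻ t, expWeight 1 t * vn t ≤
        (∫⁻ t, expWeight 1 t * g t) * ∫⁻ t, expWeight 1 t * vn t := by
      rw [← lintegral_expWeight_mul_lconvolution 1 hgm hvnm]
      refine lintegral_mono_ae ?_
      filter_upwards [h1] with t ht
      exact mul_le_mul_right ht _
    have h3 : ∫⁻ t, expWeight 1 t * vn t ≠ ∞ := by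
      refine ne_top_of_le_ne_top (hfin n) ?_
      rw [← lintegral_indicator measurableSet_Iic]
      exact lintegral_mono (hw1 vn hvn0)
    have h4 : ∫⁻ t, expWeight 1 t * vn t = 0 := by
      by_contra hne
      have h5 := ENNReal.mul_lt_mul_left hne h3 hq
      rw [one_mul] at h5
      exact absurd h2 (not_le.2 h5)
    filter_upwards [(lintegral_eq_zero_iff (by fun_prop)).1 h4] with t ht
    simpa [expWeight_ne_zero] using ht
  filter_upwards [ae_all_iff.2 hT] with t ht
  obtain ⟨n, hn⟩ := exists_nat_ge t
  have := ht n
  rwa [indicator_of_mem (mem_Iic.2 hn)] at this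

/-- The Volterra integral as a convolution of functions on the line. -/
theorem lintegral_volterra_eq {φ X : ℝ → ℝ} {g x : ℝ → ℝ≥0∞} (hφ0 : ∀ t, 0 ≤ t → 0 ≤ φ t)
    (hg0 : ∀ t, t ≤ 0 → g t = 0) (hx0 : ∀ t, t ≤ 0 → x t = 0)
    (hg : ∀ᵐ t, 0 < t → g t = ENNReal.ofReal (φ t))
    (hx : ∀ᵐ t, 0 < t → x t = ENNReal.ofReal (X t)) (t : ℝ) :
    ∫⁻ s in Ioc 0 t, ENNReal.ofReal (X (t - s) * φ s) = (g ⋆ₗ x) t := by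
  have hx' : ∀ᵐ s : ℝ, 0 < t - s → x (t - s) = ENNReal.ofReal (X (t - s)) :=
    (quasiMeasurePreserving_sub_left_of_right_invariant volume t).ae hx
  rw [lconvolution_def, ← lintegral_indicator measurableSet_Ioc]
  refine lintegral_congr_ae ?_
  have hne : ∀ᵐ s : ℝ, s ≠ t := by simp [ae_iff]
  filter_upwards [hg, hx', hne] with s hs hs' hst
  rw [show -s + t = t - s by ring]
  by_cases hmem : s ∈ Ioc 0 t
  · have hlt : s < t := lt_of_le_of_ne hmem.2 hst
    rw [indicator_of_mem hmem, hs hmem.1, hs' (by linarith), mul_comm,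
      ENNReal.ofReal_mul (hφ0 s hmem.1.le)]
  · rw [indicator_of_notMem hmem]
    rw [mem_Ioc, not_and_or, not_lt, not_le] at hmem
    rcases hmem with h | h
    · simp [hg0 s h]
    · simp [hx0 (t - s) (by linarith)]

/-- Tonelli on the region `0 ≤ t < s`. It converts integrals of tails into moments. -/
theorem lintegral_mul_tailInt {k a : ℝ → ℝ≥0∞} (hk : Measurable k) (ha : Measurable a) :
    ∫⁻ t, k t * tailInt a t = ∫⁻ s, a s * ∫⁻ t in Ico 0 s, k t := by
  have h1 : ∀ t, k t * tailInt a t =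
      ∫⁻ s, k t * ({p : ℝ × ℝ | 0 ≤ p.1 ∧ p.1 < p.2}.indicator (fun p => a p.2) (t, s)) := by
    intro t
    rw [lintegral_const_mul _ (by
      exact ((ha.comp measurable_snd).indicator
        ((measurableSet_le measurable_const measurable_fst).inter
          (measurableSet_lt measurable_fst measurable_snd))).comp measurable_prodMk_left)]
    congr 1
    rcases lt_or_ge t 0 with ht | ht
    · rw [tailInt_of_neg a ht]
      simp [not_le.2 ht]
    · rw [tailInt_of_nonneg a ht, ← lintegral_indicator measurableSet_Ioi]
      refine lintegral_congr fun s => ?_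
      simp [indicator_apply, ht]
  simp_rw [h1]
  rw [lintegral_lintegral_swap]
  · refine lintegral_congr fun s => ?_
    rw [← lintegral_const_mul _ hk, ← lintegral_indicator measurableSet_Ico]
    refine lintegral_congr fun t => ?_
    by_cases h : t ∈ Ico 0 s
    · rw [indicator_of_mem h, indicator_of_mem (show (t, s) ∈ {p : ℝ × ℝ | 0 ≤ p.1 ∧ p.1 < p.2}
        from h), mul_comm]
    · rw [indicator_of_notMem h, indicator_of_notMem
        (show (t, s) ∉ {p : ℝ × ℝ | 0 ≤ p.1 ∧ p.1 < p.2} from h), mul_zero]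
  · refine Measurable.aemeasurable ?_
    exact (hk.comp measurable_fst).mul ((ha.comp measurable_snd).indicator
        ((measurableSet_le measurable_const measurable_fst).inter
          (measurableSet_lt measurable_fst measurable_snd)))

theorem lintegral_tailInt {a : ℝ → ℝ≥0∞} (ha : Measurable a) :
    ∫⁻ t, tailInt a t = ∫⁻ s, ENNReal.ofReal s * a s := by
  have := lintegral_mul_tailInt (k := 1) measurable_one ha
  simp only [Pi.one_apply, one_mul] at this
  rw [this]
  refine lintegral_congr fun s => ?_
  simp [mul_comm]

theorem lintegral_tailInt_tailInt_le {a : ℝ → ℝ≥0∞} (ha : Measurable a) :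
    ∫⁻ t, tailInt (tailInt a) t ≤ ∫⁻ s, ENNReal.ofReal s ^ 2 * a s := by
  rw [lintegral_tailInt (measurable_tailInt a),
    lintegral_mul_tailInt (by fun_prop : Measurable fun s => ENNReal.ofReal s) ha]
  refine lintegral_mono fun s => ?_
  rw [mul_comm]
  refine mul_le_mul_left ?_ _
  calc ∫⁻ t in Ico 0 s, ENNReal.ofReal t ≤ ∫⁻ _ in Ico 0 s, ENNReal.ofReal s :=
        setLIntegral_mono measurable_const fun t ht => ENNReal.ofReal_le_ofReal ht.2.le
    _ = ENNReal.ofReal s ^ 2 := by simp [sq]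

/-- A kernel and its resolvent, as a renewal pair of extended nonnegative functions. -/
theorem exists_renewalPair {φ R : ℝ → ℝ} (hφ : WeaklyCriticalKernel φ) (hR : IsResolvent φ R) :
    ∃ g u : ℝ → ℝ≥0∞, RenewalPair g u ∧
      (∀ᵐ t, 0 < t → g t = ENNReal.ofReal (φ t)) ∧
      (∀ᵐ t, 0 < t → R t = (u t).toReal) ∧
      ∀ M : ℝ, (∀ t, 0 ≤ t → φ t ≤ M) → ∀ t, g t ≤ ENNReal.ofReal M := by
  have hmφ : AEStronglyMeasurable φ (volume.restrict (Ioi 0)) :=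
    (hφ.integrable.mono_set Ioi_subset_Ici_self).aestronglyMeasurable
  have hmR : AEStronglyMeasurable R (volume.restrict (Ioi 0)) := by
    have : Ioi (0 : ℝ) ⊆ ⋃ n : ℕ, Icc (0 : ℝ) n := fun x hx => by
      obtain ⟨n, hn⟩ := exists_nat_ge x
      exact mem_iUnion.2 ⟨n, le_of_lt hx, hn⟩
    refine AEStronglyMeasurable.mono_set this ?_
    rw [aestronglyMeasurable_iUnion_iff]
    exact fun n => (hR.locallyIntegrable n).aestronglyMeasurable
  -- Capping the measurable version of `φ` at the supremum of `φ` changes it only on a null set, and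
  -- makes any bound for `φ` hold for `g` at every point.
  set B : ℝ≥0∞ := ⨆ t ∈ Ici (0 : ℝ), ENNReal.ofReal (φ t) with hB
  set g : ℝ → ℝ≥0∞ := (Ioi (0 : ℝ)).indicator fun t => min (ENNReal.ofReal (hmφ.mk φ t)) B with hg
  set u : ℝ → ℝ≥0∞ := (Ioi (0 : ℝ)).indicator fun t => ENNReal.ofReal (hmR.mk R t) with hu
  set v : ℝ → ℝ≥0∞ := (Ioi (0 : ℝ)).indicator fun t => ENNReal.ofReal (-hmR.mk R t) with hv
  have hmkφ := hmφ.stronglyMeasurable_mk.measurable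
  have hmkR := hmR.stronglyMeasurable_mk.measurable
  have hgm : Measurable g := (hmkφ.ennreal_ofReal.min measurable_const).indicator measurableSet_Ioi
  have hum : Measurable u := hmkR.ennreal_ofReal.indicator measurableSet_Ioi
  have hvm : Measurable v := hmkR.neg.ennreal_ofReal.indicator measurableSet_Ioi
  have hzero : ∀ (k : ℝ → ℝ≥0∞) (t : ℝ), t ≤ 0 → (Ioi (0 : ℝ)).indicator k t = 0 := fun k t ht =>
    indicator_of_notMem (by simpa using ht) _
  have hg0 := hzero fun t => min (ENNReal.ofReal (hmφ.mk φ t)) B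
  have hu0 := hzero fun t => ENNReal.ofReal (hmR.mk R t)
  have hv0 := hzero fun t => ENNReal.ofReal (-hmR.mk R t)
  rw [← hg] at hg0
  rw [← hu] at hu0
  rw [← hv] at hv0
  have hgφ : ∀ᵐ t, 0 < t → g t = ENNReal.ofReal (φ t) := by
    filter_upwards [(ae_restrict_iff' measurableSet_Ioi).1 hmφ.ae_eq_mk] with t ht ht0
    rw [hg, indicator_of_mem (mem_Ioi.2 ht0), ← ht ht0]
    exact min_eq_left (le_iSup₂_of_le t (mem_Ici.2 ht0.le) le_rfl)
  have hRmk := (ae_restrict_iff' measurableSet_Ioi).1 hmR.ae_eq_mk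
  have huR : ∀ᵐ t, 0 < t → u t = ENNReal.ofReal (R t) := by
    filter_upwards [hRmk] with t ht ht0
    rw [hu, indicator_of_mem (mem_Ioi.2 ht0), ← ht ht0]
  have hvR : ∀ᵐ t, 0 < t → v t = ENNReal.ofReal (-R t) := by
    filter_upwards [hRmk] with t ht ht0
    rw [hv, indicator_of_mem (mem_Ioi.2 ht0), ← ht ht0]
  have hlint : ∀ (k : ℝ → ℝ≥0∞) (f : ℝ → ℝ), (∀ t, t ≤ 0 → k t = 0) →
      (∀ᵐ t, 0 < t → k t = ENNReal.ofReal (f t)) → ∀ T, ∫⁻ t in Iic T, k t =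
        ∫⁻ t in Ioc 0 T, ENNReal.ofReal (f t) := by
    intro k f hk0 hkf T
    rw [← lintegral_indicator measurableSet_Iic, ← lintegral_indicator measurableSet_Ioc]
    refine lintegral_congr_ae ?_
    filter_upwards [hkf] with t ht
    rcases le_or_gt t 0 with h0 | h0
    · simp [indicator_apply, hk0 t h0, not_lt.2 h0]
    · simp [indicator_apply, h0, ht h0]
  have hfin : ∀ (k : ℝ → ℝ≥0∞) (f : ℝ → ℝ), (∀ t, t ≤ 0 → k t = 0) →
      (∀ᵐ t, 0 < t → k t = ENNReal.ofReal (f t)) → (∀ T : ℝ, IntegrableOn f (Icc 0 T)) →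
      ∀ T, ∫⁻ t in Iic T, k t ≠ ∞ := by
    intro k f hk0 hkf hf T
    rw [hlint k f hk0 hkf]
    exact ((hf T).mono_set Ioc_subset_Icc_self).lintegral_lt_top.ne
  have hufin := hfin u R hu0 huR hR.locallyIntegrable
  have hvfin := hfin v (fun t => -R t) hv0 hvR fun T => (hR.locallyIntegrable T).neg
  have hwhole : ∀ (c : ℝ → ℝ≥0∞) , ∫⁻ t, c t * g t =
      ∫⁻ t in Ioi (0 : ℝ), c t * ENNReal.ofReal (φ t) := by
    intro c
    rw [← lintegral_indicator measurableSet_Ioi]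
    refine lintegral_congr_ae ?_
    filter_upwards [hgφ] with t ht
    rcases le_or_gt t 0 with h0 | h0
    · simp [hg0 t h0, not_lt.2 h0]
    · simp [h0, ht h0]
  have hmass : ∫⁻ t, g t = 1 := by
    have h1 := hwhole 1
    simp only [Pi.one_apply, one_mul] at h1
    rw [h1, ← ofReal_integral_eq_lintegral_ofReal (hφ.integrable.mono_set Ioi_subset_Ici_self),
      hφ.mass_eq_one, ENNReal.ofReal_one]
    filter_upwards [ae_restrict_mem measurableSet_Ioi] with t ht
    exact hφ.nonneg t (le_of_lt ht)
  have heq := (ae_restrict_iff' measurableSet_Ici).1 hR.equation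
  -- The sign of `R` is not assumed. As `φ ≥ 0`, the negative part of `R` is a subsolution of the
  -- homogeneous equation, hence zero.
  have hvle : v ≤ᵐ[volume] g ⋆ₗ v := by
    filter_upwards [heq, hvR] with t ht htv
    rcases le_or_gt t 0 with h0 | h0
    · rw [hv0 t h0]
      exact zero_le
    · rw [htv h0, ← lintegral_volterra_eq hφ.nonneg hg0 hv0 hgφ hvR t]
      refine le_trans (ENNReal.ofReal_le_ofReal ?_) (ofReal_integral_le_lintegral_ofReal _)
      rw [ht h0.le, intervalIntegral.integral_of_le h0.le]
      simp only [neg_mul]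
      rw [integral_neg]
      linarith [hφ.nonneg t h0.le]
  have hvzero := ae_eq_zero_of_le_lconvolution hgm hvm hg0 hv0 hmass hvfin hvle
  have hRnn : ∀ᵐ t, 0 < t → 0 ≤ R t := by
    filter_upwards [hvzero, hvR] with t ht htv h0
    rw [htv h0, Pi.zero_apply, ENNReal.ofReal_eq_zero] at ht
    linarith
  -- Finiteness is needed to read the real Volterra integral as `g ⋆ₗ u` in `[0, ∞]`. It follows on
  -- each `(-∞, n]` by truncating `u`.
  have hconvfin : ∀ᵐ t, (g ⋆ₗ u) t < ∞ := by
    have h1 : ∀ n : ℕ, ∀ᵐ t, t ≤ (n : ℝ) → (g ⋆ₗ u) t < ∞ := by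
      intro n
      have hm : Measurable ((Iic (n : ℝ)).indicator u) := hum.indicator measurableSet_Iic
      have h2 : ∫⁻ t, (g ⋆ₗ (Iic (n : ℝ)).indicator u) t ≠ ∞ := by
        rw [lintegral_lconvolution_eq_mul hgm hm, hmass, one_mul,
          lintegral_indicator measurableSet_Iic]
        exact hufin n
      filter_upwards [ae_lt_top (measurable_lconvolution _ hgm hm) h2] with t ht htn
      rwa [lconvolution_truncate hg0 htn]
    filter_upwards [ae_all_iff.2 h1] with t ht
    obtain ⟨n, hn⟩ := exists_nat_ge t
    exact ht n hn
  have hueq : u =ᵐ[volume] g + g ⋆ₗ u := by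
    filter_upwards [heq, huR, hgφ, hconvfin] with t ht htu htg htfin
    rcases le_or_gt t 0 with h0 | h0
    · rw [hu0 t h0, Pi.add_apply, hg0 t h0, zero_add, lconvolution_def]
      symm
      refine (lintegral_congr fun y => ?_).trans lintegral_zero
      rcases le_or_gt y 0 with hy | hy
      · simp [hg0 y hy]
      · simp [hu0 (-y + t) (by linarith)]
    · have hconv := lintegral_volterra_eq hφ.nonneg hg0 hu0 hgφ huR t
      have hR' : ∀ᵐ s : ℝ, 0 < t - s → 0 ≤ R (t - s) :=
        (quasiMeasurePreserving_sub_left_of_right_invariant volume t).ae hRnn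
      have hR'' : ∀ᵐ s : ℝ, 0 < t - s → R (t - s) = hmR.mk R (t - s) :=
        (quasiMeasurePreserving_sub_left_of_right_invariant volume t).ae hRmk
      have hne : ∀ᵐ s : ℝ, s ≠ t := by simp [ae_iff]
      have hint : ∫ s in Ioc 0 t, R (t - s) * φ s = ((g ⋆ₗ u) t).toReal := by
        rw [← hconv]
        refine integral_eq_lintegral_of_nonneg_ae ?_ ?_
        · refine (ae_restrict_iff' measurableSet_Ioc).2 ?_
          filter_upwards [hR', hne] with s hs hst hmem
          exact mul_nonneg (hs (sub_pos.2 (lt_of_le_of_ne hmem.2 hst))) (hφ.nonneg s hmem.1.le)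
        · refine AEStronglyMeasurable.congr (f := fun s => hmR.mk R (t - s) * hmφ.mk φ s) ?_ ?_
          · exact ((hmkR.comp (by fun_prop)).mul hmkφ).aestronglyMeasurable
          · refine (ae_restrict_iff' measurableSet_Ioc).2 ?_
            filter_upwards [hR'', hne, (ae_restrict_iff' measurableSet_Ioi).1 hmφ.ae_eq_mk]
              with s hs hst hsφ hmem
            rw [← hs (sub_pos.2 (lt_of_le_of_ne hmem.2 hst)), ← hsφ hmem.1]
      rw [htu h0, ht h0.le, intervalIntegral.integral_of_le h0.le, hint, Pi.add_apply, htg h0,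
        ENNReal.ofReal_add (hφ.nonneg t h0.le) ENNReal.toReal_nonneg,
        ENNReal.ofReal_toReal htfin.ne]
  refine ⟨g, u, ⟨hgm, hum, hg0, hu0, hmass, ?_, hufin, hueq⟩, hgφ, ?_, fun M hM t => ?_⟩
  · rw [lintegral_tailInt hgm, hwhole]
    have h1 := hφ.dispersion_lt_top
    refine ne_of_eq_of_ne (setLIntegral_congr_fun measurableSet_Ioi fun s hs => ?_) h1.ne
    rw [pow_one, ENNReal.ofReal_mul (le_of_lt hs)]
  · filter_upwards [hRnn, huR] with t h1 h2 h0
    rw [h2 h0, ENNReal.toReal_ofReal (h1 h0)]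
  · rw [hg]
    refine indicator_apply_le' (fun _ => (min_le_right _ _).trans ?_) fun _ => zero_le
    exact iSup₂_le fun s hs => ENNReal.ofReal_le_ofReal (hM s hs)

theorem lintegral_pow_mul_eq_psiInfty {φ : ℝ → ℝ} {g : ℝ → ℝ≥0∞}
    (hg0 : ∀ t, t ≤ 0 → g t = 0) (hg : ∀ᵐ t, 0 < t → g t = ENNReal.ofReal (φ t)) (k : ℕ) :
    ∫⁻ t, ENNReal.ofReal t ^ k * g t = psiInfty φ k := by
  rw [psiInfty, ← lintegral_indicator measurableSet_Ioi]
  refine lintegral_congr_ae ?_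
  filter_upwards [hg] with t ht
  rcases le_or_gt t 0 with h0 | h0
  · simp [hg0 t h0, not_lt.2 h0]
  · rw [indicator_of_mem (mem_Ioi.2 h0), ht h0, ENNReal.ofReal_mul (by positivity),
      ENNReal.ofReal_pow h0.le]

theorem tailInt_eq_ofReal_tailPhi {φ : ℝ → ℝ} {g : ℝ → ℝ≥0∞} (hφ : WeaklyCriticalKernel φ)
    (hg : ∀ᵐ t, 0 < t → g t = ENNReal.ofReal (φ t)) {t : ℝ} (ht : 0 ≤ t) :
    tailInt g t = ENNReal.ofReal (tailPhi φ t) := by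
  have hsub : Ioi t ⊆ Ici 0 := fun s hs => ht.trans (le_of_lt hs)
  rw [tailInt_of_nonneg g ht, tailPhi,
    ofReal_integral_eq_lintegral_ofReal (hφ.integrable.mono_set hsub)]
  · refine lintegral_congr_ae ((ae_restrict_iff' measurableSet_Ioi).2 ?_)
    filter_upwards [hg] with s hs hst
    exact hs (lt_of_le_of_lt ht hst)
  · filter_upwards [ae_restrict_mem measurableSet_Ioi] with s hs
    exact hφ.nonneg s (hsub hs)

/-! ### Errors of the rescaled resolvent in terms of the integrated tail. -/

/-- The data relating a kernel and its resolvent to a renewal pair. -/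
structure IsRenewalModel (φ R : ℝ → ℝ) (g u : ℝ → ℝ≥0∞) : Prop where
  pair : RenewalPair g u
  kernel : ∀ᵐ t, 0 < t → g t = ENNReal.ofReal (φ t)
  resolvent : ∀ᵐ t, 0 < t → R t = (u t).toReal
  dispersion_eq : dispersion φ = (∫⁻ t, tailInt g t).toReal

namespace IsRenewalModel

variable {φ R : ℝ → ℝ} {g u : ℝ → ℝ≥0∞}

theorem dispersion_pos (h : IsRenewalModel φ R g u) : 0 < dispersion φ := by
  rw [h.dispersion_eq]
  exact ENNReal.toReal_pos h.pair.mean_ne_zero h.pair.mean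

theorem integral_resolvent (h : IsRenewalModel φ R g u) {x : ℝ} (hx : 0 ≤ x) :
    ∫ s in (0 : ℝ)..x, R s = (∫⁻ t in Iic x, u t).toReal := by
  have hum := h.pair.meas_u
  have h1 : ∫⁻ t in Iic x, u t = ∫⁻ t in Ioc 0 x, u t := by
    rw [← lintegral_indicator measurableSet_Iic, ← lintegral_indicator measurableSet_Ioc]
    refine lintegral_congr fun t => ?_
    rcases le_or_gt t 0 with h0 | h0
    · simp [h.pair.u_zero t h0, not_lt.2 h0]
    · simp [indicator_apply, h0]
  have h2 : ∫⁻ t in Ioc 0 x, u t ≠ ∞ := h1 ▸ h.pair.finite x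
  rw [intervalIntegral.integral_of_le hx, h1, ← integral_toReal hum.aemeasurable
    (ae_lt_top hum h2)]
  refine setIntegral_congr_ae measurableSet_Ioc ?_
  filter_upwards [h.resolvent] with t ht hmem
  exact ht hmem.1

theorem exists_integral_bound (h : IsRenewalModel φ R g u) :
    ∃ K : ℝ, 0 < K ∧ ∀ x : ℝ, 0 ≤ x →
      ENNReal.ofReal |(∫ s in (0 : ℝ)..x, R s) - x / dispersion φ| ≤
        ENNReal.ofReal K * (1 + ∫⁻ t in Iic x, tailInt (tailInt g) t) := by
  obtain ⟨K, hK, hb⟩ := h.pair.bounds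
  have hσ := h.dispersion_pos
  -- The error is at least `-1` by the lower renewal bound, and at most `K/σ` times the bracket by
  -- the upper one.
  refine ⟨1 + K.toReal / dispersion φ, by positivity, fun x hx => ?_⟩
  obtain ⟨b1, b2⟩ := hb x hx
  have hH := h.pair.finite x
  have hS := h.pair.mean
  rw [h.integral_resolvent hx]
  by_cases hJ : ∫⁻ t in Iic x, tailInt (tailInt g) t = ∞
  · rw [hJ, add_top, ENNReal.mul_top]
    · exact le_top
    · simp only [ne_eq, ENNReal.ofReal_eq_zero, not_le]
      positivity
  set H := ∫⁻ t in Iic x, u t with hHdef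
  set S := ∫⁻ t, tailInt g t with hSdef
  set J := ∫⁻ t in Iic x, tailInt (tailInt g) t with hJdef
  have hJ1 : 1 + J ≠ ∞ := ENNReal.add_ne_top.2 ⟨ENNReal.one_ne_top, hJ⟩
  have r1 : x ≤ dispersion φ + dispersion φ * H.toReal := by
    have := ENNReal.toReal_mono (ENNReal.add_ne_top.2 ⟨hS, ENNReal.mul_ne_top hS hH⟩) b1
    rwa [ENNReal.toReal_ofReal hx, ENNReal.toReal_add hS (ENNReal.mul_ne_top hS hH),
      ENNReal.toReal_mul, ← h.dispersion_eq] at this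
  have r2 : dispersion φ * H.toReal ≤ x + K.toReal * (1 + J).toReal := by
    have := ENNReal.toReal_mono (ENNReal.add_ne_top.2 ⟨ENNReal.ofReal_ne_top,
      ENNReal.mul_ne_top hK hJ1⟩) b2
    rwa [ENNReal.toReal_add ENNReal.ofReal_ne_top (ENNReal.mul_ne_top hK hJ1), ENNReal.toReal_mul,
      ENNReal.toReal_mul, ENNReal.toReal_ofReal hx, ← h.dispersion_eq] at this
  have hJge : 1 ≤ (1 + J).toReal := by
    rw [ENNReal.toReal_add ENNReal.one_ne_top hJ, ENNReal.toReal_one]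
    linarith [ENNReal.toReal_nonneg (a := J)]
  rw [← ENNReal.ofReal_toReal hJ1, ← ENNReal.ofReal_mul (by positivity)]
  refine ENNReal.ofReal_le_ofReal ?_
  set Y := (1 + J).toReal
  set Kr := K.toReal
  have hKr : 0 ≤ Kr := ENNReal.toReal_nonneg
  have hdiv : dispersion φ * (x / dispersion φ) = x := mul_div_cancel₀ x hσ.ne'
  have hdivK : dispersion φ * (Kr / dispersion φ) = Kr := mul_div_cancel₀ Kr hσ.ne'
  have hq : 0 ≤ Kr / dispersion φ := by positivity
  rw [abs_le]
  constructor
  · have h1 : x / dispersion φ ≤ 1 + H.toReal := by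
      rw [div_le_iff₀ hσ]
      linarith
    nlinarith
  · have h1 : H.toReal ≤ x / dispersion φ + Kr / dispersion φ * Y := by
      rw [← mul_le_mul_iff_right₀ hσ, mul_add, hdiv, ← mul_assoc, hdivK]
      exact r2
    nlinarith

/-- For `t ≤ N * T` the weight `e^{-t/N}` is at least `e^{-T}`, so truncated integrals reduce to the
weighted integrals used for the `L²` bound. -/
theorem lintegral_Iic_le_exp_mul (f : ℝ → ℝ≥0∞) (hf : Measurable f) {T N : ℝ} (hN : 0 < N) :
    ∫⁻ t in Iic (N * T), f t ≤ ENNReal.ofReal (Real.exp T) * ∫⁻ t, expWeight (1 / N) t * f t := by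
  rw [← lintegral_const_mul _ (by fun_prop)]
  refine (setLIntegral_mono (by fun_prop) fun t ht => ?_).trans (setLIntegral_le_lintegral _ _)
  rw [← mul_assoc]
  refine le_mul_of_one_le_left (zero_le) ?_
  rw [expWeight, ← ENNReal.ofReal_mul (Real.exp_pos _).le, ← Real.exp_add,
    ENNReal.one_le_ofReal, Real.one_le_exp_iff]
  have : 1 / N * t ≤ T := by
    rw [one_div, inv_mul_le_iff₀ hN]
    exact ht
  linarith

theorem integralFn_sub_eq {n : ℕ} (hn : 1 ≤ n) (t : ℝ) :
    (integralFn (rescaled R n) - integralFn (limitResolvent φ)) t =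
      ((n : ℝ))⁻¹ * ((∫ s in (0 : ℝ)..n * t, R s) - n * t / dispersion φ) := by
  have hn0 : (n : ℝ) ≠ 0 := by positivity
  simp only [Pi.sub_apply, integralFn, rescaled, limitResolvent]
  rw [intervalIntegral.integral_comp_mul_left (fun x => R x) hn0, mul_zero,
    intervalIntegral.integral_const]
  simp only [smul_eq_mul]
  field_simp
  ring

/-- Error of the integrated rescaled resolvent, in terms of the integrated tail. -/
theorem exists_normLp_integral_le (h : IsRenewalModel φ R g u) (p : ℝ≥0∞) (T : ℝ) :
    ∃ K : ℝ, 0 < K ∧ ∀ n : ℕ, 1 ≤ n → ∀ d : ℝ, 0 ≤ d →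
      1 + ∫⁻ t, expWeight (1 / n) t * tailInt (tailInt g) t ^ 1 ≤ ENNReal.ofReal (n * d) →
      normLp p T (integralFn (rescaled R n) - integralFn (limitResolvent φ)) ≤
        ENNReal.ofReal (K * d) := by
  obtain ⟨K, hK, hb⟩ := h.exists_integral_bound
  have hG := measurable_tailInt (tailInt g)
  have hFt : (volume.restrict (Icc 0 T)) univ ^ p.toReal⁻¹ ≠ ∞ :=
    ENNReal.rpow_ne_top_of_nonneg (by positivity) (by simp)
  set F := (volume.restrict (Icc 0 T)) univ ^ p.toReal⁻¹ with hF
  -- `F` is the price of passing from a uniform bound on `[0, T]` to the `L^p` norm; `1 + exp T`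
  -- bounds the constant and the integral of the tail separately.
  refine ⟨(F.toReal + 1) * (K * (1 + Real.exp T)), by positivity, fun n hn d hd hle => ?_⟩
  have hn0 : (0 : ℝ) < n := by positivity
  simp only [pow_one] at hle
  have hbound : ∀ t ∈ Icc 0 T,
      ‖(integralFn (rescaled R n) - integralFn (limitResolvent φ)) t‖ ≤
        K * (1 + Real.exp T) * d := by
    intro t ht
    rw [integralFn_sub_eq hn, norm_mul, Real.norm_eq_abs, Real.norm_eq_abs,
      abs_of_pos (inv_pos.2 hn0), inv_mul_le_iff₀ hn0]
    have h1 := hb (n * t) (mul_nonneg hn0.le ht.1)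
    have h2 : 1 + ∫⁻ s in Iic (n * t), tailInt (tailInt g) s ≤
        ENNReal.ofReal ((1 + Real.exp T) * (n * d)) := by
      have h3 : ∫⁻ s in Iic ((n : ℝ) * t), tailInt (tailInt g) s ≤
          ∫⁻ s in Iic (n * T), tailInt (tailInt g) s :=
        lintegral_mono_set (Iic_subset_Iic.2 (mul_le_mul_of_nonneg_left ht.2 hn0.le))
      have h4 := lintegral_Iic_le_exp_mul (T := T) _ hG hn0
      have h5 : (1 : ℝ≥0∞) ≤ ENNReal.ofReal (n * d) := le_self_add.trans hle
      have h6 : ∫⁻ t, expWeight (1 / n) t * tailInt (tailInt g) t ≤ ENNReal.ofReal (n * d) :=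
        le_add_self.trans hle
      rw [ENNReal.ofReal_mul (by positivity), ENNReal.ofReal_add zero_le_one (Real.exp_pos _).le,
        ENNReal.ofReal_one, add_mul, one_mul]
      exact add_le_add h5 ((h3.trans h4).trans (mul_le_mul_right h6 _))
    have h3 := h1.trans (mul_le_mul_right h2 _)
    rw [← ENNReal.ofReal_mul hK.le, ENNReal.ofReal_le_ofReal_iff (by positivity)] at h3
    refine h3.trans (le_of_eq ?_)
    ring
  have h1 := eLpNorm_le_of_ae_bound (p := p) (μ := volume.restrict (Icc 0 T))
    ((ae_restrict_iff' measurableSet_Icc).2 (Eventually.of_forall hbound))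
  refine h1.trans ?_
  rw [← hF, ← ENNReal.ofReal_toReal hFt, ← ENNReal.ofReal_mul ENNReal.toReal_nonneg]
  refine ENNReal.ofReal_le_ofReal ?_
  rw [ENNReal.toReal_ofReal ENNReal.toReal_nonneg, mul_assoc (F.toReal + 1)]
  exact mul_le_mul_of_nonneg_right (le_add_of_nonneg_right zero_le_one) (by positivity)

theorem lintegral_comp_mul_left_Icc (f : ℝ → ℝ≥0∞) {c T : ℝ} (hc : 0 < c) :
    ∫⁻ t in Icc 0 T, f (c * t) = ENNReal.ofReal c⁻¹ * ∫⁻ s in Icc 0 (c * T), f s := by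
  have he : MeasurableEmbedding (c * · : ℝ → ℝ) := measurableEmbedding_mulLeft₀ hc.ne'
  have hmap := Real.map_volume_mul_left hc.ne'
  rw [abs_of_pos (inv_pos.2 hc)] at hmap
  rw [← smul_eq_mul, ← lintegral_smul_measure, ← Measure.restrict_smul, ← hmap,
    he.restrict_map, he.lintegral_map]
  congr 2
  ext t
  simp only [mem_preimage, mem_Icc]
  rw [mul_nonneg_iff_of_pos_left hc, mul_le_mul_iff_right₀ hc]

/-- Error of the rescaled resolvent in `L²`, in terms of the integrated tail. -/
theorem exists_normLp_two_le (h : IsRenewalModel φ R g u) {M : ℝ≥0∞} (hMt : M ≠ ∞)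
    (hM : ∀ t, g t ≤ M) (T : ℝ) :
    ∃ K : ℝ, 0 < K ∧ ∀ n : ℕ, 1 ≤ n → ∀ d : ℝ, 0 ≤ d →
      1 + ∫⁻ t, expWeight (1 / n) t * tailInt (tailInt g) t ^ 2 ≤ ENNReal.ofReal (n * d ^ 2) →
      normLp 2 T (rescaled R n - limitResolvent φ) ≤ ENNReal.ofReal (K * d) := by
  obtain ⟨C, hC, hb⟩ := h.pair.exists_l2_bound hMt hM
  have hG := measurable_tailInt (tailInt g)
  -- With `ε = 1/n`, the factor `e^{2T}` undoes the squared weight on `[0, nT]`; the summand `1`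
  -- only secures positivity.
  refine ⟨Real.sqrt (Real.exp (2 * T) * C.toReal) + 1, by positivity, fun n hn d hd hle => ?_⟩
  have hn0 : (0 : ℝ) < n := by positivity
  have hn1 : (1 : ℝ) ≤ n := by exact_mod_cast hn
  have hε : 0 < 1 / (n : ℝ) := by positivity
  have hl2 := hb (1 / n) hε ((div_le_one hn0).2 hn1)
  rw [← h.dispersion_eq] at hl2
  have hmono : ∫⁻ t, ‖damped (1 / n) (tailInt (tailInt g)) t‖ₑ ^ 2 ≤
      ∫⁻ t, expWeight (1 / n) t * tailInt (tailInt g) t ^ 2 := by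
    refine lintegral_mono fun t => ?_
    rcases lt_or_ge t 0 with ht | ht
    · simp [damped, tailInt_of_neg _ ht]
    · refine (pow_le_pow_left' (enorm_damped_le _ _ t) 2).trans ?_
      rw [mul_pow, sq (expWeight _ _)]
      exact mul_le_mul_left (mul_le_of_le_one_left (zero_le) (expWeight_le_one hε.le ht)) _
  have hl2' := hl2.trans (mul_le_mul_right ((add_le_add_right hmono 1).trans hle) C)
  have hpt : ∫⁻ s in Icc 0 (n * T), ‖R s - 1 / dispersion φ‖ₑ ^ 2 ≤
      ENNReal.ofReal (Real.exp (2 * T)) * ∫⁻ t, ‖damped (1 / n) u t -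
        ((1 / dispersion φ : ℝ) : ℂ) * damped (1 / n) heaviside t‖ₑ ^ 2 := by
    rw [← lintegral_const_mul' _ _ ENNReal.ofReal_ne_top]
    refine le_trans ?_ (setLIntegral_le_lintegral (Icc 0 (n * T)) _)
    refine lintegral_mono_ae ((ae_restrict_iff' measurableSet_Icc).2 ?_)
    have hne : ∀ᵐ s : ℝ, s ≠ 0 := by simp [ae_iff]
    filter_upwards [h.resolvent, hne] with s hs hs0 hmem
    have hspos : 0 < s := lt_of_le_of_ne hmem.1 (Ne.symm hs0)
    have he : damped (1 / n) u s - ((1 / dispersion φ : ℝ) : ℂ) * damped (1 / n) heaviside s =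
        ((Real.exp (-(1 / n * s)) * (R s - 1 / dispersion φ) : ℝ) : ℂ) := by
      rw [damped, damped, heaviside_of_nonneg hmem.1, hs hspos, ENNReal.toReal_one]
      push_cast
      ring
    rw [he, ← ofReal_norm (((_ : ℝ) : ℂ)), Complex.norm_real, ofReal_norm, enorm_mul, mul_pow,
      ← mul_assoc]
    refine le_mul_of_one_le_left (zero_le) ?_
    rw [Real.enorm_of_nonneg (Real.exp_pos _).le, ← ENNReal.ofReal_pow (Real.exp_pos _).le,
      ← ENNReal.ofReal_mul (Real.exp_pos _).le, ← Real.exp_nat_mul, ← Real.exp_add,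
      ENNReal.one_le_ofReal, Real.one_le_exp_iff]
    have : 1 / (n : ℝ) * s ≤ T := by
      rw [one_div, inv_mul_le_iff₀ hn0]
      exact hmem.2
    push_cast
    linarith
  have hsq : normLp 2 T (rescaled R n - limitResolvent φ) ^ 2 =
      ∫⁻ t in Icc 0 T, ‖R (n * t) - 1 / dispersion φ‖ₑ ^ 2 := by
    rw [normLp, eLpNorm_eq_lintegral_rpow_enorm_toReal (by norm_num) (by norm_num),
      ← ENNReal.rpow_natCast, ← ENNReal.rpow_mul]
    simp [rescaled, limitResolvent]
  rw [← ENNReal.pow_le_pow_left_iff two_ne_zero, hsq,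
    lintegral_comp_mul_left_Icc (fun s => ‖R s - 1 / dispersion φ‖ₑ ^ 2) hn0]
  calc ENNReal.ofReal (n : ℝ)⁻¹ * ∫⁻ s in Icc 0 (n * T), ‖R s - 1 / dispersion φ‖ₑ ^ 2
      ≤ ENNReal.ofReal (n : ℝ)⁻¹ * (ENNReal.ofReal (Real.exp (2 * T)) *
          (C * ENNReal.ofReal (n * d ^ 2))) := by
        gcongr
        exact hpt.trans (mul_le_mul_right hl2' _)
    _ = ENNReal.ofReal ((Real.exp (2 * T) * C.toReal) * d ^ 2) := by
        rw [← ENNReal.ofReal_toReal hC, ← ENNReal.ofReal_mul ENNReal.toReal_nonneg,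
          ← ENNReal.ofReal_mul (Real.exp_pos _).le, ← ENNReal.ofReal_mul (by positivity),
          ENNReal.toReal_ofReal ENNReal.toReal_nonneg]
        congr 1
        field_simp
    _ ≤ ENNReal.ofReal ((Real.sqrt (Real.exp (2 * T) * C.toReal) + 1) * d) ^ 2 := by
        rw [← ENNReal.ofReal_pow (by positivity), mul_pow]
        refine ENNReal.ofReal_le_ofReal (mul_le_mul_of_nonneg_right ?_ (by positivity))
        have h0 : 0 ≤ Real.exp (2 * T) * C.toReal := by positivity
        nlinarith [Real.sq_sqrt h0, Real.sqrt_nonneg (Real.exp (2 * T) * C.toReal)]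

end IsRenewalModel

/-! ### Rates under a second moment or regular variation. -/

theorem IsRegularlyVarying.index_unique {f : ℝ → ℝ} {ρ ρ' : ℝ} (h : IsRegularlyVarying f ρ)
    (h' : IsRegularlyVarying f ρ') : ρ = ρ' :=
  (Real.rpow_right_inj zero_lt_two (by norm_num)).1
    (tendsto_nhds_unique (h.2 2 zero_lt_two) (h'.2 2 zero_lt_two))

theorem WeaklyCriticalKernel.tailPhi_nonneg {φ : ℝ → ℝ} (hφ : WeaklyCriticalKernel φ) {t : ℝ}
    (ht : 0 ≤ t) : 0 ≤ tailPhi φ t :=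
  setIntegral_nonneg measurableSet_Ioi fun s hs => hφ.nonneg s (ht.trans (le_of_lt hs))

theorem WeaklyCriticalKernel.tailPhi_antitoneOn {φ : ℝ → ℝ} (hφ : WeaklyCriticalKernel φ) :
    AntitoneOn (tailPhi φ) (Ici 0) := by
  intro s hs t ht hst
  have hsub : Ioi s ⊆ Ici 0 := fun r hr => (mem_Ici.1 hs).trans (le_of_lt hr)
  refine setIntegral_mono_set (hφ.integrable.mono_set hsub) ?_ (Ioi_subset_Ioi hst).eventuallyLE
  filter_upwards [ae_restrict_mem measurableSet_Ioi] with r hr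
  exact hφ.nonneg r (hsub hr)

theorem WeaklyCriticalKernel.tailPhi_pos {φ : ℝ → ℝ} (hφ : WeaklyCriticalKernel φ) {ρ : ℝ}
    (h : IsRegularlyVarying (tailPhi φ) ρ) (t : ℝ) (ht : 0 ≤ t) : 0 < tailPhi φ t := by
  have hpos : ∀ᶠ s in atTop, 0 < tailPhi φ s := by
    rcases h.1 with h1 | h1
    · exact h1
    · obtain ⟨s, hs, hs0⟩ := (h1.and (eventually_ge_atTop 0)).exists
      exact absurd (hφ.tailPhi_nonneg hs0) (not_le.2 hs)
  obtain ⟨s, hs, hst⟩ := (hpos.and (eventually_ge_atTop t)).exists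
  exact hs.trans_le (hφ.tailPhi_antitoneOn (mem_Ici.2 ht) (mem_Ici.2 (ht.trans hst)) hst)

theorem exists_isRenewalModel {φ R : ℝ → ℝ} (hφ : WeaklyCriticalKernel φ) (hR : IsResolvent φ R) :
    ∃ g u : ℝ → ℝ≥0∞, IsRenewalModel φ R g u ∧
      ∀ M : ℝ, (∀ t, 0 ≤ t → φ t ≤ M) → ∀ t, g t ≤ ENNReal.ofReal M := by
  obtain ⟨g, u, hp, hg, hu, hM⟩ := exists_renewalPair hφ hR
  refine ⟨g, u, ⟨hp, hg, hu, ?_⟩, hM⟩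
  rw [dispersion, lintegral_tailInt hp.meas_g, ← lintegral_pow_mul_eq_psiInfty hp.g_zero hg 1]
  simp only [pow_one]

namespace IsRenewalModel

variable {φ R : ℝ → ℝ} {g u : ℝ → ℝ≥0∞}

/-- The integrated tail is at most `σ`, and its integral is at most the second moment; so all its
positive powers are integrable, uniformly in the damping. -/
theorem exists_moment_bound (h : IsRenewalModel φ R g u) (hΨ : psiInfty φ 2 < ∞) {p : ℕ}
    (hp : p ≠ 0) : ∃ C : ℝ, 0 < C ∧ ∀ N : ℝ, 1 ≤ N →
      1 + ∫⁻ t, expWeight (1 / N) t * tailInt (tailInt g) t ^ p ≤ ENNReal.ofReal C := by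
  have hG := measurable_tailInt (tailInt g)
  have hfin : ∫⁻ t, tailInt (tailInt g) t ≠ ∞ := by
    refine ne_top_of_le_ne_top hΨ.ne ?_
    rw [← lintegral_pow_mul_eq_psiInfty h.pair.g_zero h.kernel 2]
    exact lintegral_tailInt_tailInt_le h.pair.meas_g
  set S := ∫⁻ t, tailInt g t with hS
  have hB : 1 + S ^ (p - 1) * ∫⁻ t, tailInt (tailInt g) t ≠ ∞ :=
    ENNReal.add_ne_top.2 ⟨ENNReal.one_ne_top,
      ENNReal.mul_ne_top (ENNReal.pow_ne_top h.pair.mean) hfin⟩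
  refine ⟨(1 + S ^ (p - 1) * ∫⁻ t, tailInt (tailInt g) t).toReal,
    ENNReal.toReal_pos (by simp) hB, fun N hN => ?_⟩
  rw [ENNReal.ofReal_toReal hB, ← lintegral_const_mul _ hG]
  refine add_le_add le_rfl (lintegral_mono fun t => ?_)
  rcases lt_or_ge t 0 with ht | ht
  · simp [tailInt_of_neg _ ht, hp]
  · refine (mul_le_of_le_one_left (zero_le) (expWeight_le_one (by positivity) ht)).trans ?_
    obtain ⟨q, rfl⟩ := Nat.exists_eq_succ_of_ne_zero hp
    rw [Nat.succ_eq_add_one, pow_succ, Nat.add_sub_cancel]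
    exact mul_le_mul_left (pow_le_pow_left' (tailInt_le _ _) _) _

theorem exists_regularly_varying_bound (h : IsRenewalModel φ R g u) (hφ : WeaklyCriticalKernel φ)
    {α δ : ℝ} (hrv : IsRegularlyVarying (tailPhi φ) (-α - 1)) (hδ : 0 < δ) (hδα : δ < α) {p : ℕ}
    (hp : p ≠ 0) (he : p * (α + δ) ≠ 1) : ∃ C : ℝ, 0 < C ∧ ∀ N : ℝ, 1 ≤ N →
      1 + ∫⁻ t, expWeight (1 / N) t * tailInt (tailInt g) t ^ p ≤
        ENNReal.ofReal
          (C * ((N ^ (α + 1 + δ) * tailPhi φ N) ^ p * N ^ (max (1 - p * (α + δ)) 0))) :=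
  exists_lintegral_tail_pow_le hφ.tailPhi_antitoneOn (hφ.tailPhi_pos hrv) (hrv.2 2 zero_lt_two)
    hδ hδα (fun _ ht => tailInt_eq_ofReal_tailPhi hφ h.kernel ht) h.pair.mean hp he

/-- Markov's inequality: the decreasing tail satisfies `t Φ(t) ≤ ∫_0^t Φ ≤ σ`. -/
theorem mul_tailPhi_le (h : IsRenewalModel φ R g u) (hφ : WeaklyCriticalKernel φ) {t : ℝ}
    (ht : 0 ≤ t) : t * tailPhi φ t ≤ dispersion φ := by
  rw [h.dispersion_eq, ← ENNReal.ofReal_le_iff_le_toReal h.pair.mean, ENNReal.ofReal_mul ht,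
    ← tailInt_eq_ofReal_tailPhi hφ h.kernel ht]
  calc ENNReal.ofReal t * tailInt g t = ∫⁻ _ in Icc 0 t, tailInt g t := by simp [mul_comm]
    _ ≤ ∫⁻ s in Icc 0 t, tailInt g s :=
        setLIntegral_mono (measurable_tailInt g) fun s hs => tailInt_anti g hs.1 hs.2
    _ ≤ _ := setLIntegral_le_lintegral _ _

theorem normLp_integral_of_moment (h : IsRenewalModel φ R g u) (hΨ : psiInfty φ 2 < ∞) (p : ℝ≥0∞)
    (T : ℝ) : ∃ C : ℝ, 0 < C ∧ ∀ n : ℕ, 1 ≤ n →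
      normLp p T (integralFn (rescaled R n) - integralFn (limitResolvent φ)) ≤
        ENNReal.ofReal (C * (n : ℝ)⁻¹) := by
  obtain ⟨K, hK, hb⟩ := h.exists_normLp_integral_le p T
  obtain ⟨C, hC, hc⟩ := h.exists_moment_bound hΨ one_ne_zero
  refine ⟨K * C, by positivity, fun n hn => ?_⟩
  have hn0 : (n : ℝ) ≠ 0 := by positivity
  rw [mul_assoc]
  refine hb n hn _ (by positivity) ((hc n (by exact_mod_cast hn)).trans_eq ?_)
  congr 1
  field_simp

theorem normLp_two_of_moment (h : IsRenewalModel φ R g u) (hΨ : psiInfty φ 2 < ∞) {M : ℝ≥0∞}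
    (hMt : M ≠ ∞) (hM : ∀ t, g t ≤ M) (T : ℝ) : ∃ C : ℝ, 0 < C ∧ ∀ n : ℕ, 1 ≤ n →
      normLp 2 T (rescaled R n - limitResolvent φ) ≤
        ENNReal.ofReal (C * (n : ℝ) ^ (-(1 / 2) : ℝ)) := by
  obtain ⟨K, hK, hb⟩ := h.exists_normLp_two_le hMt hM T
  obtain ⟨C, hC, hc⟩ := h.exists_moment_bound hΨ two_ne_zero
  refine ⟨K * √C, by positivity, fun n hn => ?_⟩
  have hn0 : (0 : ℝ) < n := by positivity
  rw [mul_assoc]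
  refine hb n hn _ (by positivity) ((hc n (by exact_mod_cast hn)).trans_eq ?_)
  rw [mul_pow, Real.sq_sqrt hC.le, ← Real.rpow_mul_natCast hn0.le,
    show (-(1 / 2) * ((2 : ℕ) : ℝ) : ℝ) = -1 by norm_num, Real.rpow_neg_one]
  congr 1
  field_simp

theorem normLp_integral_of_regularlyVarying (h : IsRenewalModel φ R g u)
    (hφ : WeaklyCriticalKernel φ) {α : ℝ} (hα : 0 < α) (hα1 : α < 1)
    (hrv : IsRegularlyVarying (tailPhi φ) (-α - 1)) (p : ℝ≥0∞)
    (T : ℝ) : ∃ C : ℝ, 0 < C ∧ ∀ n : ℕ, 1 ≤ n →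
      normLp p T (integralFn (rescaled R n) - integralFn (limitResolvent φ)) ≤
        ENNReal.ofReal (C * (n * tailPhi φ n)) := by
  -- With `α + δ < 1` the weighted integral grows like a positive power of `n`, and `δ` cancels:
  -- `n^{α+1+δ} n^{1-(α+δ)} = n²`.
  obtain ⟨δ, hδ, hδ2⟩ : ∃ δ : ℝ, 0 < δ ∧ δ < min α (1 - α) := exists_between
    (lt_min hα (by linarith))
  obtain ⟨hδα, hδ1⟩ := lt_min_iff.1 hδ2
  obtain ⟨K, hK, hb⟩ := h.exists_normLp_integral_le p T
  obtain ⟨C, hC, hc⟩ := h.exists_regularly_varying_bound hφ hrv hδ hδα one_ne_zero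
    (by push_cast; linarith)
  refine ⟨K * C, by positivity, fun n hn => ?_⟩
  have hn0 : (0 : ℝ) < n := by positivity
  have hΦ := hφ.tailPhi_nonneg hn0.le
  rw [mul_assoc]
  refine hb n hn _ (by positivity) ((hc n (by exact_mod_cast hn)).trans_eq ?_)
  rw [Nat.cast_one, one_mul, max_eq_left (by linarith), pow_one]
  congr 1
  have : (n : ℝ) ^ (α + 1 + δ) * (n : ℝ) ^ (1 - (α + δ)) = n * n := by
    rw [← Real.rpow_add hn0, show α + 1 + δ + (1 - (α + δ)) = ((2 : ℕ) : ℝ) by push_cast; ring,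
      Real.rpow_natCast, sq]
  linear_combination C * tailPhi φ n * this

theorem normLp_two_of_regularlyVarying_lt (h : IsRenewalModel φ R g u)
    (hφ : WeaklyCriticalKernel φ) {α : ℝ} (hα : 0 < α) (hα1 : α < 1 / 2)
    (hrv : IsRegularlyVarying (tailPhi φ) (-α - 1)) {M : ℝ≥0∞}
    (hMt : M ≠ ∞) (hM : ∀ t, g t ≤ M) (T : ℝ) : ∃ C : ℝ, 0 < C ∧ ∀ n : ℕ, 1 ≤ n →
      normLp 2 T (rescaled R n - limitResolvent φ) ≤ ENNReal.ofReal (C * (n * tailPhi φ n)) := by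
  -- Here squares are integrated, so `2(α + δ) < 1` is required; `δ` again cancels, leaving `n³
  -- Φ(n)²`.
  obtain ⟨δ, hδ, hδ2⟩ : ∃ δ : ℝ, 0 < δ ∧ δ < min α (1 / 2 - α) := exists_between
    (lt_min hα (by linarith))
  obtain ⟨hδα, hδ1⟩ := lt_min_iff.1 hδ2
  obtain ⟨K, hK, hb⟩ := h.exists_normLp_two_le hMt hM T
  obtain ⟨C, hC, hc⟩ := h.exists_regularly_varying_bound hφ hrv hδ hδα two_ne_zero
    (by push_cast; linarith)
  refine ⟨K * √C, by positivity, fun n hn => ?_⟩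
  have hn0 : (0 : ℝ) < n := by positivity
  have hΦ := hφ.tailPhi_nonneg hn0.le
  rw [mul_assoc]
  refine hb n hn _ (by positivity) ((hc n (by exact_mod_cast hn)).trans_eq ?_)
  rw [Nat.cast_ofNat, max_eq_left (by linarith), mul_pow (√C), Real.sq_sqrt hC.le]
  congr 1
  have : ((n : ℝ) ^ (α + 1 + δ)) ^ 2 * (n : ℝ) ^ (1 - 2 * (α + δ)) = n ^ 3 := by
    rw [← Real.rpow_mul_natCast hn0.le, ← Real.rpow_add hn0,
      show (α + 1 + δ) * ((2 : ℕ) : ℝ) + (1 - 2 * (α + δ)) = ((3 : ℕ) : ℝ) by push_cast; ring,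
      Real.rpow_natCast]
  linear_combination C * tailPhi φ n ^ 2 * this

theorem normLp_two_of_regularlyVarying_ge (h : IsRenewalModel φ R g u)
    (hφ : WeaklyCriticalKernel φ) {α ℓ : ℝ} (hα : 1 / 2 ≤ α) (hℓ : 0 < ℓ) (hℓ1 : ℓ < 1 / 2)
    (hrv : IsRegularlyVarying (tailPhi φ) (-α - 1)) {M : ℝ≥0∞}
    (hMt : M ≠ ∞) (hM : ∀ t, g t ≤ M) (T : ℝ) : ∃ C : ℝ, 0 < C ∧ ∀ n : ℕ, 1 ≤ n →
      normLp 2 T (rescaled R n - limitResolvent φ) ≤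
        ENNReal.ofReal (C * ((n : ℝ) ^ (α + ℓ + 1 / 2) * tailPhi φ n)) := by
  obtain ⟨K, hK, hb⟩ := h.exists_normLp_two_le hMt hM T
  -- The choice `δ = ℓ` is admissible since `ℓ < 1/2 ≤ α`. Now `2(α + ℓ) > 1`, so the power of `n`
  -- from the integral is zero and `ℓ` stays in the rate.
  obtain ⟨C, hC, hc⟩ := h.exists_regularly_varying_bound hφ hrv hℓ (by linarith) two_ne_zero
    (by push_cast; linarith)
  refine ⟨K * √C, by positivity, fun n hn => ?_⟩
  have hn0 : (0 : ℝ) < n := by positivity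
  have hΦ := hφ.tailPhi_nonneg hn0.le
  rw [mul_assoc]
  refine hb n hn _ (by positivity) ((hc n (by exact_mod_cast hn)).trans_eq ?_)
  rw [Nat.cast_ofNat, max_eq_right (by linarith), Real.rpow_zero, mul_one, mul_pow (√C),
    Real.sq_sqrt hC.le]
  congr 1
  have : ((n : ℝ) ^ (α + 1 + ℓ)) ^ 2 = n * ((n : ℝ) ^ (α + ℓ + 1 / 2)) ^ 2 := by
    rw [← Real.rpow_mul_natCast hn0.le, ← Real.rpow_mul_natCast hn0.le, mul_comm (n : ℝ),
      ← Real.rpow_add_one hn0.ne']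
    congr 1
    push_cast
    ring
  linear_combination C * tailPhi φ n ^ 2 * this

end IsRenewalModel

/-! ### Assembly of the rates. -/

theorem ENNReal.le_ofReal_mul_of_le {x : ℝ≥0∞} {C C' b b' : ℝ} (h : x ≤ ENNReal.ofReal (C * b))
    (hC' : 0 ≤ C') (hC : C ≤ C') (hb0 : 0 ≤ b) (hb : b ≤ b') : x ≤ ENNReal.ofReal (C' * b') :=
  h.trans (ENNReal.ofReal_le_ofReal (mul_le_mul hC hb hb0 hC'))

theorem proposition2p12 (φ R : ℝ → ℝ) (hφ : WeaklyCriticalKernel φ) (hR : IsResolvent φ R) :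
    (∀ T : ℝ, 0 < T → ∃ C : ℝ, 0 < C ∧ ∀ n : ℕ, 1 ≤ n →
      (psiInfty φ 2 < ∞ →
        normLp ∞ T (integralFn (rescaled R n) - integralFn (limitResolvent φ)) ≤
          ENNReal.ofReal (C * (n : ℝ) ^ (-(1 / 3) : ℝ))) ∧
      (∀ α : ℝ, 0 < α → α < 1 → IsRegularlyVarying (tailPhi φ) (-α - 1) →
        normLp ∞ T (integralFn (rescaled R n) - integralFn (limitResolvent φ)) ≤
          ENNReal.ofReal (C * |(n : ℝ) * tailPhi φ n| ^ (1 / 3 : ℝ)))) ∧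
    (BoundedVariationOn φ (Ici 0) →
      ∀ T : ℝ, 0 < T → ∀ ℓ : ℝ, 0 < ℓ → ℓ < 1 / 2 →
        ∃ C : ℝ, 0 < C ∧ ∀ n : ℕ, 1 ≤ n →
            (psiInfty φ 2 < ∞ →
              normLp 2 T (integralFn (rescaled R n) - integralFn (limitResolvent φ)) ≤
                  ENNReal.ofReal (C * (n : ℝ) ^ (-(1 / 2) : ℝ)) ∧
                normLp 2 T (rescaled R n - limitResolvent φ) ≤
                  ENNReal.ofReal (C * (n : ℝ) ^ (-(1 / 2) : ℝ))) ∧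
            (∀ α : ℝ, 0 < α → α < 1 / 2 → IsRegularlyVarying (tailPhi φ) (-α - 1) →
              normLp 2 T (integralFn (rescaled R n) - integralFn (limitResolvent φ)) ≤
                  ENNReal.ofReal (C * ((n : ℝ) * tailPhi φ n)) ∧
                normLp 2 T (rescaled R n - limitResolvent φ) ≤
                  ENNReal.ofReal (C * ((n : ℝ) * tailPhi φ n))) ∧
            (∀ α : ℝ, 1 / 2 ≤ α → α < 1 → IsRegularlyVarying (tailPhi φ) (-α - 1) →
              normLp 2 T (integralFn (rescaled R n) - integralFn (limitResolvent φ)) ≤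
                  ENNReal.ofReal (C * ((n : ℝ) ^ (α + ℓ + 1 / 2) * tailPhi φ n)) ∧
                normLp 2 T (rescaled R n - limitResolvent φ) ≤
                  ENNReal.ofReal (C * ((n : ℝ) ^ (α + ℓ + 1 / 2) * tailPhi φ n)))) := by
  obtain ⟨g, u, h, hgM⟩ := exists_isRenewalModel hφ hR
  have hinv : ∀ n : ℕ, 1 ≤ n → ∀ a : ℝ, -1 ≤ a → (n : ℝ)⁻¹ ≤ (n : ℝ) ^ a := fun n hn a ha => by
    rw [← Real.rpow_neg_one]
    exact Real.rpow_le_rpow_of_exponent_le (by exact_mod_cast hn) ha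
  have hσ := h.dispersion_pos
  have hnΦ : ∀ n : ℕ, 0 ≤ (n : ℝ) * tailPhi φ n := fun n =>
    mul_nonneg (Nat.cast_nonneg n) (hφ.tailPhi_nonneg (Nat.cast_nonneg n))
  refine ⟨fun T _ => ?_, fun hbv T _ ℓ hℓ hℓ1 => ?_⟩
  · obtain ⟨C₁, hC₁, h₁⟩ : ∃ C : ℝ, 0 < C ∧ ∀ n : ℕ, 1 ≤ n → psiInfty φ 2 < ∞ →
        normLp ∞ T (integralFn (rescaled R n) - integralFn (limitResolvent φ)) ≤
          ENNReal.ofReal (C * (n : ℝ) ^ (-(1 / 3) : ℝ)) := by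
      by_cases hΨ : psiInfty φ 2 < ∞
      · obtain ⟨C, hC, hb⟩ := h.normLp_integral_of_moment hΨ ∞ T
        exact ⟨C, hC, fun n hn _ => ENNReal.le_ofReal_mul_of_le (hb n hn) hC.le le_rfl
          (by positivity) (hinv n hn _ (by norm_num))⟩
      · exact ⟨1, one_pos, fun n _ hΨ' => absurd hΨ' hΨ⟩
    obtain ⟨C₂, hC₂, h₂⟩ : ∃ C : ℝ, 0 < C ∧ ∀ n : ℕ, 1 ≤ n →
        ∀ α : ℝ, 0 < α → α < 1 → IsRegularlyVarying (tailPhi φ) (-α - 1) →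
        normLp ∞ T (integralFn (rescaled R n) - integralFn (limitResolvent φ)) ≤
          ENNReal.ofReal (C * |(n : ℝ) * tailPhi φ n| ^ (1 / 3 : ℝ)) := by
      -- The constant must be chosen before `α`. The rate does not mention `α`, so the constant of
      -- any one admissible index serves for all.
      by_cases hex : ∃ α : ℝ, 0 < α ∧ α < 1 ∧ IsRegularlyVarying (tailPhi φ) (-α - 1)
      · obtain ⟨α, hα, hα1, hrv⟩ := hex
        obtain ⟨C, hC, hb⟩ := h.normLp_integral_of_regularlyVarying hφ hα hα1 hrv ∞ T
        -- Since `y = nΦ(n)` is at most `σ`, the linear rate implies the cube-root one: `y ≤ σ^{2/3}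
        -- y^{1/3}`.
        refine ⟨C * dispersion φ ^ (2 / 3 : ℝ), by positivity, fun n hn _ _ _ _ =>
          (hb n hn).trans (ENNReal.ofReal_le_ofReal ?_)⟩
        rw [abs_of_nonneg (hnΦ n), mul_assoc]
        refine mul_le_mul_of_nonneg_left ?_ hC.le
        have hy := hnΦ n
        have hyσ := h.mul_tailPhi_le hφ (Nat.cast_nonneg n)
        set y := (n : ℝ) * tailPhi φ n
        calc y = y ^ (2 / 3 : ℝ) * y ^ (1 / 3 : ℝ) := by
              rw [← Real.rpow_add' hy (by norm_num), show (2 / 3 + 1 / 3 : ℝ) = 1 by norm_num,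
                Real.rpow_one]
          _ ≤ _ := by gcongr
      · exact ⟨1, one_pos, fun n _ α hα hα1 hrv => absurd ⟨α, hα, hα1, hrv⟩ hex⟩
    refine ⟨C₁ + C₂, by positivity, fun n hn => ⟨fun hΨ => ?_, fun α hα hα1 hrv => ?_⟩⟩
    · exact ENNReal.le_ofReal_mul_of_le (h₁ n hn hΨ) (by positivity) (by linarith) (by positivity)
        le_rfl
    · exact ENNReal.le_ofReal_mul_of_le (h₂ n hn α hα hα1 hrv) (by positivity) (by linarith)
        (by positivity) le_rfl
  -- Bounded variation bounds the kernel by its value at zero plus its total variation.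
  · obtain ⟨M, hMt, hM⟩ : ∃ M : ℝ≥0∞, M ≠ ∞ ∧ ∀ t, g t ≤ M := by
      refine ⟨_, ENNReal.ofReal_ne_top, hgM (φ 0 + (eVariationOn φ (Ici 0)).toReal)
        fun t ht => ?_⟩
      linarith [hbv.sub_le (mem_Ici.2 ht) (mem_Ici.2 le_rfl)]
    obtain ⟨C₁, hC₁, h₁⟩ : ∃ C : ℝ, 0 < C ∧ ∀ n : ℕ, 1 ≤ n → psiInfty φ 2 < ∞ →
        normLp 2 T (integralFn (rescaled R n) - integralFn (limitResolvent φ)) ≤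
          ENNReal.ofReal (C * (n : ℝ) ^ (-(1 / 2) : ℝ)) ∧
        normLp 2 T (rescaled R n - limitResolvent φ) ≤
          ENNReal.ofReal (C * (n : ℝ) ^ (-(1 / 2) : ℝ)) := by
      by_cases hΨ : psiInfty φ 2 < ∞
      · obtain ⟨C, hC, hb⟩ := h.normLp_integral_of_moment hΨ 2 T
        obtain ⟨C', hC', hb'⟩ := h.normLp_two_of_moment hΨ hMt hM T
        exact ⟨C + C', by positivity, fun n hn _ =>
          ⟨ENNReal.le_ofReal_mul_of_le (hb n hn) (by positivity) (by linarith)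
            (by positivity) (hinv n hn _ (by norm_num)),
          ENNReal.le_ofReal_mul_of_le (hb' n hn) (by positivity) (by linarith)
            (by positivity) le_rfl⟩⟩
      · exact ⟨1, one_pos, fun n _ hΨ' => absurd hΨ' hΨ⟩
    obtain ⟨C₂, hC₂, h₂⟩ : ∃ C : ℝ, 0 < C ∧ ∀ n : ℕ, 1 ≤ n →
        ∀ α : ℝ, 0 < α → α < 1 / 2 → IsRegularlyVarying (tailPhi φ) (-α - 1) →
        normLp 2 T (integralFn (rescaled R n) - integralFn (limitResolvent φ)) ≤
          ENNReal.ofReal (C * ((n : ℝ) * tailPhi φ n)) ∧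
        normLp 2 T (rescaled R n - limitResolvent φ) ≤
          ENNReal.ofReal (C * ((n : ℝ) * tailPhi φ n)) := by
      by_cases hex : ∃ α : ℝ, 0 < α ∧ α < 1 / 2 ∧ IsRegularlyVarying (tailPhi φ) (-α - 1)
      · obtain ⟨α, hα, hα1, hrv⟩ := hex
        obtain ⟨C, hC, hb⟩ :=
          h.normLp_integral_of_regularlyVarying hφ hα (by linarith) hrv 2 T
        obtain ⟨C', hC', hb'⟩ := h.normLp_two_of_regularlyVarying_lt hφ hα hα1 hrv hMt hM T
        exact ⟨C + C', by positivity, fun n hn _ _ _ _ =>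
          ⟨ENNReal.le_ofReal_mul_of_le (hb n hn) (by positivity) (by linarith) (hnΦ n) le_rfl,
          ENNReal.le_ofReal_mul_of_le (hb' n hn) (by positivity) (by linarith) (hnΦ n) le_rfl⟩⟩
      · exact ⟨1, one_pos, fun n _ α hα hα1 hrv => absurd ⟨α, hα, hα1, hrv⟩ hex⟩
    have hpow : ∀ n : ℕ, ∀ α : ℝ, 0 ≤ (n : ℝ) ^ (α + ℓ + 1 / 2) * tailPhi φ n := fun n α =>
      mul_nonneg (by positivity) (hφ.tailPhi_nonneg (Nat.cast_nonneg n))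
    obtain ⟨C₃, hC₃, h₃⟩ : ∃ C : ℝ, 0 < C ∧ ∀ n : ℕ, 1 ≤ n →
        ∀ α : ℝ, 1 / 2 ≤ α → α < 1 → IsRegularlyVarying (tailPhi φ) (-α - 1) →
        normLp 2 T (integralFn (rescaled R n) - integralFn (limitResolvent φ)) ≤
          ENNReal.ofReal (C * ((n : ℝ) ^ (α + ℓ + 1 / 2) * tailPhi φ n)) ∧
        normLp 2 T (rescaled R n - limitResolvent φ) ≤
          ENNReal.ofReal (C * ((n : ℝ) ^ (α + ℓ + 1 / 2) * tailPhi φ n)) := by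
      by_cases hex : ∃ α : ℝ, 1 / 2 ≤ α ∧ α < 1 ∧ IsRegularlyVarying (tailPhi φ) (-α - 1)
      · obtain ⟨α, hα, hα1, hrv⟩ := hex
        obtain ⟨C, hC, hb⟩ :=
          h.normLp_integral_of_regularlyVarying hφ (by linarith) hα1 hrv 2 T
        obtain ⟨C', hC', hb'⟩ := h.normLp_two_of_regularlyVarying_ge hφ hα hℓ hℓ1 hrv hMt hM T
        refine ⟨C + C', by positivity, fun n hn α' _ _ hrv' => ?_⟩
        -- In this regime the rate itself depends on `α`, so uniqueness of the index is what allows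
        -- one constant for all `α`.
        obtain rfl : α = α' := by linarith [hrv.index_unique hrv']
        refine ⟨ENNReal.le_ofReal_mul_of_le (hb n hn) (by positivity) (by linarith) (hnΦ n) ?_,
          ENNReal.le_ofReal_mul_of_le (hb' n hn) (by positivity) (by linarith) (hpow n α) le_rfl⟩
        refine mul_le_mul_of_nonneg_right ?_ (hφ.tailPhi_nonneg (Nat.cast_nonneg n))
        calc (n : ℝ) = (n : ℝ) ^ (1 : ℝ) := (Real.rpow_one _).symm
          _ ≤ _ := Real.rpow_le_rpow_of_exponent_le (by exact_mod_cast hn) (by linarith)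
      · exact ⟨1, one_pos, fun n _ α hα hα1 hrv => absurd ⟨α, hα, hα1, hrv⟩ hex⟩
    refine ⟨C₁ + C₂ + C₃, by positivity, fun n hn => ⟨fun hΨ => ?_, fun α hα hα1 hrv => ?_,
      fun α hα hα1 hrv => ?_⟩⟩
    · exact ⟨ENNReal.le_ofReal_mul_of_le (h₁ n hn hΨ).1 (by positivity) (by linarith)
        (by positivity) le_rfl, ENNReal.le_ofReal_mul_of_le (h₁ n hn hΨ).2 (by positivity)
        (by linarith) (by positivity) le_rfl⟩
    · have hb := h₂ n hn α hα hα1 hrv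
      exact ⟨ENNReal.le_ofReal_mul_of_le hb.1 (by positivity) (by linarith) (hnΦ n) le_rfl,
        ENNReal.le_ofReal_mul_of_le hb.2 (by positivity) (by linarith) (hnΦ n) le_rfl⟩
    · have hb := h₃ n hn α hα hα1 hrv
      exact ⟨ENNReal.le_ofReal_mul_of_le hb.1 (by positivity) (by linarith) (hpow n α) le_rfl,
        ENNReal.le_ofReal_mul_of_le hb.2 (by positivity) (by linarith) (hpow n α) le_rfl⟩
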